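/- **Setting.** Let $\mathbf P$ be a nonempty class of data-generating processes. Let $\Theta$ be a parameter space of pairs $\theta=(\mu,\eta)$, $M=\{\mu:(\mu,\eta)\in\Theta\text{ for some }\eta\}$, $H_\mu=\{\eta:(\mu,\eta)\in\Theta\}$, $L(\cdot;\mathbb P)$ the population criterion, $\Theta_I(\mathbb P)=\arg\max_\Theta L(\cdot;\mathbb P)\neq\emptyset$ and $M_I(\mathbb P)=\{\mu:(\mu,\eta)\in\Theta_I(\mathbb P)\text{ for some }\eta\}$. Let $L_n$ be a sample criterion (the value $-\infty$ is allowed), measurable in $\theta$, $\Pi$ a (possibly improper) prior and $d\Pi_n(\theta)\propto e^{nL_n(\theta)}d\Pi(\theta)$ the quasi-posterior. For a point $\hat\theta$ put $Q_n(\theta)=2n[L_n(\hat\theta)-L_n(\theta)]$, and for a set $A\subseteq M$ put $PL_n(A)=\inf_{\mu\in A}\sup_{\eta\in H_\mu}L_n(\mu,\eta)$ and $PQ_n(A)=2n[L_n(\hat\theta)-PL_n(A)]$. Let $\Delta(\theta)$ be the set of parameters observationally equivalent to $\theta$ (equal model density, resp. equal moments), $M(\theta)=\{\mu:(\mu,\eta)\in\Delta(\theta)\text{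 for some }\eta\}$. Given Monte Carlo draws $\theta^1,\dots,\theta^B$, let $\xi^{mc}_{n,\alpha}$ and $\xi^{mc,p}_{n,\alpha}$ be the $\alpha$ quantiles of $Q_n(\theta^b)$ and of $PQ_n(M(\theta^b))$, $b\le B$, and let $\xi^{post}_{n,\alpha}$ and $\xi^{post,p}_{n,\alpha}$ be the $\alpha$ quantiles of $Q_n(\theta)$ and $PQ_n(M(\theta))$ under $\Pi_n$. Procedures 1 and 2 are $$\hat\Theta_\alpha=\{\theta\in\Theta:Q_n(\theta)\le\xi^{mc}_{n,\alpha}\},\qquad \hat M_\alpha=\{\mu\in M:\inf_{\eta\in H_\mu}Q_n(\mu,\eta)\le\xi^{mc,p}_{n,\alpha}\}.$$ "$o_{\mathbb P}(1)$ uniformly" means $\sup_{\mathbb P}\mathbb P(|\upsilon_n|>\epsilon)\to0$ for all $\epsilon>0$; $O_{\mathbb P}(1)$ uniformly is analogous. **Assumptions.** Objects below may depend on $\mathbb P$. There are measurable sets $\Theta_{osn}$ with $\Theta_I\subseteq\Theta_{osn}$ and a measurable neighborhood $\Theta_I^N$, with $\Theta_{osn}\subseteq\Theta_I^N$ for all $\mathbb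 P$ once $n$ is large; a measurable map $(\gamma,\gamma_\perp):\Theta_I^N\to\Gamma\times\Gamma_\perp\subseteq\mathbb R^{d^*}\times\mathbb R^m$ that vanishes exactly on $\Theta_I$, with $1\le d^*\le\bar d$, $\bar d$ independent of $\mathbb P$ ($\mathbb P$ is nonsingular if $m=0$, i.e. $\gamma_\perp$ is absent, and singular otherwise); a closed convex cone $T\subseteq\mathbb R^{d^*}$ with metric projection $\mathbf T$; and numbers $k_n$ with $\inf_{\mathbb P}k_n\to\infty$. The sets $\Gamma$, $\Gamma_\perp$ and $\gamma_\perp(\Theta_{osn})$ are measurable. For all large $n$ and all $\mathbb P$, membership of $\theta\in\Theta_I^N$ in $\Theta_{osn}$ depends only on $(\gamma(\theta),\gamma_\perp(\theta))$ as long as $\|\sqrt n\gamma(\theta)\|\le k_n$. Moreover: 1. (Consistency, contraction) $L_n(\hat\theta)=\sup_{\Theta_{osn}}L_n+o_{\mathbb P}(n^{-1})$ and $\Pi_n(\Theta_{osn}^c)=o_{\mathbb P}(1)$, uniformly. 2. (Quadratic expansion with drift) There are $\tau\in T$, random $\ell_n$, random vectors $\mathbb V_n=O_{\mathbb P}(1)$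 uniformly, $\hat\gamma_n$ with $\sqrt n\hat\gamma_n=\mathbf T(\mathbb V_n+\sqrt n\tau)$, and measurable $f_{n,\perp}:\Gamma_\perp\to[0,\infty)$ with $f_{n,\perp}(0)=0$ such that, uniformly, $$\sup_{\theta\in\Theta_{osn}}\Big|nL_n(\theta)-\Big(\ell_n+\tfrac12\|\sqrt n(\hat\gamma_n-\tau)\|^2-\tfrac12\|\sqrt n(\hat\gamma_n-\tau-\gamma(\theta))\|^2-f_{n,\perp}(\gamma_\perp(\theta))\Big)\Big|=o_{\mathbb P}(1),$$ $\sup_{\mathbb P}\sup_{\Theta_{osn}}\|(\gamma,\gamma_\perp)\|\to0$; for all large $n$ and all $\mathbb P$, $\{\sqrt n\gamma(\theta):\theta\in\Theta_{osn}\}\cap B_{k_n}=(T-\sqrt n\tau)\cap B_{k_n}$, and, for singular $\mathbb P$, the image of $\Theta_{osn}$ under $(\gamma,\gamma_\perp)$ is the product of its images under $\gamma$ and $\gamma_\perp$; and $\inf_{\mathbb P}\mathbb P_Z(Z\in T)>0$, where $Z\sim N(0,I_{d^*})$ under $\mathbb P_Z$. 3. (Prior) $\int e^{nL_n}d\Pi<\infty$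 $\mathbb P$-a.s. for each $\mathbb P$ and $n\ge1$; for some $\delta>0$ independent of $\mathbb P$, the image of $\Pi$ on $\Theta_I^N$ under $(\gamma,\gamma_\perp)$ has a Lebesgue density on $B_\delta\cap(\Gamma\times\Gamma_\perp)$ that is positive and continuous at the origin, both uniformly in $\mathbb P$. Let $0<\alpha<1$. **Theorem A (Procedure 1).** Assume 1–3, $\xi^{mc}_{n,\alpha}=\xi^{post}_{n,\alpha}+o_{\mathbb P}(1)$ uniformly, and $\sup_{\mathbb P}\sup_z|\mathbb P(\|\mathbf T\mathbb V_n\|^2\le z)-\mathbb P_Z(\|\mathbf TZ\|^2\le z)|\to0$. (i) If $\|\mathbf T(\mathbb V_n+\sqrt n\tau)-\sqrt n\tau\|^2\le\|\mathbf T\mathbb V_n\|^2$ a.s. for each $\mathbb P$ and $n\ge 1$, then $\liminf_n\inf_{\mathbb P}\mathbb P(\Theta_I(\mathbb P)\subseteq\hat\Theta_\alpha)\ge\alpha$. (ii) If no $\mathbb P$ is singular and $T=\mathbb R^{d^*}$ for each $\mathbb P$, then $\liminf_n\inf_{\mathbb P}\mathbb P(\Theta_I(\mathbb P)\subseteq\hat\Theta_\alpha)=\alpha$.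 **Theorem B (Procedure 2).** Assume 1–3, $M(\theta)=M_I(\mathbb P)$ for all $\theta\in\Theta_I(\mathbb P)$, $\xi^{mc,p}_{n,\alpha}=\xi^{post,p}_{n,\alpha}+o_{\mathbb P}(1)$ uniformly, and that for each $\mathbb P$ there is a measurable $f:\mathbb R^{d^*}\to\mathbb R$ such that: (a) $\sup_{\theta\in\Theta_{osn}}|nPL_n(M(\theta))-(\ell_n+\frac12\|\sqrt n(\hat\gamma_n-\tau)\|^2-\frac12f(\sqrt n(\hat\gamma_n-\tau-\gamma(\theta))))|=o_{\mathbb P}(1)$ uniformly; (b) $f(\mathbf T(\mathbb V_n+\sqrt n\tau)-\sqrt n\tau)\le f(\mathbb V_n)$ a.s. for each $n\ge 1$; (c) $\mathbb P_Z(f(Z)\le z\mid Z\in v-T)\le\mathbb P_Z(f(Z)\le z)$ for all $z$ and all $v\in T$; (d) $\sup_{\mathbb P}\sup_z|\mathbb P(f(\mathbb V_n)\le z)-G_{\mathbb P}(z)|\to0$ with $G_{\mathbb P}(z)=\mathbb P_Z(f(Z)\le z)$; (e) with $\xi_{\mathbb P}=\inf\{z:G_{\mathbb P}(z)\ge\alpha\}$,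 for each $\epsilon>0$ there is $\delta>0$ with $G_{\mathbb P}(\xi_{\mathbb P}-\epsilon)<\alpha-\delta$ for all $\mathbb P$, and $\inf_{\mathbb P}G_{\mathbb P}(\xi_{\mathbb P}-\epsilon)\to\alpha$ as $\epsilon\downarrow0$. (i) Then $\liminf_n\inf_{\mathbb P}\mathbb P(M_I(\mathbb P)\subseteq\hat M_\alpha)\ge\alpha$. (ii) If (b) and (c) hold with equality for each $\mathbb P$ (in (c), for all $z$ and $v$), and if $G_{\mathbb P}(\xi_{\mathbb P})=\alpha$ and $G_{\mathbb P}(z)>\alpha$ for $z>\xi_{\mathbb P}$ for each $\mathbb P$, then $\liminf_n\inf_{\mathbb P}\mathbb P(M_I(\mathbb P)\subseteq\hat M_\alpha)=\alpha$. (If coverage events are not measurable, $\mathbb P$ in the conclusions may be read as inner probability, and in the equalities as either inner or outer probability.) -/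

import Mathlib

open MeasureTheory ProbabilityTheory Filter Topology
open scoped ENNReal

noncomputable section

namespace QuasiPosterior

/-! ### General notions -/

/-- Uniform `o_P(1)` over a family of probability measures (outer probability is used, so that
no measurability of `v` is needed): `sup_i P_i (v n i > ε) → 0` for every `ε > 0`. -/
def UnifLittleO {Ω ι : Type*} [MeasurableSpace Ω] (P : ι → Measure Ω)
    (v : ℕ → ι → Ω → ℝ≥0∞) : Prop :=
  ∀ ε : ℝ, 0 < ε →
    Tendsto (fun n => ⨆ i, P i {ω | ENNReal.ofReal ε < v n i ω}) atTop (𝓝 0)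

/-- Uniform `O_P(1)` over a family of probability measures. -/
def UnifBigO {Ω ι : Type*} [MeasurableSpace Ω] (P : ι → Measure Ω)
    (v : ℕ → ι → Ω → ℝ) : Prop :=
  ∀ ε : ℝ, 0 < ε → ∃ C : ℝ, ∀ᶠ n in atTop, ∀ i, P i {ω | C < |v n i ω|} ≤ ENNReal.ofReal ε

/-- Inner probability of an event; it is `P A` for measurable `A`. -/
def innerProb {Ω : Type*} [MeasurableSpace Ω] (P : Measure Ω) (A : Set Ω) : ℝ≥0∞ := 1 - P Aᶜ

/-- The `α` quantile `inf {c | α ≤ μ (X ≤ c)}` of an extended real function `X` under `μ`. -/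
def quantile {S : Type*} [MeasurableSpace S] (μ : Measure S) (X : S → EReal) (α : ℝ) : EReal :=
  sInf {c : EReal | ENNReal.ofReal α ≤ μ {s | X s ≤ c}}

/-- The `α` quantile of a finite sample `x 0, …, x (B - 1)`. -/
def sampleQuantile {B : ℕ} (x : Fin B → EReal) (α : ℝ) : EReal :=
  sInf {c : EReal | α * (B : ℝ) ≤ (Nat.card {b : Fin B // x b ≤ c} : ℝ)}

/-- The metric projection `argmin_{t ∈ T} ‖v - t‖` onto a closed convex cone `T`. -/
def coneProj {E : Type*} [NormedAddCommGroup E] [InnerProductSpace ℝ E] [CompleteSpace E]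
    (T : ProperCone ℝ E) (v : E) : E :=
  Classical.choose
    (exists_norm_eq_iInf_of_complete_convex T.nonempty T.isClosed.isComplete T.convex v)

theorem coneProj_spec {E : Type*} [NormedAddCommGroup E] [InnerProductSpace ℝ E]
    [CompleteSpace E] (T : ProperCone ℝ E) (v : E) :
    coneProj T v ∈ (T : Set E) ∧ ‖v - coneProj T v‖ = ⨅ w : (T : Set E), ‖v - w‖ :=
  Classical.choose_spec
    (exists_norm_eq_iInf_of_complete_convex T.nonempty T.isClosed.isComplete T.convex v)

/-- `ℝ^d` with the Euclidean norm. -/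
abbrev Eu (d : ℕ) : Type := EuclideanSpace ℝ (Fin d)

/-- The standard Gaussian measure `N(0, I_d)` on `ℝ^d`. -/
abbrev gauss (d : ℕ) : Measure (Eu d) := stdGaussian (Eu d)

/-- The distribution function of `g(Z)` with `Z ∼ N(0, I_d)`. -/
def gaussCdf {d : ℕ} (g : Eu d → ℝ) (z : ℝ) : ℝ := (gauss d).real {x | g x ≤ z}

/-- The `α` quantile of `g(Z)` with `Z ∼ N(0, I_d)`. -/
def gaussQuantile {d : ℕ} (g : Eu d → ℝ) (α : ℝ) : ℝ := sInf {z : ℝ | α ≤ gaussCdf g z}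

/-- The distribution function of `g(Z)` conditional on `Z ∈ v - T`. -/
def gaussCdfOn {d : ℕ} (g : Eu d → ℝ) (T : ProperCone ℝ (Eu d)) (v : Eu d) (z : ℝ) : ℝ :=
  (ProbabilityTheory.cond (gauss d) {x | ∃ t ∈ T, x = v - t}).real {x | g x ≤ z}

/-! ### The model, the quasi-posterior and the two procedures -/

/-- A class of data-generating processes `P i`, `i : ι`, on a sample space `Ω` (which carries the
data of every sample size and the Monte Carlo randomness), together with the ingredients of the
procedures. A parameter is a pair `θ = (μ, η)` in the parameter space `Θ`. -/
structure Model (Ω ι 𝓜 𝓗 D : Type*) [MeasurableSpace Ω] [MeasurableSpace 𝓜]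
    [MeasurableSpace 𝓗] where
  /-- the data-generating processes -/
  P : ι → Measure Ω
  isProb : ∀ i, IsProbabilityMeasure (P i)
  /-- the parameter space -/
  Θ : Set (𝓜 × 𝓗)
  /-- the population objective function under `P i` -/
  L : ι → Θ → EReal
  /-- the sample objective function; a log-likelihood may take the value `-∞` -/
  Ln : ℕ → Ω → Θ → EReal
  measurable_Ln : ∀ n ω, Measurable (Ln n ω)
  /-- the prior, possibly improper -/
  prior : Measure Θ
  /-- the approximate maximizer `θ̂` -/
  thetaHat : ℕ → Ω → Θ
  /-- the number of Monte Carlo draws -/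
  B : ℕ → ℕ
  B_pos : ∀ n, 0 < B n
  /-- the Monte Carlo draws -/
  draw : (n : ℕ) → Ω → Fin (B n) → Θ
  /-- the function of `θ` that defines observational equivalence under `P i`: `θ ↦ p_θ` in a
  likelihood model, `θ ↦ E_{P i}[ρ(X, θ)]` in a moment model -/
  equiv : ι → Θ → D
  /-- the identified sets are not empty -/
  nonempty_ΘI : ∀ i, ∃ θ, L i θ = ⨆ ϑ, L i ϑ

namespace Model

variable {Ω ι 𝓜 𝓗 D : Type*} [MeasurableSpace Ω] [MeasurableSpace 𝓜] [MeasurableSpace 𝓗]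
variable (S : Model Ω ι 𝓜 𝓗 D)

/-- The identified set `Θ_I(P i)`. -/
def ΘI (i : ι) : Set S.Θ := {θ | S.L i θ = ⨆ ϑ, S.L i ϑ}

/-- The set of subvectors `μ` of the parameters in `A`. -/
def sub (A : Set S.Θ) : Set 𝓜 := {μ | ∃ η, ∃ h : (μ, η) ∈ S.Θ, (⟨(μ, η), h⟩ : S.Θ) ∈ A}

/-- The identified set `M_I(P i)` of the subvector. -/
def MI (i : ι) : Set 𝓜 := S.sub (S.ΘI i)

/-- The equivalence set `Δ(θ)`. -/
def Δ (i : ι) (θ : S.Θ) : Set S.Θ := {ϑ | S.equiv i ϑ = S.equiv i θ}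

/-- The set `M(θ)` of subvectors of the parameters that are equivalent to `θ`. -/
def Mset (i : ι) (θ : S.Θ) : Set 𝓜 := S.sub (S.Δ i θ)

/-- The weight `e^{n L_n(θ)}`. -/
def weight (n : ℕ) (ω : Ω) (θ : S.Θ) : ℝ≥0∞ := EReal.exp ((n : EReal) * S.Ln n ω θ)

/-- The quasi-posterior `Π_n(· | X_n)`. -/
def posterior (n : ℕ) (ω : Ω) : Measure S.Θ :=
  (∫⁻ θ, S.weight n ω θ ∂S.prior)⁻¹ • S.prior.withDensity (S.weight n ω)

/-- The quasi-likelihood ratio `Q_n(θ) = 2n (L_n(θ̂) - L_n(θ))`. -/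
def Qn (n : ℕ) (ω : Ω) (θ : S.Θ) : EReal :=
  ((2 * n : ℝ) : EReal) * (S.Ln n ω (S.thetaHat n ω) - S.Ln n ω θ)

/-- The profile criterion `PL_n(A) = inf_{μ ∈ A} sup_{η ∈ H_μ} L_n(μ, η)` of a set `A`. -/
def PLn (n : ℕ) (ω : Ω) (A : Set 𝓜) : EReal :=
  ⨅ μ ∈ A, ⨆ η : {η : 𝓗 // (μ, η) ∈ S.Θ}, S.Ln n ω ⟨(μ, η.1), η.2⟩

/-- The profile quasi-likelihood ratio `PQ_n(A) = 2n (L_n(θ̂) - PL_n(A))` of a set `A`. -/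
def PQn (n : ℕ) (ω : Ω) (A : Set 𝓜) : EReal :=
  ((2 * n : ℝ) : EReal) * (S.Ln n ω (S.thetaHat n ω) - S.PLn n ω A)

/-- The `α` quantile of `Q_n` under the quasi-posterior. -/
def ξpost (α : ℝ) (n : ℕ) (ω : Ω) : EReal := quantile (S.posterior n ω) (S.Qn n ω) α

/-- The `α` quantile of `Q_n` over the Monte Carlo draws. -/
def ξmc (α : ℝ) (n : ℕ) (ω : Ω) : EReal :=
  sampleQuantile (fun b => S.Qn n ω (S.draw n ω b)) α

/-- The `α` quantile of `PQ_n(M(θ))` under the quasi-posterior. -/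
def ξpostp (α : ℝ) (n : ℕ) (i : ι) (ω : Ω) : EReal :=
  quantile (S.posterior n ω) (fun θ => S.PQn n ω (S.Mset i θ)) α

/-- The `α` quantile of `PQ_n(M(θ))` over the Monte Carlo draws. -/
def ξmcp (α : ℝ) (n : ℕ) (i : ι) (ω : Ω) : EReal :=
  sampleQuantile (fun b => S.PQn n ω (S.Mset i (S.draw n ω b))) α

/-- The confidence set of Procedure 1. -/
def ΘHat (α : ℝ) (n : ℕ) (ω : Ω) : Set S.Θ := {θ | S.Qn n ω θ ≤ S.ξmc α n ω}

/-- The confidence set of Procedure 2 (it involves `i` only through the equivalence sets). -/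
def MHat (α : ℝ) (n : ℕ) (i : ι) (ω : Ω) : Set 𝓜 :=
  {μ | (∃ η, (μ, η) ∈ S.Θ) ∧
    ⨅ η : {η : 𝓗 // (μ, η) ∈ S.Θ}, S.Qn n ω ⟨(μ, η.1), η.2⟩ ≤ S.ξmcp α n i ω}

/-- The event that the Procedure 1 set covers `Θ_I(P i)`. -/
def coverΘ (α : ℝ) (n : ℕ) (i : ι) : Set Ω := {ω | S.ΘI i ⊆ S.ΘHat α n ω}

/-- The event that the Procedure 2 set covers `M_I(P i)`. -/
def coverM (α : ℝ) (n : ℕ) (i : ι) : Set Ω := {ω | S.MI i ⊆ S.MHat α n i ω}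

end Model

/-! ### Local reduced-form reparameterization -/

/-- The objects in the local expansion of the criterion under each `P i`. The singular part
`γ_⊥` takes values in `ℝ^m`; the process `P i` is nonsingular iff `m i = 0` (then `γ_⊥ ≡ 0`). -/
structure LocalExpansion {Ω ι 𝓜 𝓗 D : Type*} [MeasurableSpace Ω] [MeasurableSpace 𝓜]
    [MeasurableSpace 𝓗] (S : Model Ω ι 𝓜 𝓗 D) where
  /-- the dimension `d*` of `γ` -/
  d : ι → ℕ
  /-- the dimension of `γ_⊥` -/
  m : ι → ℕ
  /-- the fixed neighborhood of `Θ_I` on which the reparameterization is defined -/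
  ΘN : ι → Set S.Θ
  /-- the local neighborhoods `Θ_osn` of `Θ_I` -/
  Θosn : ℕ → ι → Set S.Θ
  γ : (i : ι) → S.Θ → Eu (d i)
  γperp : (i : ι) → S.Θ → Eu (m i)
  Γ : (i : ι) → Set (Eu (d i))
  Γperp : (i : ι) → Set (Eu (m i))
  /-- the closed convex cone `T` -/
  T : (i : ι) → ProperCone ℝ (Eu (d i))
  /-- the drift -/
  τ : (i : ι) → Eu (d i)
  V : (n : ℕ) → (i : ι) → Ω → Eu (d i)
  ell : ℕ → ι → Ω → ℝ
  fperp : (n : ℕ) → (i : ι) → Ω → Eu (m i) → ℝ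
  k : ℕ → ι → ℝ

namespace LocalExpansion

variable {Ω ι 𝓜 𝓗 D : Type*} [MeasurableSpace Ω] [MeasurableSpace 𝓜] [MeasurableSpace 𝓗]
variable {S : Model Ω ι 𝓜 𝓗 D} (R : LocalExpansion S)

/-- The map `θ ↦ (γ(θ), γ_⊥(θ))`. -/
def γstar (i : ι) (θ : S.Θ) : Eu (R.d i) × Eu (R.m i) := (R.γ i θ, R.γperp i θ)

/-- The projection onto the cone `T`. -/
def proj (i : ι) (v : Eu (R.d i)) : Eu (R.d i) := coneProj (R.T i) v

/-- `γ̂_n`, determined by `√n γ̂_n = 𝐓(V_n + √n τ)`. -/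
def γhat (n : ℕ) (i : ι) (ω : Ω) : Eu (R.d i) :=
  (√(n : ℝ))⁻¹ • R.proj i (R.V n i ω + √(n : ℝ) • R.τ i)

/-- The local quadratic approximation of `n L_n(θ)`. -/
def quadApprox (n : ℕ) (i : ι) (ω : Ω) (θ : S.Θ) : ℝ :=
  R.ell n i ω + 1 / 2 * ‖√(n : ℝ) • (R.γhat n i ω - R.τ i)‖ ^ 2
    - 1 / 2 * ‖√(n : ℝ) • (R.γhat n i ω - R.τ i - R.γ i θ)‖ ^ 2
    - R.fperp n i ω (R.γperp i θ)

/-- The local approximation of `n PL_n(M(θ))`. -/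
def profileApprox (f : (i : ι) → Eu (R.d i) → ℝ) (n : ℕ) (i : ι) (ω : Ω) (θ : S.Θ) : ℝ :=
  R.ell n i ω + 1 / 2 * ‖√(n : ℝ) • (R.γhat n i ω - R.τ i)‖ ^ 2
    - 1 / 2 * f i (√(n : ℝ) • (R.γhat n i ω - R.τ i - R.γ i θ))

/-- The image measure of the prior on `Θ_I^N` under `θ ↦ (γ(θ), γ_⊥(θ))`. -/
def priorImage (i : ι) : Measure (Eu (R.d i) × Eu (R.m i)) :=
  (S.prior.restrict (R.ΘN i)).map (R.γstar i)

/-- The local reduced-form reparameterization and the neighborhoods `Θ_osn`. -/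
structure Reparam : Prop where
  /-- the dimension of `γ` lies between `1` and a bound that is uniform in `P` -/
  dim : ∃ dmax : ℕ, ∀ i, 1 ≤ R.d i ∧ R.d i ≤ dmax
  measurableSet_ΘN : ∀ i, MeasurableSet (R.ΘN i)
  measurableSet_Θosn : ∀ n i, MeasurableSet (R.Θosn n i)
  measurable_γ : ∀ i, Measurable (R.γ i)
  measurable_γperp : ∀ i, Measurable (R.γperp i)
  measurableSet_Γ : ∀ i, MeasurableSet (R.Γ i)
  measurableSet_Γperp : ∀ i, MeasurableSet (R.Γperp i)
  measurableSet_image : ∀ n i, MeasurableSet (R.γperp i '' R.Θosn n i)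
  ΘI_subset : ∀ n i, S.ΘI i ⊆ R.Θosn n i
  subset_ΘN : ∀ᶠ n in atTop, ∀ i, R.Θosn n i ⊆ R.ΘN i
  mapsTo_γ : ∀ i, ∀ θ ∈ R.ΘN i, R.γ i θ ∈ R.Γ i ∧ R.γperp i θ ∈ R.Γperp i
  zero_iff : ∀ i, ∀ θ ∈ R.ΘN i, R.γstar i θ = 0 ↔ θ ∈ S.ΘI i
  /-- within the radius `k_n`, membership in `Θ_osn` depends on `θ` only through the
  reduced-form parameter -/
  saturated : ∀ᶠ n in atTop, ∀ i, ∀ ϑ ∈ R.Θosn n i, ∀ θ ∈ R.ΘN i,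
    R.γstar i θ = R.γstar i ϑ → ‖√(n : ℝ) • R.γ i θ‖ ≤ R.k n i → θ ∈ R.Θosn n i

/-- Consistency and posterior contraction, uniformly. -/
structure Contraction : Prop where
  consistent : UnifLittleO S.P fun n i ω =>
    (n : ℝ≥0∞) *
      (S.Ln n ω (S.thetaHat n ω) - ⨆ θ : R.Θosn n i, S.Ln n ω θ.1).abs
  contract : UnifLittleO S.P fun n i ω => S.posterior n ω (R.Θosn n i)ᶜ

/-- Local quadratic approximation, uniformly, with drift `τ` and possibly singular. -/
structure Quad : Prop where
  τ_mem : ∀ i, R.τ i ∈ R.T i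
  measurable_V : ∀ n i, Measurable (R.V n i)
  measurable_fperp : ∀ n i ω, Measurable (R.fperp n i ω)
  fperp_nonneg : ∀ n i ω, ∀ x ∈ R.Γperp i, 0 ≤ R.fperp n i ω x
  fperp_zero : ∀ n i ω, R.fperp n i ω 0 = 0
  approx : UnifLittleO S.P fun n i ω =>
    ⨆ θ ∈ R.Θosn n i,
      ((n : EReal) * S.Ln n ω θ - ((R.quadApprox n i ω θ : ℝ) : EReal)).abs
  shrink : ∀ ε : ℝ, 0 < ε → ∀ᶠ n in atTop, ∀ i, ∀ θ ∈ R.Θosn n i, ‖R.γstar i θ‖ ≤ ε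
  tight : UnifBigO S.P fun n i ω => ‖R.V n i ω‖
  local_cone : ∀ᶠ n in atTop, ∀ i,
    {x | ∃ θ ∈ R.Θosn n i, x = √(n : ℝ) • R.γ i θ} ∩ Metric.closedBall 0 (R.k n i) =
      {x | ∃ t ∈ R.T i, x = t - √(n : ℝ) • R.τ i} ∩ Metric.closedBall 0 (R.k n i)
  k_tendsto : ∀ C : ℝ, ∀ᶠ n in atTop, ∀ i, C ≤ R.k n i
  cone_mass : ∃ c : ℝ≥0∞, 0 < c ∧ ∀ i, c ≤ gauss (R.d i) (R.T i : Set (Eu (R.d i)))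
  product : ∀ᶠ n in atTop, ∀ i, 0 < R.m i →
    R.γstar i '' R.Θosn n i = (R.γ i '' R.Θosn n i) ×ˢ (R.γperp i '' R.Θosn n i)

/-- Conditions on the prior: the quasi-posterior is proper, and near the origin the image of the
prior has a density with respect to Lebesgue measure on `Γ × Γ_⊥` (on `Γ` if `m i = 0`)
that is positive and continuous at the origin, uniformly in `P`. -/
structure Prior : Prop where
  proper : ∀ i, ∀ n, 1 ≤ n → ∀ᵐ ω ∂(S.P i), ∫⁻ θ, S.weight n ω θ ∂S.prior < ∞
  density : ∃ δ : ℝ, 0 < δ ∧ ∃ π : (i : ι) → Eu (R.d i) × Eu (R.m i) → ℝ,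
    (∀ i, Measurable (π i) ∧ ∀ x, 0 ≤ π i x) ∧
    (∀ i, ∀ A, MeasurableSet A → A ⊆ Metric.ball 0 δ → A ⊆ R.Γ i ×ˢ R.Γperp i →
      R.priorImage i A = ∫⁻ x in A, ENNReal.ofReal (π i x)) ∧
    (∃ c : ℝ, 0 < c ∧ ∀ i, c ≤ π i 0) ∧
    (∀ ε : ℝ, 0 < ε → ∃ r : ℝ, 0 < r ∧ ∀ i, ∀ x ∈ R.Γ i ×ˢ R.Γperp i,
      ‖x‖ < r → |π i x - π i 0| ≤ ε)

/-- The distributions of `g i (V_n)` under `P i` converge to those of `g i (Z)`,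
`Z ∼ N(0, I)`, in Kolmogorov distance, uniformly in `P`. -/
def KolmogorovConv (g : (i : ι) → Eu (R.d i) → ℝ) : Prop :=
  ∀ ε : ℝ, 0 < ε → ∀ᶠ n in atTop, ∀ i, ∀ z : ℝ,
    |(S.P i).real {ω | g i (R.V n i ω) ≤ z} - gaussCdf (g i) z| ≤ ε

/-- `v ↦ ‖𝐓 v‖²`. -/
def normSqProj (i : ι) (v : Eu (R.d i)) : ℝ := ‖R.proj i v‖ ^ 2

/-- `𝐓(V_n + √n τ) - √n τ`. -/
def driftProj (n : ℕ) (i : ι) (ω : Ω) : Eu (R.d i) :=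
  R.proj i (R.V n i ω + √(n : ℝ) • R.τ i) - √(n : ℝ) • R.τ i

/-- Profile expansion, uniformly. The conditions `drift_le` and `cond_le` are the one-sided
conditions on the limit function `f`. -/
structure Profile (f : (i : ι) → Eu (R.d i) → ℝ) : Prop where
  measurable_f : ∀ i, Measurable (f i)
  approx : UnifLittleO S.P fun n i ω =>
    ⨆ θ ∈ R.Θosn n i,
      ((n : EReal) * S.PLn n ω (S.Mset i θ) - ((R.profileApprox f n i ω θ : ℝ) : EReal)).abs
  drift_le : ∀ i, ∀ n, 1 ≤ n → ∀ᵐ ω ∂(S.P i), f i (R.driftProj n i ω) ≤ f i (R.V n i ω)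
  cond_le : ∀ i, ∀ v ∈ R.T i, ∀ z : ℝ, gaussCdfOn (f i) (R.T i) v z ≤ gaussCdf (f i) z

/-- The one-sided conditions of `Profile` hold with equality. -/
structure ProfileEq (f : (i : ι) → Eu (R.d i) → ℝ) : Prop where
  drift_eq : ∀ i, ∀ n, 1 ≤ n → ∀ᵐ ω ∂(S.P i), f i (R.driftProj n i ω) = f i (R.V n i ω)
  cond_eq : ∀ i, ∀ v ∈ R.T i, ∀ z : ℝ, gaussCdfOn (f i) (R.T i) v z = gaussCdf (f i) z

/-- The distributions of `f i (Z)` are equicontinuous at their `α` quantiles. -/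
structure EquicontAtQuantile (f : (i : ι) → Eu (R.d i) → ℝ) (α : ℝ) : Prop where
  increase : ∀ ε : ℝ, 0 < ε → ∃ δ : ℝ, 0 < δ ∧
    ∀ i, gaussCdf (f i) (gaussQuantile (f i) α - ε) < α - δ
  limit : Tendsto (fun ε : ℝ => ⨅ i, gaussCdf (f i) (gaussQuantile (f i) α - ε))
    (𝓝[>] 0) (𝓝 α)

/-- Each distribution function of `f i (Z)` has no jump at its `α` quantile and exceeds `α` to
the right of it. -/
def RegularAtQuantile (f : (i : ι) → Eu (R.d i) → ℝ) (α : ℝ) : Prop :=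
  ∀ i, gaussCdf (f i) (gaussQuantile (f i) α) = α ∧
    ∀ z, gaussQuantile (f i) α < z → α < gaussCdf (f i) z

end LocalExpansion

namespace Model

variable {Ω ι 𝓜 𝓗 D : Type*} [MeasurableSpace Ω] [MeasurableSpace 𝓜] [MeasurableSpace 𝓗]
variable (S : Model Ω ι 𝓜 𝓗 D)

/-- Monte Carlo convergence of the critical values of Procedure 1. -/
def MCConv (α : ℝ) : Prop :=
  UnifLittleO S.P fun n _ ω => (S.ξmc α n ω - S.ξpost α n ω).abs

/-- Monte Carlo convergence of the critical values of Procedure 2. -/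
def MCConvProfile (α : ℝ) : Prop :=
  UnifLittleO S.P fun n i ω => (S.ξmcp α n i ω - S.ξpostp α n i ω).abs

/-- The subvectors that are compatible with any point of the identified set form `M_I`. -/
def EquivIdentified : Prop := ∀ i, ∀ θ ∈ S.ΘI i, S.Mset i θ = S.MI i

end Model

end QuasiPosterior

end

noncomputable section

namespace QuasiPosterior

/-! ### Metric projection onto a closed convex cone. -/

section Cone

open scoped RealInnerProductSpace

variable {E : Type*} [NormedAddCommGroup E] [InnerProductSpace ℝ E]

/-! Let `v = 𝐓(V_n + √n τ)`, a point of `T`, and `w = v - √n τ` (`driftProj`). On `Θ_osn` the weight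
`e^{n L_n}` is, up to a factor free of `θ` and a factor near one, `exp(-‖w - √n γ‖²/2)
exp(-f_⊥(γ_⊥))`. The prior is nearly flat near the origin, `Θ_osn` is a product in reduced-form
coordinates, and `√n γ` locally fills `T - √n τ`. So the `γ_⊥` integral cancels, and the
quasi-posterior law of `w - √n γ(θ)` is close to `N(0, I)` conditioned on `v - T`
(`whp_posterior_le`). As `-T ⊆ v - T`, the conditioning event has mass bounded away from zero,
whatever the drift; this keeps the errors uniform.

The same expansion gives `Q_n ≈ ‖w - √n γ‖² + 2 f_⊥`, which is about `‖w‖²` on all of `Θ_I`. Hence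
coverage in Procedure 1 is, up to small errors, the event that `‖w‖²` is below the critical value.
Here `‖w‖² ≤ ‖𝐓 V_n‖²`, while the critical value is roughly at least the `α` quantile of `‖Z‖²`
given `Z ∈ v - T`. What remains is a Gaussian inequality: the latter law stochastically dominates
that of `‖𝐓 Z‖²` (`gaussCdfOn_normSq_le_gaussCdf`). It follows from the negative correlation of `{‖𝐓
Z‖² ≤ r}` with sets stable under adding `T` (`gauss_inter_le_mul`). That is proved by rotating `Z`
into an independent copy; a reflection argument gives the sign of the derivative.

Passing to quantiles needs continuity uniform in the cone. Gaussian scaling supplies it for `‖𝐓 Z‖²`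
away from zero. At zero there may be an atom, but the conditional law of `‖Z‖²` puts little mass
there (`exists_level_normSqProj`).

Procedure 2 has the same structure with `f` in place of the squared norms, the comparison and the
continuity being assumed. Both procedures are instances of `le_liminf_coverage` and
`liminf_coverage_le`, in which `g` is the limit statistic under the quasi-posterior and `h` the one
whose sampling law is known. For exact coverage the upper bound is needed at one process only. -/

theorem cone_add_mem (T : ProperCone ℝ E) {s t : E} (hs : s ∈ T) (ht : t ∈ T) : s + t ∈ T :=
  T.toSubmodule.add_mem hs ht

theorem cone_zero_mem (T : ProperCone ℝ E) : (0 : E) ∈ T := T.toSubmodule.zero_mem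

variable [CompleteSpace E] (T : ProperCone ℝ E)

theorem coneProj_mem (v : E) : coneProj T v ∈ T := (coneProj_spec T v).1

theorem inner_sub_coneProj_sub_le (v : E) {t : E} (ht : t ∈ T) :
    ⟪v - coneProj T v, t - coneProj T v⟫ ≤ 0 :=
  (norm_eq_iInf_iff_real_inner_le_zero T.convex (coneProj_spec T v).1).1 (coneProj_spec T v).2 t ht

theorem inner_sub_coneProj_self (v : E) : ⟪v - coneProj T v, coneProj T v⟫ = 0 := by
  have h0 := inner_sub_coneProj_sub_le T v (cone_zero_mem T)
  have h2 := inner_sub_coneProj_sub_le T v (T.smul_mem (coneProj_mem T v) (zero_le_two (α := ℝ)))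
  rw [zero_sub, inner_neg_right] at h0
  rw [two_smul, add_sub_cancel_right] at h2
  linarith

theorem inner_sub_coneProj_le (v : E) {t : E} (ht : t ∈ T) : ⟪v - coneProj T v, t⟫ ≤ 0 := by
  have h := inner_sub_coneProj_sub_le T v ht
  rw [inner_sub_right, inner_sub_coneProj_self] at h
  linarith

/-- The two variational inequalities, each tested at the other candidate, add up to a nonpositive
squared distance. -/
theorem coneProj_eq_of {v p : E} (hp : p ∈ T) (h : ∀ t ∈ T, ⟪v - p, t - p⟫ ≤ 0) :
    coneProj T v = p := by
  have h1 := h _ (coneProj_mem T v)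
  have h2 := inner_sub_coneProj_sub_le T v hp
  have h3 : ⟪coneProj T v - p, coneProj T v - p⟫ ≤ 0 := by
    have e : coneProj T v - p = (v - p) - (v - coneProj T v) := by abel
    nth_rewrite 1 [e]
    rw [inner_sub_left]
    have e2 : p - coneProj T v = -(coneProj T v - p) := by abel
    rw [e2, inner_neg_right] at h2
    linarith
  rw [real_inner_self_eq_norm_sq] at h3
  exact sub_eq_zero.1 (norm_eq_zero.1 (pow_eq_zero_iff two_ne_zero |>.1 (le_antisymm h3 (sq_nonneg _))))

theorem coneProj_of_mem {v : E} (hv : v ∈ T) : coneProj T v = v :=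
  coneProj_eq_of T hv (by simp)

theorem coneProj_smul {c : ℝ} (hc : 0 ≤ c) (v : E) :
    coneProj T (c • v) = c • coneProj T v := by
  refine coneProj_eq_of T (T.smul_mem (coneProj_mem T v) hc) fun t ht => ?_
  rw [← smul_sub, inner_smul_left, inner_sub_right, inner_smul_right, inner_sub_coneProj_self]
  have := inner_sub_coneProj_le T v ht
  simp only [conj_trivial, mul_zero, sub_zero]
  exact mul_nonpos_of_nonneg_of_nonpos hc this

theorem norm_coneProj_sub_le (u v : E) : ‖coneProj T u - coneProj T v‖ ≤ ‖u - v‖ := by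
  have h1 := inner_sub_coneProj_sub_le T u (coneProj_mem T v)
  have h2 := inner_sub_coneProj_sub_le T v (coneProj_mem T u)
  set p := coneProj T u
  set q := coneProj T v
  have h3 : ‖p - q‖ * ‖p - q‖ ≤ ‖u - v‖ * ‖p - q‖ := by
    rw [← real_inner_self_eq_norm_mul_norm]
    refine le_trans ?_ (real_inner_le_norm _ _)
    have e2 : q - p = -(p - q) := by abel
    rw [e2, inner_neg_right] at h1
    have : ⟪u - v, p - q⟫ = ⟪u - p, p - q⟫ - ⟪v - q, p - q⟫ + ⟪p - q, p - q⟫ := by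
      rw [← inner_sub_left, ← inner_add_left]; congr 1; abel
    linarith
  rcases eq_or_lt_of_le (norm_nonneg (p - q)) with h | h
  · rw [← h]; positivity
  · exact le_of_mul_le_mul_right h3 h

theorem lipschitzWith_coneProj : LipschitzWith 1 (coneProj T) :=
  LipschitzWith.of_dist_le_mul fun u v => by
    simpa [dist_eq_norm] using norm_coneProj_sub_le T u v

theorem continuous_coneProj : Continuous (coneProj T) := (lipschitzWith_coneProj T).continuous

theorem coneProj_zero : coneProj T 0 = 0 := coneProj_of_mem T (cone_zero_mem T)

theorem norm_coneProj_le (v : E) : ‖coneProj T v‖ ≤ ‖v‖ := by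
  simpa [coneProj_zero] using norm_coneProj_sub_le T v 0

theorem inner_coneProj_self (v : E) : ⟪coneProj T v, v⟫ = ‖coneProj T v‖ ^ 2 := by
  have := inner_sub_coneProj_self T v
  rw [inner_sub_left, real_inner_self_eq_norm_sq, real_inner_comm] at this
  linarith

/-- Convexity of `‖𝐓 z‖²` with subgradient `2 𝐓 z`: expand `‖𝐓(z + h) - 𝐓 z‖² ≥ 0` and test the
variational inequality at `z + h` with `𝐓 z`. -/
theorem norm_coneProj_sq_sub (z h : E) :
    0 ≤ ‖coneProj T (z + h)‖ ^ 2 - ‖coneProj T z‖ ^ 2 - 2 * ⟪coneProj T z, h⟫ := by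
  have h1 := inner_sub_coneProj_le T (z + h) (coneProj_mem T z)
  have h2 := inner_coneProj_self T z
  have h3 : 0 ≤ ‖coneProj T (z + h) - coneProj T z‖ ^ 2 := by positivity
  rw [norm_sub_sq_real] at h3
  rw [inner_sub_left, real_inner_comm, inner_add_right] at h1
  linarith

theorem hasFDerivAt_norm_coneProj_sq (z : E) :
    HasFDerivAt (fun x => ‖coneProj T x‖ ^ 2) ((2 : ℝ) • innerSL ℝ (coneProj T z)) z := by
  rw [hasFDerivAt_iff_isLittleO_nhds_zero]
  have hb : (fun h => ‖coneProj T (z + h)‖ ^ 2 - ‖coneProj T z‖ ^ 2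
      - ((2 : ℝ) • innerSL ℝ (coneProj T z)) h) =O[𝓝 0] fun h : E => ‖h‖ ^ 2 := by
    refine Asymptotics.IsBigO.of_bound 2 (Eventually.of_forall fun h => ?_)
    have h1 := norm_coneProj_sq_sub T z h
    -- The subgradient inequality based at `z + h` bounds the remainder from above by `2⟪𝐓(z + h) -
    -- 𝐓 z, h⟫`, which is quadratic in `h` since `𝐓` is nonexpansive.
    have h2 := norm_coneProj_sq_sub T (z + h) (-h)
    rw [add_neg_cancel_right, inner_neg_right] at h2
    have h3 : ⟪coneProj T (z + h) - coneProj T z, h⟫ ≤ ‖h‖ * ‖h‖ := by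
      refine (real_inner_le_norm _ _).trans ?_
      gcongr
      simpa using norm_coneProj_sub_le T (z + h) z
    rw [inner_sub_left] at h3
    have e : ((2 : ℝ) • innerSL ℝ (coneProj T z)) h = 2 * ⟪coneProj T z, h⟫ := by simp
    rw [e, Real.norm_of_nonneg h1, Real.norm_of_nonneg (by positivity)]
    nlinarith
  refine hb.trans_isLittleO ?_
  exact Asymptotics.isLittleO_norm_pow_id one_lt_two

end Cone

/-! ### The standard Gaussian measure: density, scaling, tails and small balls. -/

section Gaussian

open scoped RealInnerProductSpace

/-- The unnormalized standard Gaussian density. -/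
def gaussKernel {d : ℕ} (x : Eu d) : ℝ≥0∞ := ENNReal.ofReal (Real.exp (-(1 / 2) * ‖x‖ ^ 2))

theorem measurable_gaussKernel {d : ℕ} : Measurable (gaussKernel : Eu d → ℝ≥0∞) := by
  unfold gaussKernel; fun_prop

theorem integrable_exp_neg_half_norm_sq (d : ℕ) :
    Integrable (fun x : Eu d => Real.exp (-(1 / 2) * ‖x‖ ^ 2)) := by
  have h := (GaussianFourier.integrable_cexp_neg_mul_sq_norm_add (b := (1 / 2 : ℂ)) (by norm_num) 0
    (0 : Eu d)).norm
  refine h.congr (Eventually.of_forall fun x => ?_)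
  simp only [Complex.norm_exp]
  congr 1
  have : (-(1 / 2 : ℂ) * (‖x‖ : ℂ) ^ 2 + 0 * ((⟪(0 : Eu d), x⟫ : ℝ) : ℂ))
      = ((-(1 / 2) * ‖x‖ ^ 2 : ℝ) : ℂ) := by push_cast; ring
  rw [this, Complex.ofReal_re]

theorem exists_withDensity_gaussKernel (d : ℕ) :
    ∃ s : ℝ≥0∞, s ≠ 0 ∧ s ≠ ∞ ∧
      (volume : Measure (Eu d)).withDensity gaussKernel = s • gauss d := by
  have hint := integrable_exp_neg_half_norm_sq d
  have hfin : IsFiniteMeasure ((volume : Measure (Eu d)).withDensity gaussKernel) :=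
    isFiniteMeasure_withDensity_ofReal hint.2
  set K : ℝ := ∫ x : Eu d, Real.exp (-(1 / 2) * ‖x‖ ^ 2) with hK
  have hKpos : 0 < K := by
    rw [hK, integral_pos_iff_support_of_nonneg (fun x => (Real.exp_pos _).le) hint]
    have : (Function.support fun x : Eu d => Real.exp (-(1 / 2) * ‖x‖ ^ 2)) = Set.univ := by
      ext x; simp [Real.exp_ne_zero]
    rw [this]
    exact Measure.measure_univ_pos.2 (NeZero.ne _)
  have hcf : ∀ t : Eu d, charFun ((volume : Measure (Eu d)).withDensity gaussKernel) t
      = (Real.pi / (1 / 2 : ℂ)) ^ (Module.finrank ℝ (Eu d) / 2 : ℂ)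
        * Complex.exp (-(‖t‖ : ℂ) ^ 2 / 2) := by
    intro t
    rw [charFun_apply, integral_withDensity_eq_integral_toReal_smul measurable_gaussKernel
      (Eventually.of_forall fun x => ENNReal.ofReal_lt_top)]
    have h2 := GaussianFourier.integral_cexp_neg_mul_sq_norm_add (b := (1 / 2 : ℂ)) (by norm_num)
      Complex.I t
    have e : Complex.exp (Complex.I ^ 2 * (‖t‖ : ℂ) ^ 2 / (4 * (1 / 2 : ℂ)))
        = Complex.exp (-(‖t‖ : ℂ) ^ 2 / 2) := by
      congr 1; rw [Complex.I_sq]; ring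
    rw [e] at h2
    rw [← h2]
    congr 1
    ext x
    rw [gaussKernel, ENNReal.toReal_ofReal (Real.exp_pos _).le, Complex.real_smul,
      Complex.ofReal_exp, ← Complex.exp_add]
    congr 1
    rw [real_inner_comm]
    push_cast
    ring
  -- The complex power is identified with the total mass by evaluating the characteristic function
  -- at `0`, so it never has to be computed.
  have hC : (Real.pi / (1 / 2 : ℂ)) ^ (Module.finrank ℝ (Eu d) / 2 : ℂ) = (K : ℂ) := by
    have h0 := hcf 0
    rw [charFun_zero] at h0
    simp only [norm_zero, Complex.ofReal_zero, ne_eq, OfNat.ofNat_ne_zero, not_false_eq_true,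
      zero_pow, neg_zero, zero_div, Complex.exp_zero, mul_one] at h0
    rw [← h0]
    congr 1
    rw [measureReal_def, withDensity_apply _ MeasurableSet.univ, Measure.restrict_univ, hK,
      integral_eq_lintegral_of_nonneg_ae (Eventually.of_forall fun x => (Real.exp_pos _).le)
        hint.aestronglyMeasurable]
    rfl
  refine ⟨(K.toNNReal : ℝ≥0∞), by simpa using hKpos, ENNReal.coe_ne_top, ?_⟩
  have : (K.toNNReal : ℝ≥0∞) • gauss d = K.toNNReal • gauss d := rfl
  rw [this]
  refine Measure.ext_of_charFun ?_
  ext t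
  rw [hcf t, hC, charFun_apply, integral_smul_nnreal_measure, ← charFun_apply, charFun_stdGaussian,
    NNReal.smul_def, Real.coe_toNNReal _ hKpos.le, Complex.real_smul]

theorem lintegral_comp_sub_smul {d : ℕ} {F : Eu d → ℝ≥0∞} (hF : Measurable F) (w : Eu d) {r : ℝ}
    (hr : 0 < r) : ∫⁻ x, F (w - r • x) = ENNReal.ofReal ((r ^ d)⁻¹) * ∫⁻ x, F x := by
  have h1 : ∫⁻ x, F (w - r • x) = ∫⁻ x, F (w - x) ∂(volume.map fun x : Eu d => r • x) := by
    rw [lintegral_map (by fun_prop) (by fun_prop)]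
  rw [h1, Measure.map_addHaar_smul volume hr.ne', lintegral_smul_measure,
    lintegral_sub_left_eq_self]
  simp [abs_of_nonneg (inv_nonneg.2 (pow_nonneg hr.le d))]

/-- For `a ≤ 1` the kernel at `x` is at most the kernel at `a • x`; the substitution then costs the
Jacobian `a^{-d}`. Applied to homogeneous functions, this controls the increments of their
distribution functions. -/
theorem gauss_preimage_smul_le {d : ℕ} {A : Set (Eu d)} (hA : MeasurableSet A) {a : ℝ}
    (h0 : 0 < a) (h1 : a ≤ 1) :
    gauss d {x | a • x ∈ A} ≤ ENNReal.ofReal ((a ^ d)⁻¹) * gauss d A := by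
  obtain ⟨s, hs0, hs1, hs⟩ := exists_withDensity_gaussKernel d
  have hms : Measurable fun x : Eu d => a • x := by fun_prop
  have hA' : MeasurableSet {x : Eu d | a • x ∈ A} := hms hA
  have e : ∀ B : Set (Eu d), MeasurableSet B → s * gauss d B = ∫⁻ x in B, gaussKernel x := by
    intro B hB
    rw [← withDensity_apply _ hB, hs]; rfl
  rw [← ENNReal.mul_le_mul_iff_right hs0 hs1, mul_left_comm, e _ hA, e _ hA']
  have hF : Measurable (A.indicator gaussKernel) := measurable_gaussKernel.indicator hA
  have h2 : ∫⁻ x, A.indicator gaussKernel (a • x)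
      = ENNReal.ofReal ((a ^ d)⁻¹) * ∫⁻ x, A.indicator gaussKernel x := by
    rw [← lintegral_comp_sub_smul hF 0 h0, ← lintegral_neg_eq_self]
    simp
  rw [← lintegral_indicator hA, ← h2, ← lintegral_indicator hA']
  refine lintegral_mono fun x => ?_
  by_cases hx : a • x ∈ A
  · rw [Set.indicator_of_mem (show x ∈ {x | a • x ∈ A} from hx), Set.indicator_of_mem hx]
    unfold gaussKernel
    refine ENNReal.ofReal_le_ofReal (Real.exp_le_exp.2 ?_)
    rw [norm_smul, mul_pow, Real.norm_of_nonneg h0.le]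
    have : a ^ 2 ≤ 1 := pow_le_one₀ h0.le h1
    nlinarith [sq_nonneg ‖x‖]
  · rw [Set.indicator_of_notMem (show x ∉ {x | a • x ∈ A} from hx)]
    exact zero_le

theorem map_neg_gauss (d : ℕ) : (gauss d).map (fun x => -x) = gauss d := by
  have := stdGaussian_map (LinearIsometryEquiv.neg ℝ (E := Eu d))
  simpa using this

theorem gauss_preimage_neg {d : ℕ} {A : Set (Eu d)} (hA : MeasurableSet A) :
    gauss d {x | -x ∈ A} = gauss d A := by
  conv_rhs => rw [← map_neg_gauss d, Measure.map_apply measurable_neg hA]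
  rfl

/-- Uniformity is free because only finitely many dimensions occur; this is where the bound on `d*`
matters. -/
theorem exists_gauss_tail_le (dmax : ℕ) {η : ℝ≥0∞} (hη : 0 < η) :
    ∃ C : ℝ, 0 < C ∧ ∀ d ≤ dmax, gauss d {x | C < ‖x‖} ≤ η := by
  have h1 : ∀ d : ℕ, ∀ᶠ C : ℝ in atTop, gauss d {x | C < ‖x‖} ≤ η := by
    intro d
    have : Tendsto (fun C : ℝ => gauss d {x | C < ‖x‖}) atTop (𝓝 (gauss d (⋂ C : ℝ, {x | C < ‖x‖}))) :=
      tendsto_measure_iInter_atTop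
        (fun C => (measurableSet_lt measurable_const measurable_norm).nullMeasurableSet)
        (fun a b hab x hx => lt_of_le_of_lt hab hx) ⟨0, measure_ne_top _ _⟩
    have h2 : (⋂ C : ℝ, {x : Eu d | C < ‖x‖}) = ∅ := by
      ext x
      simp only [Set.mem_iInter, Set.mem_ofPred_eq, Set.mem_empty_iff_false, iff_false, not_forall,
        not_lt]
      exact ⟨‖x‖, le_rfl⟩
    rw [h2, measure_empty] at this
    exact this.eventually (eventually_le_nhds hη)
  have h2 : ∀ᶠ C : ℝ in atTop, ∀ d ∈ Finset.range (dmax + 1), gauss d {x | C < ‖x‖} ≤ η :=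
    (Filter.eventually_all_finset _).2 fun d _ => h1 d
  obtain ⟨C, hC, hC0⟩ := (h2.and (eventually_gt_atTop 0)).exists
  exact ⟨C, hC0, fun d hd => hC d (Finset.mem_range.2 (Nat.lt_succ_of_le hd))⟩

theorem gauss_singleton_zero {d : ℕ} (hd : 1 ≤ d) : gauss d {(0 : Eu d)} = 0 := by
  obtain ⟨s, hs0, hs1, hs⟩ := exists_withDensity_gaussKernel d
  have : Nonempty (Fin d) := ⟨⟨0, hd⟩⟩
  have h : (s • gauss d) {(0 : Eu d)} = 0 := by
    rw [← hs]
    exact withDensity_absolutelyContinuous _ _ (measure_singleton _)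
  simpa [hs0] using h

theorem exists_gauss_closedBall_le (dmax : ℕ) {η : ℝ≥0∞} (hη : 0 < η) :
    ∃ r : ℝ, 0 < r ∧ ∀ d, 1 ≤ d → d ≤ dmax → gauss d {x | ‖x‖ ≤ r} ≤ η := by
  have h1 : ∀ d : ℕ, 1 ≤ d → ∀ᶠ r : ℝ in 𝓝[>] 0, gauss d {x | ‖x‖ ≤ r} ≤ η := by
    intro d hd
    have : Tendsto (fun r : ℝ => gauss d {x | ‖x‖ ≤ r}) (𝓝[>] 0)
        (𝓝 (gauss d (⋂ r > (0 : ℝ), {x | ‖x‖ ≤ r}))) :=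
      tendsto_measure_biInter_gt
        (fun C _ => (measurableSet_le measurable_norm measurable_const).nullMeasurableSet)
        (fun a b _ hab x hx => le_trans hx hab) ⟨1, one_pos, measure_ne_top _ _⟩
    have h2 : (⋂ r > (0 : ℝ), {x : Eu d | ‖x‖ ≤ r}) = {0} := by
      ext x
      simp only [Set.mem_iInter, Set.mem_ofPred_eq, Set.mem_singleton_iff]
      refine ⟨fun h => norm_le_zero_iff.1 (le_of_forall_gt_imp_ge_of_dense h), ?_⟩
      rintro rfl r hr
      simpa using hr.le
    rw [h2, gauss_singleton_zero hd] at this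
    exact this.eventually (eventually_le_nhds hη)
  have h2 : ∀ᶠ r : ℝ in 𝓝[>] 0, ∀ d ∈ Finset.Icc 1 dmax, gauss d {x | ‖x‖ ≤ r} ≤ η :=
    (Filter.eventually_all_finset _).2 fun d hd => h1 d (Finset.mem_Icc.1 hd).1
  obtain ⟨r, hr, hr0⟩ := (h2.and self_mem_nhdsWithin).exists
  exact ⟨r, hr0, fun d h1 h2 => hr d (Finset.mem_Icc.2 ⟨h1, h2⟩)⟩

end Gaussian

/-! ### Negative correlation under the Gaussian measure. -/

section Correlation

open scoped RealInnerProductSpace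

/-- The reflection in the hyperplane orthogonal to `t` preserves the Gaussian law, flips the sign of
`⟪t, x⟫`, and moves `x` along `t` only. Pairing `x` with its mirror image, the monotonicity of `φ`
decides the sign. -/
theorem integral_mul_inner_gauss_nonpos {d : ℕ} {φ : Eu d → ℝ} (hφ : Measurable φ)
    (hb : ∀ x, |φ x| ≤ 1) (t : Eu d) (hmono : ∀ x, ∀ s : ℝ, 0 ≤ s → φ (x + s • t) ≤ φ x) :
    ∫ x, φ x * ⟪t, x⟫ ∂(gauss d) ≤ 0 := by
  have hbint : ∀ f : Eu d → ℝ, Measurable f → (∀ x, |f x| ≤ 1) →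
      Integrable (fun x => f x * ⟪t, x⟫) (gauss d) := by
    intro f hf hfb
    refine Integrable.bdd_mul (c := 1) ?_ hf.aestronglyMeasurable (Eventually.of_forall hfb)
    exact (IsGaussian.integrable_id (μ := gauss d)).const_inner t
  set e : Eu d ≃ₗᵢ[ℝ] Eu d :=
    (Submodule.reflection (Submodule.span ℝ {t})).trans (LinearIsometryEquiv.neg ℝ) with he
  have heval : ∀ x, e x = x - (2 * (⟪t, x⟫ / ‖t‖ ^ 2)) • t := by
    intro x
    simp only [he, LinearIsometryEquiv.trans_apply, LinearIsometryEquiv.coe_neg,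
      Submodule.reflection_singleton_apply]
    simp only [two_smul, RCLike.ofReal_real_eq_id, id_eq, two_mul, add_smul, neg_sub]
  have hinner : ∀ x, ⟪t, e x⟫ = -⟪t, x⟫ := by
    intro x
    rw [heval, inner_sub_right, inner_smul_right, real_inner_self_eq_norm_sq]
    by_cases ht : ‖t‖ = 0
    · simp [norm_eq_zero.1 ht]
    · field_simp; ring
  have hem : Measurable e := e.continuous.measurable
  have h1 : ∫ x, φ x * ⟪t, x⟫ ∂(gauss d) = -∫ x, φ (e x) * ⟪t, x⟫ ∂(gauss d) := by
    conv_lhs => rw [gauss, ← stdGaussian_map e]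
    rw [integral_map hem.aemeasurable (by fun_prop), ← integral_neg]
    congr 1
    ext x
    rw [hinner]; ring
  have h2 : ∫ x, φ x * ⟪t, x⟫ ∂(gauss d) ≤ ∫ x, φ (e x) * ⟪t, x⟫ ∂(gauss d) := by
    refine integral_mono (hbint φ hφ hb) (hbint _ (hφ.comp hem) fun x => hb _) fun x => ?_
    rcases le_total 0 ⟪t, x⟫ with h | h
    · refine mul_le_mul_of_nonneg_right ?_ h
      have := hmono (e x) (2 * (⟪t, x⟫ / ‖t‖ ^ 2)) (by positivity)
      rwa [heval, sub_add_cancel, ← heval] at this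
    · refine mul_le_mul_of_nonpos_right ?_ h
      have := hmono x (-(2 * (⟪t, x⟫ / ‖t‖ ^ 2)))
        (neg_nonneg.2 (mul_nonpos_of_nonneg_of_nonpos zero_le_two
          (div_nonpos_of_nonpos_of_nonneg h (by positivity))))
      rwa [neg_smul, ← sub_eq_add_neg, ← heval] at this
  linarith

/-- Negative correlation of an upper set of a cone `T` and a decreasing smooth function of the
norm of the projection onto `T`. -/
theorem integral_indicator_mul_le {d : ℕ} (T : ProperCone ℝ (Eu d)) {K : Set (Eu d)}
    (hK : MeasurableSet K) (hKT : ∀ x ∈ K, ∀ t ∈ T, x + t ∈ K) {ψ : ℝ → ℝ} {C : ℝ}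
    (hψ : Differentiable ℝ ψ) (hψ' : Continuous (deriv ψ)) (hneg : ∀ u, deriv ψ u ≤ 0)
    (hb : ∀ u, |ψ u| ≤ 1) (hC : ∀ x : Eu d, ‖deriv ψ (‖coneProj T x‖ ^ 2) • coneProj T x‖ ≤ C) :
    ∫ x, K.indicator 1 x * ψ (‖coneProj T x‖ ^ 2) ∂(gauss d)
      ≤ (gauss d).real K * ∫ x, ψ (‖coneProj T x‖ ^ 2) ∂(gauss d) := by
  set P := coneProj T with hP
  -- Gaussian interpolation: `Y θ` runs from the first coordinate at `θ = 0` to the independent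
  -- second one at `θ = π/2`, and `X θ` is its derivative. The endpoints of `∫ F θ` are the two
  -- sides of the claim, so it suffices that the integral increases.
  have hPc : Continuous P := continuous_coneProj T
  set Y : ℝ → Eu d × Eu d → Eu d := fun θ p => Real.cos θ • p.1 + Real.sin θ • p.2 with hY
  set X : ℝ → Eu d × Eu d → Eu d := fun θ p => -Real.sin θ • p.1 + Real.cos θ • p.2 with hX
  set μ := (gauss d).prod (gauss d) with hμ
  set I : Eu d → ℝ := K.indicator 1 with hI
  have hIm : Measurable I := measurable_one.indicator hK
  have hIb : ∀ x, |I x| ≤ 1 := by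
    intro x
    by_cases hx : x ∈ K <;> simp [hI, hx]
  have hI0 : ∀ x, 0 ≤ I x := by
    intro x
    by_cases hx : x ∈ K <;> simp [hI, hx]
  have hψc : Continuous ψ := hψ.continuous
  set F : ℝ → Eu d × Eu d → ℝ := fun θ p => I p.1 * ψ (‖P (Y θ p)‖ ^ 2) with hF
  set F' : ℝ → Eu d × Eu d → ℝ := fun θ p =>
    I p.1 * (2 * ⟪deriv ψ (‖P (Y θ p)‖ ^ 2) • P (Y θ p), X θ p⟫) with hF'
  have hI1 : Measurable fun p : Eu d × Eu d => I p.1 := hIm.comp measurable_fst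
  have hFm : ∀ θ, Measurable (F θ) := by
    intro θ
    refine hI1.mul (Continuous.measurable ?_)
    simp only [hY]; fun_prop
  have hF'm : ∀ θ, Measurable (F' θ) := by
    intro θ
    refine hI1.mul (Continuous.measurable ?_)
    simp only [hY, hX]; fun_prop
  have hC0 : 0 ≤ C := (norm_nonneg _).trans (hC 0)
  have hbound : Integrable (fun p : Eu d × Eu d => 2 * (C * (‖p.1‖ + ‖p.2‖))) μ := by
    refine Integrable.const_mul (Integrable.const_mul (Integrable.add ?_ ?_) C) 2
    · exact (IsGaussian.integrable_id (μ := gauss d)).norm.comp_fst _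
    · exact (IsGaussian.integrable_id (μ := gauss d)).norm.comp_snd _
  have hXn : ∀ θ p, ‖X θ p‖ ≤ ‖p.1‖ + ‖p.2‖ := by
    intro θ p
    refine (norm_add_le _ _).trans (add_le_add ?_ ?_)
    · rw [norm_smul, norm_neg]
      exact mul_le_of_le_one_left (norm_nonneg _) (Real.abs_sin_le_one θ)
    · rw [norm_smul]
      exact mul_le_of_le_one_left (norm_nonneg _) (Real.abs_cos_le_one θ)
  have hder : ∀ θ, HasDerivAt (fun θ => ∫ p, F θ p ∂μ) (∫ p, F' θ p ∂μ) θ := by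
    intro θ
    refine (hasDerivAt_integral_of_dominated_loc_of_deriv_le (s := Set.univ) univ_mem
      (Eventually.of_forall fun θ => (hFm θ).aestronglyMeasurable) ?_
      (hF'm θ).aestronglyMeasurable (bound := fun p => 2 * (C * (‖p.1‖ + ‖p.2‖)))
      (Eventually.of_forall fun p θ _ => ?_) hbound
      (Eventually.of_forall fun p θ _ => ?_)).2
    · refine Integrable.of_bound (hFm θ).aestronglyMeasurable 1 (Eventually.of_forall fun p => ?_)
      rw [Real.norm_eq_abs, abs_mul]
      exact mul_le_one₀ (hIb _) (abs_nonneg _) (hb _)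
    · simp only [hF']
      rw [Real.norm_eq_abs, abs_mul, abs_mul, abs_two]
      refine (mul_le_of_le_one_left (by positivity) (hIb _)).trans ?_
      gcongr
      refine (abs_real_inner_le_norm _ _).trans ?_
      exact mul_le_mul (hC _) (hXn θ p) (norm_nonneg _) hC0
    · refine HasDerivAt.const_mul _ ?_
      have h1 : HasDerivAt (fun θ => Y θ p) (X θ p) θ :=
        ((Real.hasDerivAt_cos θ).smul_const p.1).add ((Real.hasDerivAt_sin θ).smul_const p.2)
      have h2 := (hasFDerivAt_norm_coneProj_sq T (Y θ p)).comp_hasDerivAt θ h1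
      have h3 := (hψ (‖P (Y θ p)‖ ^ 2)).hasDerivAt.comp θ h2
      refine h3.congr_deriv ?_
      simp only [smul_apply, innerSL_apply_apply, smul_eq_mul, inner_smul_left,
        conj_trivial, hP]
      ring
  have hrot : ∀ θ, MeasurePreserving (ContinuousLinearMap.rotation θ) μ μ := by
    intro θ
    refine ⟨(ContinuousLinearMap.rotation θ).continuous.measurable, ?_⟩
    exact IsGaussian.map_rotation_eq_self (by simp) θ
  have hnn : ∀ θ ∈ Set.Icc 0 (Real.pi / 2), 0 ≤ ∫ p, F' θ p ∂μ := by
    intro θ hθ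
    have hsin : 0 ≤ Real.sin θ := Real.sin_nonneg_of_nonneg_of_le_pi hθ.1 (by linarith [hθ.2, Real.pi_pos])
    -- Rotation invariance makes `(Y θ, X θ)` the integration variables, the old first coordinate
    -- being `cos θ • y - sin θ • x`. For fixed `y` the indicator decreases as `x` moves along `𝐓 y
    -- ∈ T`, so the reflection lemma applies; the factor `ψ' ≤ 0` turns the sign.
    set H : Eu d × Eu d → ℝ := fun q => I (Real.cos θ • q.1 - Real.sin θ • q.2) *
      (2 * ⟪deriv ψ (‖P q.1‖ ^ 2) • P q.1, q.2⟫) with hH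
    have hHm : Measurable H := by
      refine (hIm.comp (Continuous.measurable ?_)).mul (Continuous.measurable ?_)
      · fun_prop
      · fun_prop
    have e1 : ∀ p, F' θ p = H (ContinuousLinearMap.rotation θ p) := by
      intro p
      simp only [hF', hH, ContinuousLinearMap.rotation_apply, hY, hX]
      congr 2
      rw [smul_add, smul_add, smul_smul, smul_smul, smul_smul, smul_smul, add_sub_add_comm, ← sub_smul,
        ← sub_smul]
      have a1 : Real.cos θ * Real.cos θ - Real.sin θ * -Real.sin θ = 1 := by
        nlinarith [Real.sin_sq_add_cos_sq θ]
      have a2 : Real.cos θ * Real.sin θ - Real.sin θ * Real.cos θ = 0 := by ring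
      rw [a1, a2, one_smul, zero_smul, add_zero]
    have e2 : ∫ p, F' θ p ∂μ = ∫ q, H q ∂μ := by
      simp_rw [e1]
      rw [← (hrot θ).map_eq, integral_map (hrot θ).measurable.aemeasurable hHm.aestronglyMeasurable,
        (hrot θ).map_eq]
    rw [e2]
    by_cases hint : Integrable H μ
    · rw [integral_prod _ hint]
      refine integral_nonneg fun y => ?_
      have e3 : (fun x => H (y, x)) = fun x => (2 * deriv ψ (‖P y‖ ^ 2)) *
          (I (Real.cos θ • y - Real.sin θ • x) * ⟪P y, x⟫) := by
        ext x
        simp only [hH, inner_smul_left, conj_trivial]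
        ring
      simp only [e3, Pi.zero_apply]
      rw [integral_const_mul]
      refine mul_nonneg_of_nonpos_of_nonpos (by linarith [hneg (‖P y‖ ^ 2)]) ?_
      refine integral_mul_inner_gauss_nonpos (φ := fun x => I (Real.cos θ • y - Real.sin θ • x))
        (hIm.comp (by fun_prop)) (fun x => hIb _) _ fun x s hs => ?_
      by_cases hx : Real.cos θ • y - Real.sin θ • (x + s • P y) ∈ K
      · have hx' : Real.cos θ • y - Real.sin θ • x ∈ K := by
          have := hKT _ hx _ (T.smul_mem (coneProj_mem T y) (mul_nonneg hsin hs))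
          convert this using 1
          rw [smul_add, smul_smul]
          abel
        simp only [hI, Set.indicator_of_mem hx, Set.indicator_of_mem hx', Pi.one_apply, le_refl]
      · simp only [hI, Set.indicator_of_notMem hx]
        exact hI0 _
    -- The integral of a non-integrable function is `0`, so this case needs no integrability proof.
    · rw [integral_undef hint]
  have hmono : MonotoneOn (fun θ => ∫ p, F θ p ∂μ) (Set.Icc 0 (Real.pi / 2)) := by
    refine monotoneOn_of_deriv_nonneg (convex_Icc _ _)
      (fun θ _ => (hder θ).continuousAt.continuousWithinAt)
      (fun θ _ => (hder θ).differentiableAt.differentiableWithinAt) fun θ hθ => ?_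
    rw [(hder θ).deriv]
    exact hnn θ (interior_subset hθ)
  have hpi : (0 : ℝ) ≤ Real.pi / 2 := by positivity
  have h := hmono (Set.left_mem_Icc.2 hpi) (Set.right_mem_Icc.2 hpi) hpi
  simp only [hF, hY, Real.cos_zero, Real.sin_zero, Real.cos_pi_div_two, Real.sin_pi_div_two, one_smul,
    zero_smul, add_zero, zero_add] at h
  have h0 : ∫ p : Eu d × Eu d, I p.1 * ψ (‖P p.1‖ ^ 2) ∂μ
      = ∫ x, I x * ψ (‖P x‖ ^ 2) ∂(gauss d) := by
    rw [hμ, integral_fun_fst (f := fun x => I x * ψ (‖P x‖ ^ 2))]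
    simp
  have h1 : ∫ p : Eu d × Eu d, I p.1 * ψ (‖P p.2‖ ^ 2) ∂μ
      = (gauss d).real K * ∫ x, ψ (‖P x‖ ^ 2) ∂(gauss d) := by
    rw [hμ, integral_prod_mul (f := I) (g := fun x => ψ (‖P x‖ ^ 2)), hI, integral_indicator_one hK]
  rwa [h0, h1] at h

theorem measurableSet_normSq_coneProj_le {d : ℕ} (T : ProperCone ℝ (Eu d)) (r : ℝ) :
    MeasurableSet {x : Eu d | ‖coneProj T x‖ ^ 2 ≤ r} :=
  ((continuous_coneProj T).norm.pow 2).measurable measurableSet_Iic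

/-- The indicator of `(-∞, r]` is majorized by smooth steps descending on `[r, r + ε]`. Smoothing to
the right makes right-continuity sufficient in the limit, so an atom at `r` does no harm. -/
theorem gauss_inter_le_mul {d : ℕ} (T : ProperCone ℝ (Eu d)) {K : Set (Eu d)}
    (hK : MeasurableSet K) (hKT : ∀ x ∈ K, ∀ t ∈ T, x + t ∈ K) (r : ℝ) :
    (gauss d).real (K ∩ {x | ‖coneProj T x‖ ^ 2 ≤ r})
      ≤ (gauss d).real K * (gauss d).real {x | ‖coneProj T x‖ ^ 2 ≤ r} := by
  have hcont : Continuous fun x : Eu d => ‖coneProj T x‖ ^ 2 := (continuous_coneProj T).norm.pow 2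
  have key : ∀ ε : ℝ, 0 < ε → (gauss d).real (K ∩ {x | ‖coneProj T x‖ ^ 2 ≤ r})
      ≤ (gauss d).real K * (gauss d).real {x | ‖coneProj T x‖ ^ 2 ≤ r + ε} := by
    intro ε hε
    set ψ : ℝ → ℝ := fun u => 1 - Real.smoothTransition ((u - r) / ε) with hψ
    have hcd : ContDiff ℝ 1 ψ := by
      refine contDiff_const.sub (Real.smoothTransition.contDiff.comp ?_)
      fun_prop
    have hd : Differentiable ℝ ψ := hcd.differentiable one_ne_zero
    have hc : Continuous (deriv ψ) := hcd.continuous_deriv le_rfl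
    have hanti : Antitone ψ := by
      intro a b hab
      refine sub_le_sub_left (Real.smoothTransition.monotone ?_) 1
      gcongr
    have h0 : ∀ u, 0 ≤ ψ u := fun u => sub_nonneg.2 (Real.smoothTransition.le_one _)
    have h1 : ∀ u, ψ u ≤ 1 := fun u => sub_le_self _ (Real.smoothTransition.nonneg _)
    have hzero : ∀ u, r + ε < u → ψ u = 0 := by
      intro u hu
      simp only [hψ]
      rw [Real.smoothTransition.one_of_one_le, sub_self]
      rw [one_le_div hε]; linarith
    have hone : ∀ u, u ≤ r → ψ u = 1 := by
      intro u hu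
      simp only [hψ]
      rw [Real.smoothTransition.zero_of_nonpos, sub_zero]
      exact div_nonpos_of_nonpos_of_nonneg (by linarith) hε.le
    have hdzero : ∀ u, r + ε < u → deriv ψ u = 0 := by
      intro u hu
      have : ψ =ᶠ[𝓝 u] fun _ => 0 := by
        filter_upwards [Ioi_mem_nhds hu] with v hv using hzero v hv
      rw [this.deriv_eq, deriv_const]
    -- The step is constant beyond `r + ε`, so its derivative times `√u = ‖𝐓 x‖` has to be bounded
    -- on a compact interval only.
    obtain ⟨C, hC⟩ := (isCompact_Icc (a := (0 : ℝ)) (b := r + ε)).exists_bound_of_continuousOn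
      (f := fun u => deriv ψ u * √u) (by fun_prop)
    have hb : ∀ x : Eu d, ‖deriv ψ (‖coneProj T x‖ ^ 2) • coneProj T x‖ ≤ max C 0 := by
      intro x
      by_cases hx : ‖coneProj T x‖ ^ 2 ≤ r + ε
      · have := hC (‖coneProj T x‖ ^ 2) ⟨by positivity, hx⟩
        rw [Real.sqrt_sq (norm_nonneg _), norm_mul, norm_norm] at this
        rw [norm_smul]
        exact this.trans (le_max_left _ _)
      · rw [hdzero _ (not_le.1 hx), zero_smul, norm_zero]
        exact le_max_right _ _
    have hmain := integral_indicator_mul_le T hK hKT hd hc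
      (fun u => hanti.deriv_nonpos) (fun u => abs_le.2 ⟨by linarith [h0 u], h1 u⟩) hb
    have hint : Integrable (fun x : Eu d => ψ (‖coneProj T x‖ ^ 2)) (gauss d) :=
      Integrable.of_bound (hd.continuous.comp hcont).aestronglyMeasurable 1
        (Eventually.of_forall fun x => abs_le.2 ⟨by linarith [h0 (‖coneProj T x‖ ^ 2)], h1 _⟩)
    refine le_trans ?_ (hmain.trans ?_)
    · rw [← integral_indicator_one (hK.inter (measurableSet_normSq_coneProj_le T r))]
      refine integral_mono_of_nonneg (Eventually.of_forall fun x => ?_) ?_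
        (Eventually.of_forall fun x => ?_)
      · exact Set.indicator_nonneg (fun _ _ => zero_le_one) x
      · refine Integrable.bdd_mul (c := 1) hint (measurable_one.indicator hK).aestronglyMeasurable
          (Eventually.of_forall fun x => ?_)
        by_cases hx : x ∈ K <;> simp [hx]
      · by_cases hx : x ∈ K
        · by_cases hx2 : ‖coneProj T x‖ ^ 2 ≤ r
          · simp [hx, hx2, hone _ hx2]
          · simp [hx, hx2, h0]
        · simp [hx]
    · refine mul_le_mul_of_nonneg_left ?_ measureReal_nonneg
      rw [← integral_indicator_one (measurableSet_normSq_coneProj_le T (r + ε))]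
      refine integral_mono hint ((integrable_const (1 : ℝ)).indicator
        (measurableSet_normSq_coneProj_le T (r + ε))) fun x => ?_
      by_cases hx : ‖coneProj T x‖ ^ 2 ≤ r + ε
      · simpa [hx] using h1 _
      · simp [hx, hzero _ (not_le.1 hx)]
  have hlim : Tendsto (fun u : ℝ => (gauss d).real {x : Eu d | ‖coneProj T x‖ ^ 2 ≤ u}) (𝓝[>] r)
      (𝓝 ((gauss d).real {x | ‖coneProj T x‖ ^ 2 ≤ r})) := by
    have h := tendsto_measure_biInter_gt (μ := gauss d)
      (s := fun u : ℝ => {x : Eu d | ‖coneProj T x‖ ^ 2 ≤ u}) (a := r)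
      (fun u _ => (measurableSet_normSq_coneProj_le T u).nullMeasurableSet)
      (fun a b _ hab x hx => le_trans hx hab) ⟨r + 1, by linarith, measure_ne_top _ _⟩
    have h2 : (⋂ u > r, {x : Eu d | ‖coneProj T x‖ ^ 2 ≤ u}) = {x | ‖coneProj T x‖ ^ 2 ≤ r} := by
      ext x
      simp only [Set.mem_iInter, Set.mem_ofPred_eq]
      exact ⟨fun h => le_of_forall_gt_imp_ge_of_dense h, fun h u hu => h.trans (le_of_lt hu)⟩
    rw [h2] at h
    exact (ENNReal.tendsto_toReal (measure_ne_top _ _)).comp h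
  refine ge_of_tendsto (hlim.const_mul ((gauss d).real K)) ?_
  filter_upwards [self_mem_nhdsWithin] with u hu
  have := key (u - r) (sub_pos.2 hu)
  rwa [add_sub_cancel] at this

end Correlation

/-! ### Distribution functions of Gaussian functionals, also conditional on a translated cone. -/

section Cdf

variable {d : ℕ}

/-- The reflected and translated cone `v - T`. -/
def subCone (T : ProperCone ℝ (Eu d)) (v : Eu d) : Set (Eu d) := {x | ∃ t ∈ T, x = v - t}

theorem mem_subCone {T : ProperCone ℝ (Eu d)} {v x : Eu d} : x ∈ subCone T v ↔ v - x ∈ T := by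
  constructor
  · rintro ⟨t, ht, rfl⟩
    simpa using ht
  · intro h
    exact ⟨v - x, h, by simp⟩

theorem measurableSet_subCone (T : ProperCone ℝ (Eu d)) (v : Eu d) :
    MeasurableSet (subCone T v) := by
  have : subCone T v = (fun x => v - x) ⁻¹' (T : Set (Eu d)) := by
    ext x; exact mem_subCone
  rw [this]
  exact (T.isClosed.preimage (by fun_prop)).measurableSet

/-- By symmetry of the Gaussian law, since `-T ⊆ v - T`. It bounds the conditioning mass from below
independently of `v`, hence of the drift. -/
theorem gauss_cone_le_subCone (T : ProperCone ℝ (Eu d)) {v : Eu d} (hv : v ∈ T) :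
    gauss d (T : Set (Eu d)) ≤ gauss d (subCone T v) := by
  rw [← gauss_preimage_neg (measurableSet_subCone T v)]
  refine measure_mono fun x hx => mem_subCone.2 ?_
  rw [sub_neg_eq_add]
  exact cone_add_mem T hv hx

theorem gaussCdfOn_eq (g : Eu d → ℝ) (T : ProperCone ℝ (Eu d)) (v : Eu d) (z : ℝ) :
    gaussCdfOn g T v z
      = ((gauss d).real (subCone T v))⁻¹ * (gauss d).real (subCone T v ∩ {x | g x ≤ z}) := by
  rw [gaussCdfOn, measureReal_def]
  change (ProbabilityTheory.cond (gauss d) (subCone T v) _).toReal = _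
  rw [cond_apply (measurableSet_subCone T v), ENNReal.toReal_mul, ENNReal.toReal_inv]
  rfl

/-- After `x ↦ -x` the conditioning set is `T - v`, which is stable under adding `T`. Relax `‖x‖² ≤
z` to `‖𝐓 x‖² ≤ z`, then use negative correlation. -/
theorem gaussCdfOn_normSq_le_gaussCdf (T : ProperCone ℝ (Eu d)) (v : Eu d) (z : ℝ) :
    gaussCdfOn (fun x => ‖x‖ ^ 2) T v z ≤ gaussCdf (fun x => ‖coneProj T x‖ ^ 2) z := by
  rw [gaussCdfOn_eq]
  have hK : MeasurableSet {x | -x ∈ subCone T v} := measurable_neg (measurableSet_subCone T v)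
  have h1 : (gauss d).real {x | -x ∈ subCone T v} = (gauss d).real (subCone T v) := by
    rw [measureReal_def, gauss_preimage_neg (measurableSet_subCone T v), measureReal_def]
  have hz : MeasurableSet {x : Eu d | ‖x‖ ^ 2 ≤ z} :=
    (continuous_norm.pow 2).measurable measurableSet_Iic
  have h2 : (gauss d).real (subCone T v ∩ {x | ‖x‖ ^ 2 ≤ z})
      ≤ (gauss d).real ({x | -x ∈ subCone T v} ∩ {x | ‖coneProj T x‖ ^ 2 ≤ z}) := by
    rw [measureReal_def, ← gauss_preimage_neg ((measurableSet_subCone T v).inter hz)]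
    refine measureReal_mono fun x hx => ⟨hx.1, ?_⟩
    have h3 : ‖-x‖ ^ 2 ≤ z := hx.2
    rw [norm_neg] at h3
    exact le_trans (pow_le_pow_left₀ (norm_nonneg _) (norm_coneProj_le T x) 2) h3
  have h3 := h2.trans (gauss_inter_le_mul T hK (fun x hx t ht => ?_) z)
  · rw [h1] at h3
    rcases eq_or_lt_of_le (measureReal_nonneg (μ := gauss d) (s := subCone T v)) with h | h
    · rw [← h, inv_zero, zero_mul]; exact measureReal_nonneg
    · rw [inv_mul_le_iff₀ h]
      exact h3
  · have h4 := mem_subCone.1 hx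
    refine mem_subCone.2 ?_
    have := cone_add_mem T h4 ht
    convert this using 1
    abel

theorem gaussCdfOn_le_div {g : Eu d → ℝ} (T : ProperCone ℝ (Eu d)) {v : Eu d} (hv : v ∈ T) (z : ℝ)
    {c : ℝ} (hc : 0 < c) (hcT : c ≤ (gauss d).real (T : Set (Eu d))) :
    gaussCdfOn g T v z ≤ (gauss d).real {x | g x ≤ z} / c := by
  rw [gaussCdfOn_eq, div_eq_inv_mul]
  refine mul_le_mul ?_ (measureReal_mono Set.inter_subset_right) measureReal_nonneg
    (inv_nonneg.2 hc.le)
  refine inv_anti₀ hc (hcT.trans ?_)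
  exact ENNReal.toReal_mono (measure_ne_top _ _) (gauss_cone_le_subCone T hv)

theorem gaussCdfOn_of_univ {g : Eu d → ℝ} {T : ProperCone ℝ (Eu d)}
    (hT : (T : Set (Eu d)) = Set.univ) (v : Eu d) (z : ℝ) :
    gaussCdfOn g T v z = gaussCdf g z := by
  have h : subCone T v = Set.univ := by
    ext x
    simp only [mem_subCone, Set.mem_univ, iff_true]
    have : v - x ∈ (T : Set (Eu d)) := hT ▸ Set.mem_univ _
    exact this
  rw [gaussCdfOn_eq, h]
  simp [gaussCdf]

theorem gaussCdfOn_mono (g : Eu d → ℝ) (T : ProperCone ℝ (Eu d)) (v : Eu d) :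
    Monotone (gaussCdfOn g T v) :=
  fun _ _ h => measureReal_mono fun _ hx => le_trans hx h

theorem gaussCdf_eq_cdf {g : Eu d → ℝ} (hg : Measurable g) (z : ℝ) :
    gaussCdf g z = cdf ((gauss d).map g) z := by
  have : IsProbabilityMeasure ((gauss d).map g) := Measure.isProbabilityMeasure_map hg.aemeasurable
  rw [cdf_eq_real, map_measureReal_apply hg measurableSet_Iic]
  rfl

theorem gaussCdf_mono (g : Eu d → ℝ) : Monotone (gaussCdf g) :=
  fun _ _ h => measureReal_mono fun _ hx => le_trans hx h

theorem gaussCdf_tendsto_right {g : Eu d → ℝ} (hg : Measurable g) (z : ℝ) :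
    Tendsto (gaussCdf g) (𝓝[≥] z) (𝓝 (gaussCdf g z)) := by
  have h : gaussCdf g = cdf ((gauss d).map g) := funext (gaussCdf_eq_cdf hg)
  rw [h]
  exact (cdf ((gauss d).map g)).right_continuous z

theorem gaussCdf_tendsto_atTop {g : Eu d → ℝ} (hg : Measurable g) :
    Tendsto (gaussCdf g) atTop (𝓝 1) := by
  have h : gaussCdf g = cdf ((gauss d).map g) := funext (gaussCdf_eq_cdf hg)
  rw [h]
  exact tendsto_cdf_atTop _

theorem gaussCdf_tendsto_atBot {g : Eu d → ℝ} (hg : Measurable g) :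
    Tendsto (gaussCdf g) atBot (𝓝 0) := by
  have h : gaussCdf g = cdf ((gauss d).map g) := funext (gaussCdf_eq_cdf hg)
  rw [h]
  exact tendsto_cdf_atBot _

theorem gaussCdf_lt_of_lt_gaussQuantile {g : Eu d → ℝ} (hg : Measurable g) {α : ℝ} (h0 : 0 < α)
    {z : ℝ} (hz : z < gaussQuantile g α) : gaussCdf g z < α := by
  by_contra! h
  suffices hbdd : BddBelow {z : ℝ | α ≤ gaussCdf g z} from
    absurd (csInf_le hbdd h) (not_le.2 hz)
  obtain ⟨b, hb⟩ := ((gaussCdf_tendsto_atBot hg).eventually (gt_mem_nhds h0)).exists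
  refine ⟨b, fun y hy => ?_⟩
  by_contra! hlt
  exact absurd (le_trans hy (gaussCdf_mono g hlt.le)) (not_le.2 hb)

theorem le_gaussCdf_gaussQuantile {g : Eu d → ℝ} (hg : Measurable g) {α : ℝ} (h1 : α < 1) :
    α ≤ gaussCdf g (gaussQuantile g α) := by
  obtain ⟨b, hb⟩ := ((gaussCdf_tendsto_atTop hg).eventually (lt_mem_nhds h1)).exists
  refine ge_of_tendsto ((gaussCdf_tendsto_right hg _).mono_left (nhdsWithin_mono _ Set.Ioi_subset_Ici_self)) ?_
  filter_upwards [self_mem_nhdsWithin] with z hz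
  obtain ⟨y, hy, hyz⟩ := exists_lt_of_csInf_lt ⟨b, hb.le⟩ hz
  exact le_trans hy (gaussCdf_mono g hyz.le)

theorem measurable_normSq_coneProj (T : ProperCone ℝ (Eu d)) :
    Measurable fun x : Eu d => ‖coneProj T x‖ ^ 2 :=
  ((continuous_coneProj T).norm.pow 2).measurable

theorem gaussCdf_normSq_coneProj_le (T : ProperCone ℝ (Eu d)) {a z : ℝ} (h0 : 0 < a) (h1 : a ≤ 1) :
    gaussCdf (fun x => ‖coneProj T x‖ ^ 2) z
      ≤ (a ^ d)⁻¹ * gaussCdf (fun x => ‖coneProj T x‖ ^ 2) (a ^ 2 * z) := by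
  have h := gauss_preimage_smul_le (measurable_normSq_coneProj T (measurableSet_Iic (a := a ^ 2 * z))) h0 h1
  have h2 : {x : Eu d | a • x ∈ (fun x : Eu d => ‖coneProj T x‖ ^ 2) ⁻¹' Set.Iic (a ^ 2 * z)}
      = {x | ‖coneProj T x‖ ^ 2 ≤ z} := by
    ext x
    simp only [Set.mem_preimage, Set.mem_Iic, Set.mem_ofPred_eq]
    rw [coneProj_smul T h0.le, norm_smul, mul_pow, Real.norm_of_nonneg h0.le]
    exact mul_le_mul_iff_right₀ (by positivity)
  rw [h2] at h
  have h3 := ENNReal.toReal_mono (ENNReal.mul_ne_top ENNReal.ofReal_ne_top (measure_ne_top _ _)) h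
  rw [ENNReal.toReal_mul, ENNReal.toReal_ofReal (by positivity)] at h3
  exact h3

/-- Homogeneity and scaling give `G(z) ≤ a^{-d} G(a² z)`. With `a` close to `1`, the factor exceeds
`1` by less than `κ`, while `a² z ≤ z - (1 - a²) z₀`. The restriction `z ≥ z₀ > 0` is essential: the
projection may vanish with positive probability. -/
theorem exists_gaussCdf_normSq_coneProj_sub_le (dmax : ℕ) {z₀ κ : ℝ} (hz₀ : 0 < z₀) (hκ : 0 < κ) :
    ∃ ε : ℝ, 0 < ε ∧ ∀ d ≤ dmax, ∀ T : ProperCone ℝ (Eu d), ∀ z, z₀ ≤ z →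
      gaussCdf (fun x => ‖coneProj T x‖ ^ 2) z
        ≤ gaussCdf (fun x => ‖coneProj T x‖ ^ 2) (z - ε) + κ := by
  have hc : Tendsto (fun a : ℝ => (a ^ dmax)⁻¹) (𝓝[<] 1) (𝓝 1) := by
    have : ContinuousAt (fun a : ℝ => (a ^ dmax)⁻¹) 1 := by
      refine ContinuousAt.inv₀ (by fun_prop) (by simp)
    have h := this.tendsto
    simp only [one_pow, inv_one] at h
    exact h.mono_left nhdsWithin_le_nhds
  obtain ⟨a, hac, ha0, ha1⟩ := ((hc.eventually (gt_mem_nhds (show (1 : ℝ) < 1 + κ by linarith))).and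
    (Ioo_mem_nhdsLT (zero_lt_one' ℝ))).exists
  have ha2 : a ^ 2 < 1 := pow_lt_one₀ ha0.le ha1 two_ne_zero
  refine ⟨(1 - a ^ 2) * z₀, mul_pos (by linarith) hz₀, fun d hd T z hz => ?_⟩
  have h1 := gaussCdf_normSq_coneProj_le T (z := z) ha0 ha1.le
  have h2 : gaussCdf (fun x => ‖coneProj T x‖ ^ 2) (a ^ 2 * z)
      ≤ gaussCdf (fun x => ‖coneProj T x‖ ^ 2) (z - (1 - a ^ 2) * z₀) :=
    gaussCdf_mono _ (by nlinarith)
  have h3 : (a ^ d)⁻¹ ≤ (a ^ dmax)⁻¹ :=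
    inv_anti₀ (by positivity) (pow_le_pow_of_le_one ha0.le ha1.le hd)
  have h4 : gaussCdf (fun x => ‖coneProj T x‖ ^ 2) (a ^ 2 * z) ≤ 1 := measureReal_le_one
  have h5 : 0 ≤ gaussCdf (fun x => ‖coneProj T x‖ ^ 2) (a ^ 2 * z) := measureReal_nonneg
  nlinarith

end Cdf

/-! ### Events of probability tending to one uniformly over the class. -/

section Whp

variable {Ω ι : Type*} [MeasurableSpace Ω] {P : ι → Measure Ω}

/-- The events `E n i` have probability tending to one, uniformly in `i`. -/
def Whp (P : ι → Measure Ω) (E : ℕ → ι → Ω → Prop) : Prop :=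
  ∀ η : ℝ≥0∞, 0 < η → ∀ᶠ n in atTop, ∀ i, P i {ω | ¬E n i ω} ≤ η

theorem Whp.mono {E F : ℕ → ι → Ω → Prop} (hE : Whp P E)
    (h : ∀ᶠ n in atTop, ∀ i ω, E n i ω → F n i ω) : Whp P F := by
  intro η hη
  filter_upwards [hE η hη, h] with n hn hi i
  have hsub : {ω | ¬F n i ω} ⊆ {ω | ¬E n i ω} := fun ω hω hEω => hω (hi i ω hEω)
  exact (measure_mono hsub).trans (hn i)

theorem Whp.and {E F : ℕ → ι → Ω → Prop} (hE : Whp P E) (hF : Whp P F) :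
    Whp P fun n i ω => E n i ω ∧ F n i ω := by
  intro η hη
  have hη2 : 0 < η / 2 := ENNReal.half_pos hη.ne'
  filter_upwards [hE _ hη2, hF _ hη2] with n h1 h2 i
  have hsub : {ω | ¬(E n i ω ∧ F n i ω)} ⊆ {ω | ¬E n i ω} ∪ {ω | ¬F n i ω} := by
    intro ω hω
    by_cases h : E n i ω
    · exact Or.inr fun hf => hω ⟨h, hf⟩
    · exact Or.inl h
  calc P i {ω | ¬(E n i ω ∧ F n i ω)} ≤ P i {ω | ¬E n i ω} + P i {ω | ¬F n i ω} :=
        (measure_mono hsub).trans (measure_union_le _ _)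
    _ ≤ η / 2 + η / 2 := add_le_add (h1 i) (h2 i)
    _ = η := ENNReal.add_halves η

theorem whp_of_ae {E : ℕ → ι → Ω → Prop} (h : ∀ᶠ n in atTop, ∀ i, ∀ᵐ ω ∂(P i), E n i ω) :
    Whp P E := by
  intro η _
  filter_upwards [h] with n hn i
  rw [ae_iff.1 (hn i)]
  exact zero_le

theorem UnifLittleO.whp {v : ℕ → ι → Ω → ℝ≥0∞} (h : UnifLittleO P v) {ε : ℝ} (hε : 0 < ε) :
    Whp P fun n i ω => v n i ω ≤ ENNReal.ofReal ε := by
  intro η hη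
  filter_upwards [(h ε hε).eventually (eventually_le_nhds hη)] with n hn i
  simp only [not_le]
  exact (le_iSup (fun i => P i {ω | ENNReal.ofReal ε < v n i ω}) i).trans hn

/-- Lets one argue as if a tight sequence were bounded by a fixed constant: half of the allowed
probability pays for the bound, half for the event. -/
theorem UnifBigO.whp {v : ℕ → ι → Ω → ℝ} (h : UnifBigO P v) {E : ℕ → ι → Ω → Prop}
    (hE : ∀ C : ℝ, 0 < C → Whp P fun n i ω => |v n i ω| ≤ C → E n i ω) : Whp P E := by
  intro η hη
  have hη2 : 0 < η / 2 := ENNReal.half_pos hη.ne'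
  obtain ⟨ε, hε, hε2⟩ : ∃ ε : ℝ, 0 < ε ∧ ENNReal.ofReal ε ≤ η / 2 := by
    by_cases htop : η / 2 = ∞
    · exact ⟨1, one_pos, htop ▸ le_top⟩
    · exact ⟨(η / 2).toReal, ENNReal.toReal_pos hη2.ne' htop, (ENNReal.ofReal_toReal htop).le⟩
  obtain ⟨C, hC⟩ := h ε hε
  filter_upwards [hC, hE (max C 1) (by positivity) _ hη2] with n h1 h2 i
  have hsub : {ω | ¬E n i ω} ⊆ {ω | C < |v n i ω|} ∪ {ω | ¬(|v n i ω| ≤ max C 1 → E n i ω)} := by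
    intro ω hω
    by_cases h : C < |v n i ω|
    · exact Or.inl h
    · exact Or.inr fun hf => hω (hf ((not_lt.1 h).trans (le_max_left _ _)))
  calc P i {ω | ¬E n i ω} ≤ _ + _ := (measure_mono hsub).trans (measure_union_le _ _)
    _ ≤ η / 2 + η / 2 := add_le_add ((h1 i).trans hε2) (h2 i)
    _ = η := ENNReal.add_halves η

end Whp

/-! ### Finiteness of extended real quantities. -/

section EReal

/-- Every difference involving an infinite value, `⊤ - ⊤` included, has absolute value `∞`; so
closeness forces both terms to be finite. -/
theorem exists_coe_of_abs_sub_le {x y : EReal} {ε : ℝ} (h : (x - y).abs ≤ ENNReal.ofReal ε) :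
    ∃ a b : ℝ, x = a ∧ y = b ∧ |a - b| ≤ max ε 0 := by
  induction x with
  | bot => simp at h
  | top =>
    induction y with
    | bot => simp at h
    | top => simp at h
    | coe b => simp at h
  | coe a =>
    induction y with
    | bot => simp at h
    | top => simp at h
    | coe b =>
      refine ⟨a, b, rfl, rfl, ?_⟩
      rw [← EReal.coe_sub, EReal.abs_def] at h
      rcases le_total 0 ε with h0 | h0
      · rw [max_eq_left h0]; exact (ENNReal.ofReal_le_ofReal_iff h0).1 h
      · rw [ENNReal.ofReal_of_nonpos h0, nonpos_iff_eq_zero, ENNReal.ofReal_eq_zero] at h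
        rwa [max_eq_right h0]

theorem EReal.coe_eq_of_natCast_mul {n : ℕ} (hn : 1 ≤ n) {x : EReal} {a : ℝ}
    (h : (n : EReal) * x = a) : ∃ b : ℝ, x = b ∧ (n : ℝ) * b = a := by
  have hn0 : (0 : EReal) < (n : EReal) := by exact_mod_cast hn
  have hcast : (n : EReal) = ((n : ℝ) : EReal) := rfl
  induction x with
  | bot =>
    rw [EReal.mul_bot_of_pos hn0] at h
    exact absurd h (EReal.bot_ne_coe a)
  | top =>
    rw [EReal.mul_top_of_pos hn0] at h
    exact absurd h (EReal.top_ne_coe a)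
  | coe b =>
    refine ⟨b, rfl, ?_⟩
    rw [hcast, ← EReal.coe_mul] at h
    exact_mod_cast h

end EReal

/-! ### Ratios of masses under a nearly Gaussian weight. -/

section MassRatio

variable {d m : ℕ}

theorem setLIntegral_gaussKernel_comp (B : Set (Eu d)) (hB : MeasurableSet B) (w : Eu d) {r : ℝ}
    (hr : 0 < r) {s : ℝ≥0∞} (hs : (volume : Measure (Eu d)).withDensity gaussKernel = s • gauss d) :
    ∫⁻ x, B.indicator gaussKernel (w - r • x) = ENNReal.ofReal ((r ^ d)⁻¹) * (s * gauss d B) := by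
  rw [lintegral_comp_sub_smul (measurable_gaussKernel.indicator hB) w hr, lintegral_indicator hB,
    ← withDensity_apply _ hB, hs]
  rfl

/-- Comparison of the mass of an event with the total mass for a weight that is close to a Gaussian
kernel in reduced-form coordinates. -/
theorem mass_ratio_le {Θ : Type*} [MeasurableSpace Θ] {prior : Measure Θ} {G₁ : Θ → Eu d}
    {G₂ : Θ → Eu m} (hG₁ : Measurable G₁) (hG₂ : Measurable G₂) {N O : Set Θ} (hN : MeasurableSet N)
    {W : Θ → ℝ≥0∞} {φ : Eu m → ℝ≥0∞} (hφ : Measurable φ)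
    {U : Set (Eu d)} {Y : Set (Eu m)} (hU : MeasurableSet U) (hY : MeasurableSet Y)
    {w : Eu d} {r : ℝ} (hr : 0 < r) {lo hi E₁ E₂ : ℝ≥0∞}
    (hlo : ∀ A, MeasurableSet A → A ⊆ U ×ˢ Y →
      lo * volume A ≤ (prior.restrict N).map (fun θ => (G₁ θ, G₂ θ)) A)
    (hhi : ∀ A, MeasurableSet A → A ⊆ U ×ˢ Y →
      (prior.restrict N).map (fun θ => (G₁ θ, G₂ θ)) A ≤ hi * volume A)
    (hON : O ⊆ N) (hOU : ∀ θ ∈ O, G₁ θ ∈ U ∧ G₂ θ ∈ Y)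
    {A A' B : Set (Eu d)} (hA : MeasurableSet A') (hB : MeasurableSet B)
    (hAA : ∀ θ ∈ O, w - r • G₁ θ ∈ A → w - r • G₁ θ ∈ A')
    (hBO : ∀ θ ∈ N, G₁ θ ∈ U → G₂ θ ∈ Y → w - r • G₁ θ ∈ B → θ ∈ O)
    (hBU : ∀ x, w - r • x ∈ B → x ∈ U)
    (hWup : ∀ θ ∈ O, W θ ≤ E₁ * (gaussKernel (w - r • G₁ θ) * φ (G₂ θ)))
    (hWlo : ∀ θ ∈ O, E₂ * (gaussKernel (w - r • G₁ θ) * φ (G₂ θ)) ≤ W θ)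
    (hJ : ∫⁻ y in Y, φ y ≠ ∞) (hlo0 : lo ≠ 0) (hlo1 : lo ≠ ∞) (hE20 : E₂ ≠ 0)
    (hE21 : E₂ ≠ ∞) :
    (∫⁻ θ, W θ ∂prior)⁻¹ * ∫⁻ θ in O ∩ {θ | w - r • G₁ θ ∈ A}, W θ ∂prior
      ≤ (E₁ / E₂) * (hi / lo) * (gauss d A' / gauss d B) := by
  obtain ⟨s, hs0, hs1, hs⟩ := exists_withDensity_gaussKernel d
  set J := ∫⁻ y in Y, φ y with hJdef
  set ν := (prior.restrict N).map (fun θ => (G₁ θ, G₂ θ)) with hν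
  have hG : Measurable fun θ => (G₁ θ, G₂ θ) := hG₁.prodMk hG₂
  -- Jacobian of `x ↦ w - r • x` times the Gaussian normalization. It appears in numerator and
  -- denominator alike, as does `J`, so both cancel at the end.
  set c := ENNReal.ofReal ((r ^ d)⁻¹) * s with hc
  have hc0 : c ≠ 0 := by
    refine mul_ne_zero ?_ hs0
    rw [ne_eq, ENNReal.ofReal_eq_zero, not_le]; positivity
  have hc1 : c ≠ ∞ := ENNReal.mul_ne_top ENNReal.ofReal_ne_top hs1
  have hUY : MeasurableSet (U ×ˢ Y) := hU.prod hY
  set Φ : Set (Eu d) → Eu d × Eu m → ℝ≥0∞ :=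
    fun D p => D.indicator gaussKernel (w - r • p.1) * φ p.2 with hΦ
  have hIm : ∀ D : Set (Eu d), MeasurableSet D →
      Measurable fun x => D.indicator gaussKernel (w - r • x) := fun D hD =>
    (measurable_gaussKernel.indicator hD).comp (by fun_prop)
  have hΦm : ∀ D, MeasurableSet D → Measurable (Φ D) := fun D hD =>
    ((measurable_gaussKernel.indicator hD).comp (by fun_prop)).mul (hφ.comp measurable_snd)
  have hPm : ∀ D, MeasurableSet D →
      Measurable fun θ => (U ×ˢ Y).indicator (Φ D) (G₁ θ, G₂ θ) := fun D hD =>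
    ((hΦm D hD).indicator hUY).comp hG
  have hvolU : ∀ D, MeasurableSet D → ∫⁻ p in U ×ˢ Y, Φ D p ≤ c * gauss d D * J := by
    intro D hD
    rw [Measure.volume_eq_prod, ← Measure.prod_restrict,
      lintegral_prod_mul (hIm D hD).aemeasurable
        hφ.aemeasurable]
    gcongr
    refine (setLIntegral_le_lintegral _ _).trans (le_of_eq ?_)
    rw [setLIntegral_gaussKernel_comp D hD w hr hs, ← mul_assoc]
  -- An equality, unlike the preceding bound: the preimage of `B` lies inside `U`, so no mass is
  -- lost by restricting to `U`.
  have hvolB : c * gauss d B * J = ∫⁻ p in U ×ˢ Y, Φ B p := by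
    rw [Measure.volume_eq_prod, ← Measure.prod_restrict,
      lintegral_prod_mul (hIm B hB).aemeasurable
        hφ.aemeasurable, ← lintegral_indicator hU]
    congr 1
    rw [hc, mul_assoc, ← setLIntegral_gaussKernel_comp B hB w hr hs]
    refine lintegral_congr fun x => ?_
    by_cases hx : x ∈ U
    · rw [Set.indicator_of_mem hx]
    · rw [Set.indicator_of_notMem hx, Set.indicator_of_notMem fun h => hx (hBU x h)]
  have hν1 : ν.restrict (U ×ˢ Y) ≤ hi • volume.restrict (U ×ˢ Y) := by
    refine Measure.le_iff.2 fun D hD => ?_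
    rw [Measure.restrict_apply hD, Measure.smul_apply, Measure.restrict_apply hD]
    exact hhi _ (hD.inter hUY) Set.inter_subset_right
  have hν2 : lo • volume.restrict (U ×ˢ Y) ≤ ν.restrict (U ×ˢ Y) := by
    refine Measure.le_iff.2 fun D hD => ?_
    rw [Measure.restrict_apply hD, Measure.smul_apply, Measure.restrict_apply hD]
    exact hlo _ (hD.inter hUY) Set.inter_subset_right
  have hpull : ∀ D, MeasurableSet D → ∫⁻ p in U ×ˢ Y, Φ D p ∂ν
      = ∫⁻ θ in N, (U ×ˢ Y).indicator (Φ D) (G₁ θ, G₂ θ) ∂prior := by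
    intro D hD
    rw [← lintegral_indicator hUY, hν, lintegral_map ((hΦm D hD).indicator hUY) hG]
  have hup : ∫⁻ θ in O ∩ {θ | w - r • G₁ θ ∈ A}, W θ ∂prior
      ≤ E₁ * (hi * (c * gauss d A' * J)) := by
    calc ∫⁻ θ in O ∩ {θ | w - r • G₁ θ ∈ A}, W θ ∂prior
        ≤ ∫⁻ θ in O ∩ {θ | w - r • G₁ θ ∈ A},
            E₁ * (U ×ˢ Y).indicator (Φ A') (G₁ θ, G₂ θ) ∂prior := by
          refine setLIntegral_mono ((hPm A' hA).const_mul _)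
            fun θ hθ => ?_
          have h1 := hOU θ hθ.1
          rw [Set.indicator_of_mem (Set.mk_mem_prod h1.1 h1.2)]
          simp only [hΦ]
          rw [Set.indicator_of_mem (hAA θ hθ.1 hθ.2)]
          exact hWup θ hθ.1
      _ ≤ ∫⁻ θ in N, E₁ * (U ×ˢ Y).indicator (Φ A') (G₁ θ, G₂ θ) ∂prior :=
          lintegral_mono_set (Set.inter_subset_left.trans hON)
      _ = E₁ * ∫⁻ p in U ×ˢ Y, Φ A' p ∂ν := by
          rw [lintegral_const_mul _ (hPm A' hA), hpull A' hA]
      _ ≤ E₁ * (hi * (c * gauss d A' * J)) := by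
          refine mul_le_mul_right ?_ _
          refine (lintegral_mono' hν1 le_rfl).trans ?_
          rw [lintegral_smul_measure]
          exact mul_le_mul_right (hvolU A' hA) _
  have hdown : E₂ * (lo * (c * gauss d B * J)) ≤ ∫⁻ θ, W θ ∂prior := by
    calc E₂ * (lo * (c * gauss d B * J)) ≤ E₂ * ∫⁻ p in U ×ˢ Y, Φ B p ∂ν := by
          refine mul_le_mul_right ?_ _
          rw [hvolB]
          refine le_trans (le_of_eq ?_) (lintegral_mono' hν2 le_rfl)
          rw [lintegral_smul_measure]
          rfl
      _ = ∫⁻ θ in N, E₂ * (U ×ˢ Y).indicator (Φ B) (G₁ θ, G₂ θ) ∂prior := by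
          rw [lintegral_const_mul _ (hPm B hB), hpull B hB]
      _ ≤ ∫⁻ θ in N, W θ ∂prior := by
          refine setLIntegral_mono' hN fun θ hθ => ?_
          by_cases h1 : (G₁ θ, G₂ θ) ∈ U ×ˢ Y
          · rw [Set.indicator_of_mem h1]
            simp only [hΦ]
            by_cases h2 : w - r • G₁ θ ∈ B
            · rw [Set.indicator_of_mem h2]
              exact hWlo θ (hBO θ hθ h1.1 h1.2 h2)
            · rw [Set.indicator_of_notMem h2, zero_mul, mul_zero]
              exact zero_le
          · rw [Set.indicator_of_notMem h1, mul_zero]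
            exact zero_le
      _ ≤ ∫⁻ θ, W θ ∂prior := setLIntegral_le_lintegral _ _
  -- If `J = 0` the numerator already vanishes; otherwise `c * J` can be cancelled.
  rcases eq_or_ne J 0 with hJ0 | hJ0
  · rw [hJ0] at hup
    simp only [mul_zero, nonpos_iff_eq_zero] at hup
    rw [hup, mul_zero]
    exact zero_le
  have hgB1 : gauss d B ≠ ∞ := measure_ne_top _ _
  calc _ ≤ (E₂ * (lo * (c * gauss d B * J)))⁻¹ * (E₁ * (hi * (c * gauss d A' * J))) := by
        gcongr
    _ = (E₁ / E₂) * (hi / lo) * (gauss d A' / gauss d B) * ((c * J) / (c * J)) := by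
        rw [ENNReal.mul_inv (Or.inl hE20) (Or.inl hE21), ENNReal.mul_inv (Or.inl hlo0) (Or.inl hlo1),
          ENNReal.mul_inv (Or.inr hJ) (Or.inr hJ0), ENNReal.mul_inv (Or.inl hc0) (Or.inl hc1)]
        simp only [div_eq_mul_inv]
        rw [ENNReal.mul_inv (Or.inl hc0) (Or.inl hc1)]
        ring
    _ = _ := by
        rw [ENNReal.div_self (mul_ne_zero hc0 hJ0) (ENNReal.mul_ne_top hc1 hJ), mul_one]

end MassRatio

/-- Collects the errors of the posterior approximation: `e^{2ε}` from the criterion, `(1 + ε)/(1 -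
ε)` from the prior density, `ε c` from the Gaussian tail. Because `c ≤ q`, the tail error is
relative to the conditioning mass. -/
theorem exists_ratio_slack {η : ℝ} (hη : 0 < η) : ∃ ε : ℝ, 0 < ε ∧ ε < 1 ∧
    ∀ c p q : ℝ, 0 < c → c ≤ q → 0 ≤ p → p ≤ q →
      Real.exp (2 * ε) * ((1 + ε) / (1 - ε)) * ((p + ε * c) / (q - ε * c)) ≤ q⁻¹ * p + η := by
  have hcont : ContinuousAt (fun ε : ℝ => Real.exp (2 * ε) * ((1 + ε) / (1 - ε)) / (1 - ε) * (1 + ε)) 0 := by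
    have h1 : (1 : ℝ) - 0 ≠ 0 := by norm_num
    fun_prop (disch := assumption)
  have h0 := hcont.tendsto
  simp only [mul_zero, Real.exp_zero, add_zero, sub_zero, div_one, mul_one] at h0
  have h1 := (h0.mono_left (nhdsWithin_le_nhds (s := Set.Ioi 0))).eventually
    (gt_mem_nhds (show (1 : ℝ) < 1 + η by linarith))
  obtain ⟨ε, hε, hε0, hε1⟩ := (h1.and (Ioo_mem_nhdsGT (zero_lt_one' ℝ))).exists
  refine ⟨ε, hε0, hε1, fun c p q hc hcq hp hpq => ?_⟩
  have hq : 0 < q := hc.trans_le hcq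
  have h2 : 0 < 1 - ε := by linarith
  set M := Real.exp (2 * ε) * ((1 + ε) / (1 - ε)) with hM
  have hM0 : 0 < M := by positivity
  have hM1 : 1 ≤ M := by
    have a1 : 1 ≤ Real.exp (2 * ε) := Real.one_le_exp (by linarith)
    have a2 : 1 ≤ (1 + ε) / (1 - ε) := by rw [one_le_div h2]; linarith
    exact one_le_mul_of_one_le_of_one_le a1 a2
  have h3 : (p + ε * c) / (q - ε * c) ≤ (q⁻¹ * p + ε) / (1 - ε) := by
    have e : (q⁻¹ * p + ε) / (1 - ε) = (p + ε * q) / (q - ε * q) := by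
      field_simp
    rw [e]
    have h4 : 0 < q - ε * q := by nlinarith
    have h5 : q - ε * q ≤ q - ε * c := by nlinarith
    exact div_le_div₀ (by positivity) (by nlinarith) h4 h5
  have hx : q⁻¹ * p ≤ 1 := by
    rw [inv_mul_le_iff₀ hq]; linarith
  have hx0 : 0 ≤ q⁻¹ * p := by positivity
  calc M * ((p + ε * c) / (q - ε * c)) ≤ M * ((q⁻¹ * p + ε) / (1 - ε)) := by gcongr
    _ = M / (1 - ε) * (q⁻¹ * p + ε) := by ring
    -- With `L = M / (1 - ε) ≥ 1` and `x = p / q ≤ 1`, `L (x + ε) - x ≤ L (1 + ε) - 1 < η`.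
    _ ≤ q⁻¹ * p + η := by
        have hL : 1 ≤ M / (1 - ε) := by rw [one_le_div h2]; linarith
        nlinarith

/-! ### The limit of the quasi-posterior in local coordinates. -/

variable {Ω ι 𝓜 𝓗 D : Type*} [MeasurableSpace Ω] [MeasurableSpace 𝓜] [MeasurableSpace 𝓗]

namespace Model

variable (S : Model Ω ι 𝓜 𝓗 D)

theorem measurable_weight (n : ℕ) (ω : Ω) : Measurable (S.weight n ω) := by
  unfold weight
  have h := S.measurable_Ln n ω
  fun_prop

theorem posterior_apply (n : ℕ) (ω : Ω) {A : Set S.Θ} (hA : MeasurableSet A) :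
    S.posterior n ω A = (∫⁻ θ, S.weight n ω θ ∂S.prior)⁻¹ * ∫⁻ θ in A, S.weight n ω θ ∂S.prior := by
  rw [posterior, Measure.smul_apply, withDensity_apply _ hA, smul_eq_mul]

end Model

namespace LocalExpansion

variable {S : Model Ω ι 𝓜 𝓗 D} {R : LocalExpansion S}

/-- `n L_n` is finite and within `ε` of its quadratic approximation on `Θ_osn`. -/
def GoodApprox (R : LocalExpansion S) (ε : ℝ) (n : ℕ) (i : ι) (ω : Ω) : Prop :=
  ∀ θ ∈ R.Θosn n i, ∃ a : ℝ, S.Ln n ω θ = a ∧ |n * a - R.quadApprox n i ω θ| ≤ ε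

theorem Quad.whp_goodApprox (hquad : R.Quad) {ε : ℝ} (hε : 0 < ε) :
    Whp S.P (R.GoodApprox ε) := by
  refine (hquad.approx.whp hε).mono ?_
  filter_upwards [eventually_ge_atTop 1] with n hn i ω h θ hθ
  have h1 := le_trans (le_iSup₂ (f := fun (θ : S.Θ) (_ : θ ∈ R.Θosn n i) =>
    ((n : EReal) * S.Ln n ω θ - ((R.quadApprox n i ω θ : ℝ) : EReal)).abs) θ hθ) h
  obtain ⟨a, b, ha, hb, hab⟩ := exists_coe_of_abs_sub_le h1
  obtain ⟨a', ha', haa⟩ := EReal.coe_eq_of_natCast_mul hn ha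
  refine ⟨a', ha', ?_⟩
  rw [haa, EReal.coe_injective hb]
  rwa [max_eq_left hε.le] at hab

theorem smul_γhat_sub {n : ℕ} (hn : 1 ≤ n) (i : ι) (ω : Ω) :
    √(n : ℝ) • (R.γhat n i ω - R.τ i) = R.driftProj n i ω := by
  have : √(n : ℝ) ≠ 0 := (Real.sqrt_pos.2 (by exact_mod_cast hn)).ne'
  rw [smul_sub, γhat, smul_smul, mul_inv_cancel₀ this, one_smul, driftProj]

theorem smul_γhat_sub_sub {n : ℕ} (hn : 1 ≤ n) (i : ι) (ω : Ω) (θ : S.Θ) :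
    √(n : ℝ) • (R.γhat n i ω - R.τ i - R.γ i θ) = R.driftProj n i ω - √(n : ℝ) • R.γ i θ := by
  rw [smul_sub, smul_γhat_sub hn]

theorem quadApprox_eq {n : ℕ} (hn : 1 ≤ n) (i : ι) (ω : Ω) (θ : S.Θ) :
    R.quadApprox n i ω θ = R.ell n i ω + 1 / 2 * ‖R.driftProj n i ω‖ ^ 2
      - 1 / 2 * ‖R.driftProj n i ω - √(n : ℝ) • R.γ i θ‖ ^ 2
      - R.fperp n i ω (R.γperp i θ) := by
  rw [quadApprox, smul_γhat_sub hn, smul_γhat_sub_sub hn]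

/-- `√n τ ∈ T` is fixed by the nonexpansive projection. So `w` inherits the tightness of `V_n` even
when the drift diverges. -/
theorem Quad.norm_driftProj_le (hquad : R.Quad) (n : ℕ) (i : ι) (ω : Ω) :
    ‖R.driftProj n i ω‖ ≤ ‖R.V n i ω‖ := by
  have h : R.proj i (√(n : ℝ) • R.τ i) = √(n : ℝ) • R.τ i :=
    coneProj_of_mem _ ((R.T i).smul_mem (hquad.τ_mem i) (Real.sqrt_nonneg _))
  rw [driftProj]
  nth_rewrite 2 [← h]
  refine (norm_coneProj_sub_le _ _ _).trans (le_of_eq ?_)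
  rw [add_sub_cancel_right]

/-- The product property in a form that includes the nonsingular case, where `γ_⊥` has values in a
one-point space. -/
theorem Quad.exists_mem_γ_eq_γperp_eq (hquad : R.Quad) : ∀ᶠ n in atTop, ∀ i, ∀ θ₁ ∈ R.Θosn n i,
    ∀ θ₂ ∈ R.Θosn n i, ∃ θ ∈ R.Θosn n i, R.γ i θ = R.γ i θ₁ ∧ R.γperp i θ = R.γperp i θ₂ := by
  filter_upwards [hquad.product] with n hn i θ₁ h1 θ₂ h2
  rcases Nat.eq_zero_or_pos (R.m i) with hm | hm
  · refine ⟨θ₁, h1, rfl, ?_⟩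
    have : Subsingleton (Eu (R.m i)) := by rw [hm]; infer_instance
    exact Subsingleton.elim _ _
  · have h3 : (R.γ i θ₁, R.γperp i θ₂) ∈ R.γstar i '' R.Θosn n i := by
      rw [hn i hm]
      exact ⟨⟨θ₁, h1, rfl⟩, ⟨θ₂, h2, rfl⟩⟩
    obtain ⟨θ, hθ, he⟩ := h3
    exact ⟨θ, hθ, congrArg Prod.fst he, congrArg Prod.snd he⟩

theorem Quad.exists_cone_mass (hquad : R.Quad) :
    ∃ c : ℝ, 0 < c ∧ ∀ i, c ≤ (gauss (R.d i)).real (R.T i : Set (Eu (R.d i))) := by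
  obtain ⟨c, hc, h⟩ := hquad.cone_mass
  refine ⟨(min c 1).toReal, ENNReal.toReal_pos (by simp [hc.ne']) (by simp), fun i => ?_⟩
  exact ENNReal.toReal_mono (measure_ne_top _ _) ((min_le_left _ _).trans (h i))

/-- The probability of `A` under a standard Gaussian conditional on `v - T`, with
`v = 𝐓(V_n + √n τ)`. -/
def condProb (R : LocalExpansion S) (n : ℕ) (i : ι) (ω : Ω) (A : Set (Eu (R.d i))) : ℝ :=
  ((gauss (R.d i)).real (subCone (R.T i) (R.proj i (R.V n i ω + √(n : ℝ) • R.τ i))))⁻¹ *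
    (gauss (R.d i)).real (subCone (R.T i) (R.proj i (R.V n i ω + √(n : ℝ) • R.τ i)) ∩ A)

/-- The good event does not depend on `A`, so the upper bound can be used for a set and for its
complement; the latter yields a lower bound later. The numerator is enlarged by the whole tail
beyond a radius `r₁`, where the shape of `Θ_osn` is unknown, and the denominator is cut down to `v -
T` within that radius. -/
theorem whp_posterior_le (hreparam : R.Reparam) (hquad : R.Quad) (hprior : R.Prior) {η : ℝ}
    (hη : 0 < η) :
    Whp S.P fun n i ω => ∀ A : Set (Eu (R.d i)), MeasurableSet A →
      S.posterior n ω (R.Θosn n i ∩ {θ | R.driftProj n i ω - √(n : ℝ) • R.γ i θ ∈ A})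
        ≤ ENNReal.ofReal (R.condProb n i ω A + η) := by
  obtain ⟨dmax, hd⟩ := hreparam.dim
  obtain ⟨c, hc, hcT⟩ := hquad.exists_cone_mass
  obtain ⟨ε, hε0, hε1, hε⟩ := exists_ratio_slack hη
  obtain ⟨r₁, hr₁, htail⟩ := exists_gauss_tail_le dmax (η := ENNReal.ofReal (ε * c))
    (ENNReal.ofReal_pos.2 (by positivity))
  obtain ⟨δ, hδ, dens, hdens, hdint, ⟨b, hb, hbd⟩, hdc⟩ := hprior.density
  obtain ⟨r₀, hr₀, hdc⟩ := hdc (ε * b) (by positivity)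
  -- Within `ρ` the prior image has a density, which differs from its value at the origin by at most
  -- the relative error `ε`.
  set ρ := min δ r₀ with hρ
  have hρ0 : 0 < ρ := lt_min hδ hr₀
  refine hquad.tight.whp fun C hC => (hquad.whp_goodApprox hε0).mono ?_
  filter_upwards [eventually_ge_atTop 1, hreparam.subset_ΘN, hreparam.saturated,
    -- `‖√n γ‖ ≤ ‖w‖ + ‖w - √n γ‖ ≤ C + r₁`, so all relevant points lie where the local cone shape
    -- is known.
    hquad.shrink (ρ / 2) (by positivity), hquad.local_cone, hquad.k_tendsto (C + r₁),
    hquad.exists_mem_γ_eq_γperp_eq] with n hn hsub hsat hshrink hcone hk hprod i ω hgood hV A hA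
  rw [abs_norm] at hV
  have hw := (hquad.norm_driftProj_le n i ω).trans hV
  set w := R.driftProj n i ω with hwdef
  set v := R.proj i (R.V n i ω + √(n : ℝ) • R.τ i) with hv
  have hwv : w = v - √(n : ℝ) • R.τ i := rfl
  have hvT : v ∈ R.T i := coneProj_mem _ _
  have hsq : 0 < √(n : ℝ) := Real.sqrt_pos.2 (by exact_mod_cast hn)
  set U := R.Γ i ∩ Metric.ball 0 ρ with hU
  set Y := R.γperp i '' R.Θosn n i with hY
  have hball : ∀ θ ∈ R.Θosn n i, ‖R.γ i θ‖ < ρ ∧ ‖R.γperp i θ‖ < ρ := by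
    intro θ hθ
    have h := hshrink i θ hθ
    rw [γstar, Prod.norm_def, max_le_iff] at h
    exact ⟨by linarith [h.1], by linarith [h.2]⟩
  have hYsub : Y ⊆ R.Γperp i ∩ Metric.ball 0 ρ := by
    rintro _ ⟨θ, hθ, rfl⟩
    exact ⟨(hreparam.mapsTo_γ i θ (hsub i hθ)).2, mem_ball_zero_iff.2 (hball θ hθ).2⟩
  have hUY : ∀ p ∈ U ×ˢ Y, p ∈ R.Γ i ×ˢ R.Γperp i ∧ ‖p‖ < ρ := by
    intro p hp
    have h2 := hYsub hp.2
    refine ⟨⟨hp.1.1, h2.1⟩, ?_⟩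
    rw [Prod.norm_def]
    exact max_lt (mem_ball_zero_iff.1 hp.1.2) (mem_ball_zero_iff.1 h2.2)
  have hdensUY : ∀ p ∈ U ×ˢ Y, |dens i p - dens i 0| ≤ ε * b := fun p hp =>
    hdc i p (hUY p hp).1 ((hUY p hp).2.trans_le (min_le_right _ _))
  have himg : ∀ E, MeasurableSet E → E ⊆ U ×ˢ Y →
      R.priorImage i E = ∫⁻ x in E, ENNReal.ofReal (dens i x) := by
    intro E hE hEs
    refine hdint i E hE (fun p hp => ?_) fun p hp => (hUY p (hEs hp)).1
    exact mem_ball_zero_iff.2 ((hUY p (hEs hp)).2.trans_le (min_le_left _ _))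
  have hlo0 : 0 < dens i 0 - ε * b := by nlinarith [hbd i]
  set K := R.ell n i ω + 1 / 2 * ‖w‖ ^ 2 with hK
  set φ : Eu (R.m i) → ℝ≥0∞ := fun y => ENNReal.ofReal (Real.exp (-R.fperp n i ω y)) with hφ
  have hφm : Measurable φ := by
    have := hquad.measurable_fperp n i ω
    fun_prop
  have hconeIff : ∀ x : Eu (R.d i), w - √(n : ℝ) • x ∈ subCone (R.T i) v →
      ‖w - √(n : ℝ) • x‖ ≤ r₁ → ∃ θ ∈ R.Θosn n i, R.γ i θ = x := by
    intro x hx hx1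
    obtain ⟨t, ht, hxt⟩ := hx
    have h1 : √(n : ℝ) • x = t - √(n : ℝ) • R.τ i := by
      rw [hwv, sub_sub, sub_right_inj] at hxt
      rw [← hxt]; abel
    have h2 : √(n : ℝ) • x ∈ {x | ∃ t ∈ R.T i, x = t - √(n : ℝ) • R.τ i} ∩
        Metric.closedBall 0 (R.k n i) := by
      refine ⟨⟨t, ht, h1⟩, mem_closedBall_zero_iff.2 ?_⟩
      have : √(n : ℝ) • x = w - (w - √(n : ℝ) • x) := by abel
      rw [this]
      exact (norm_sub_le _ _).trans ((add_le_add hw hx1).trans (hk i))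
    rw [← hcone i] at h2
    obtain ⟨⟨θ, hθ, he⟩, -⟩ := h2
    exact ⟨θ, hθ, (smul_right_injective _ hsq.ne' he).symm⟩
  have hnormk : ∀ x : Eu (R.d i), ‖w - √(n : ℝ) • x‖ ≤ r₁ → ‖√(n : ℝ) • x‖ ≤ R.k n i := by
    intro x hx1
    have : √(n : ℝ) • x = w - (w - √(n : ℝ) • x) := by abel
    rw [this]
    exact (norm_sub_le _ _).trans ((add_le_add hw hx1).trans (hk i))
  have htm : MeasurableSet {x : Eu (R.d i) | r₁ < ‖x‖} :=
    measurableSet_lt measurable_const measurable_norm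
  have hweight : ∀ θ ∈ R.Θosn n i, ∃ a : ℝ, S.weight n ω θ = ENNReal.ofReal (Real.exp a) ∧
      |a - (K - 1 / 2 * ‖w - √(n : ℝ) • R.γ i θ‖ ^ 2 - R.fperp n i ω (R.γperp i θ))| ≤ ε := by
    intro θ hθ
    obtain ⟨a, ha, hab⟩ := hgood θ hθ
    refine ⟨n * a, ?_, ?_⟩
    · have h1 : (n : EReal) * S.Ln n ω θ = ((n * a : ℝ) : EReal) := by
        rw [ha, EReal.coe_mul]; rfl
      rw [Model.weight, h1, EReal.exp_coe]
    · rwa [quadApprox_eq hn] at hab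
  have hkernel : ∀ (e : ℝ) (x : Eu (R.d i)) (y : Eu (R.m i)),
      ENNReal.ofReal (Real.exp e) * (gaussKernel x * φ y)
        = ENNReal.ofReal (Real.exp (e - 1 / 2 * ‖x‖ ^ 2 - R.fperp n i ω y)) := by
    intro e x y
    rw [gaussKernel, hφ, ← ENNReal.ofReal_mul (Real.exp_pos _).le, ← Real.exp_add,
      ← ENNReal.ofReal_mul (Real.exp_pos _).le, ← Real.exp_add]
    congr 2; ring
  have hmain := mass_ratio_le (prior := S.prior) (hreparam.measurable_γ i)
    (hreparam.measurable_γperp i) (N := R.ΘN i) (O := R.Θosn n i) (hreparam.measurableSet_ΘN i)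
    (W := S.weight n ω) (φ := φ) hφm (U := U) (Y := Y)
    ((hreparam.measurableSet_Γ i).inter measurableSet_ball) (hreparam.measurableSet_image n i)
    (w := w) (r := √(n : ℝ)) hsq (lo := ENNReal.ofReal (dens i 0 - ε * b))
    (hi := ENNReal.ofReal (dens i 0 + ε * b)) (E₁ := ENNReal.ofReal (Real.exp (K + ε)))
    (E₂ := ENNReal.ofReal (Real.exp (K - ε))) (A := A) (A' := (subCone (R.T i) v ∩ A) ∪ {x | r₁ < ‖x‖})
    (B := subCone (R.T i) v \ {x | r₁ < ‖x‖})
    (fun E hE hEs => by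
      have h1 := himg E hE hEs
      rw [priorImage] at h1
      refine le_trans (le_of_eq ?_) (le_of_le_of_eq (setLIntegral_mono' (s := E)
        (f := fun _ => ENNReal.ofReal (dens i 0 - ε * b)) hE fun x hx => ?_) h1.symm)
      · rw [setLIntegral_const]
      · exact ENNReal.ofReal_le_ofReal (by linarith [(abs_le.1 (hdensUY x (hEs hx))).1]))
    (fun E hE hEs => by
      have h1 := himg E hE hEs
      rw [priorImage] at h1
      refine le_trans (le_of_eq_of_le h1 (setLIntegral_mono' (s := E)
        (g := fun _ => ENNReal.ofReal (dens i 0 + ε * b)) hE fun x hx => ?_)) (le_of_eq ?_)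
      · exact ENNReal.ofReal_le_ofReal (by linarith [(abs_le.1 (hdensUY x (hEs hx))).2])
      · rw [setLIntegral_const])
    (hsub i)
    (fun θ hθ => ⟨⟨(hreparam.mapsTo_γ i θ (hsub i hθ)).1, mem_ball_zero_iff.2 (hball θ hθ).1⟩,
      ⟨θ, hθ, rfl⟩⟩)
    (((measurableSet_subCone _ _).inter hA).union htm) ((measurableSet_subCone _ _).diff htm)
    (fun θ hθ hθA => by
      by_cases hx : r₁ < ‖w - √(n : ℝ) • R.γ i θ‖
      · exact Or.inr hx
      refine Or.inl ⟨?_, hθA⟩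
      have h2 : √(n : ℝ) • R.γ i θ ∈ {x | ∃ θ ∈ R.Θosn n i, x = √(n : ℝ) • R.γ i θ} ∩
          Metric.closedBall 0 (R.k n i) :=
        ⟨⟨θ, hθ, rfl⟩, mem_closedBall_zero_iff.2 (hnormk _ (not_lt.1 hx))⟩
      rw [hcone i] at h2
      obtain ⟨⟨t, ht, he⟩, -⟩ := h2
      exact ⟨t, ht, by rw [he, hwv]; abel⟩)
    -- `γ(θ)` and `γ_⊥(θ)` are attained in `Θ_osn` by two different points. The product property
    -- merges them into one, and saturation transfers membership to `θ`.
    (fun θ hθ hθU hθY hθB => by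
      obtain ⟨θ₁, h1, he1⟩ := hconeIff _ hθB.1 (not_lt.1 hθB.2)
      obtain ⟨θ₂, h2, he2⟩ := hθY
      obtain ⟨ϑ, h3, he3, he4⟩ := hprod i θ₁ h1 θ₂ h2
      refine hsat i ϑ h3 θ hθ ?_ (hnormk _ (not_lt.1 hθB.2))
      rw [γstar, γstar, he3, he4, he1, he2])
    (fun x hx => by
      obtain ⟨θ, hθ, rfl⟩ := hconeIff x hx.1 (not_lt.1 hx.2)
      exact ⟨(hreparam.mapsTo_γ i θ (hsub i hθ)).1, mem_ball_zero_iff.2 (hball θ hθ).1⟩)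
    (fun θ hθ => by
      obtain ⟨a, ha, hab⟩ := hweight θ hθ
      rw [ha, hkernel]
      exact ENNReal.ofReal_le_ofReal (Real.exp_le_exp.2 (by linarith [(abs_le.1 hab).2])))
    (fun θ hθ => by
      obtain ⟨a, ha, hab⟩ := hweight θ hθ
      rw [ha, hkernel]
      exact ENNReal.ofReal_le_ofReal (Real.exp_le_exp.2 (by linarith [(abs_le.1 hab).1])))
    -- Finite `γ_⊥` integral: `f_⊥ ≥ 0` bounds the integrand by one, and `Y` lies in a ball.
    (by
      refine ne_top_of_le_ne_top (b := volume (Metric.ball (0 : Eu (R.m i)) ρ)) measure_ball_lt_top.ne ?_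
      calc ∫⁻ y in Y, φ y ≤ ∫⁻ _ in Y, 1 := by
            refine setLIntegral_mono' (hreparam.measurableSet_image n i) fun y hy => ?_
            rw [hφ, ← ENNReal.ofReal_one]
            refine ENNReal.ofReal_le_ofReal (Real.exp_le_one_iff.2 ?_)
            linarith [hquad.fperp_nonneg n i ω y (hYsub hy).1]
        _ = volume Y := setLIntegral_one Y
        _ ≤ _ := measure_mono fun y hy => (hYsub hy).2)
    (ENNReal.ofReal_pos.2 hlo0).ne' ENNReal.ofReal_ne_top
    (ENNReal.ofReal_pos.2 (Real.exp_pos _)).ne' ENNReal.ofReal_ne_top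
  have hSm : MeasurableSet (R.Θosn n i ∩ {θ | w - √(n : ℝ) • R.γ i θ ∈ A}) := by
    have hγ := hreparam.measurable_γ i
    have hf : Measurable fun θ => w - √(n : ℝ) • R.γ i θ := by fun_prop
    exact (hreparam.measurableSet_Θosn n i).inter (hf hA)
  rw [Model.posterior_apply S n ω hSm]
  refine hmain.trans ?_
  set q := (gauss (R.d i)).real (subCone (R.T i) v) with hq
  set p := (gauss (R.d i)).real (subCone (R.T i) v ∩ A) with hp
  have hcq : c ≤ q := (hcT i).trans
    (ENNReal.toReal_mono (measure_ne_top _ _) (gauss_cone_le_subCone _ hvT))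
  have hpq : p ≤ q := measureReal_mono Set.inter_subset_left
  have ht : (gauss (R.d i)).real {x | r₁ < ‖x‖} ≤ ε * c := by
    have := ENNReal.toReal_mono ENNReal.ofReal_ne_top (htail _ (hd i).2)
    rwa [ENNReal.toReal_ofReal (by positivity)] at this
  have hA' : (gauss (R.d i)).real (subCone (R.T i) v ∩ A ∪ {x | r₁ < ‖x‖}) ≤ p + ε * c :=
    (measureReal_union_le _ _).trans (by linarith)
  have hB' : q - ε * c ≤ (gauss (R.d i)).real (subCone (R.T i) v \ {x | r₁ < ‖x‖}) := by
    have := le_measureReal_sdiff (μ := gauss (R.d i)) (s₁ := subCone (R.T i) v)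
      (s₂ := {x : Eu (R.d i) | r₁ < ‖x‖})
    linarith
  have hhi0 : 0 < dens i 0 + ε * b := by
    have := mul_pos hε0 hb
    linarith
  have hqc : 0 < q - ε * c := by nlinarith
  rw [← ofReal_measureReal (measure_ne_top (gauss (R.d i)) (subCone (R.T i) v ∩ A ∪ {x | r₁ < ‖x‖})),
    ← ofReal_measureReal (measure_ne_top (gauss (R.d i)) (subCone (R.T i) v \ {x | r₁ < ‖x‖})),
    ← ENNReal.ofReal_div_of_pos (Real.exp_pos _), ← ENNReal.ofReal_div_of_pos hlo0,
    ← ENNReal.ofReal_div_of_pos (hqc.trans_le hB'), ← Real.exp_sub,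
    ← ENNReal.ofReal_mul (Real.exp_pos _).le,
    ← ENNReal.ofReal_mul (mul_nonneg (Real.exp_pos _).le (div_nonneg hhi0.le hlo0.le))]
  refine ENNReal.ofReal_le_ofReal (le_trans ?_ (hε c p q hc hcq measureReal_nonneg hpq))
  have e1 : K + ε - (K - ε) = 2 * ε := by ring
  rw [e1]
  have h1ε : 0 < 1 - ε := by linarith
  gcongr ?_ * ?_ * ?_
  · rw [div_le_div_iff₀ hlo0 h1ε]
    nlinarith [hbd i, mul_nonneg hε0.le (sub_nonneg.2 (hbd i))]
  · exact div_le_div₀ (by positivity) hA' hqc hB'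

end LocalExpansion

/-! ### Coverage of the subvector set as one inequality. -/

theorem EReal.coe_mul_sub_le_iff {c a : ℝ} (hc : 0 < c) (x y : EReal) :
    (c : EReal) * ((a : EReal) - x) ≤ y ↔ (a : EReal) - ((c⁻¹ : ℝ) : EReal) * y ≤ x := by
  have hc' : 0 < c⁻¹ := inv_pos.2 hc
  induction x with
  | bot =>
    induction y with
    | bot => simp [EReal.coe_mul_top_of_pos hc, EReal.coe_mul_bot_of_pos hc']
    | top => simp [EReal.coe_mul_top_of_pos hc, EReal.coe_mul_top_of_pos hc']
    | coe y =>
      rw [EReal.sub_bot (EReal.coe_ne_bot a), EReal.coe_mul_top_of_pos hc, ← EReal.coe_mul,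
        ← EReal.coe_sub]
      exact iff_of_false (not_le.2 (EReal.coe_lt_top _)) (not_le.2 (EReal.bot_lt_coe _))
  | top =>
    simp [EReal.coe_mul_bot_of_pos hc]
  | coe x =>
    rw [← EReal.coe_sub, ← EReal.coe_mul]
    induction y with
    | bot =>
      rw [EReal.coe_mul_bot_of_pos hc', EReal.coe_sub_bot]
      exact iff_of_false (not_le.2 (EReal.bot_lt_coe _)) (not_le.2 (EReal.coe_lt_top _))
    | top => simp [EReal.coe_mul_top_of_pos hc']
    | coe y =>
      rw [← EReal.coe_mul, ← EReal.coe_sub, EReal.coe_le_coe_iff, EReal.coe_le_coe_iff,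
        ← le_div_iff₀' hc, div_eq_inv_mul]
      constructor <;> intro h <;> linarith

theorem EReal.le_coe_mul_sub_iff {c a : ℝ} (hc : 0 < c) (x y : EReal) :
    y ≤ (c : EReal) * ((a : EReal) - x) ↔ x ≤ (a : EReal) - ((c⁻¹ : ℝ) : EReal) * y := by
  have hc' : 0 < c⁻¹ := inv_pos.2 hc
  induction x with
  | bot =>
    simp [EReal.coe_mul_top_of_pos hc]
  | top =>
    induction y with
    | bot => simp [EReal.coe_mul_bot_of_pos hc, EReal.coe_mul_bot_of_pos hc']
    | top => simp [EReal.coe_mul_bot_of_pos hc, EReal.coe_mul_top_of_pos hc']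
    | coe y =>
      rw [EReal.sub_top, EReal.coe_mul_bot_of_pos hc, ← EReal.coe_mul,
        ← EReal.coe_sub]
      exact iff_of_false (not_le.2 (EReal.bot_lt_coe _)) (not_le.2 (EReal.coe_lt_top _))
  | coe x =>
    rw [← EReal.coe_sub, ← EReal.coe_mul]
    induction y with
    | bot => simp [EReal.coe_mul_bot_of_pos hc']
    | top =>
      rw [EReal.coe_mul_top_of_pos hc', EReal.sub_top]
      exact iff_of_false (not_le.2 (EReal.coe_lt_top _)) (not_le.2 (EReal.bot_lt_coe _))
    | coe y =>
      rw [← EReal.coe_mul, ← EReal.coe_sub, EReal.coe_le_coe_iff, EReal.coe_le_coe_iff,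
        ← div_le_iff₀' hc, div_eq_inv_mul]
      constructor <;> intro h <;> linarith

theorem EReal.iInf_coe_mul_sub {κ : Sort*} {c a : ℝ} (hc : 0 < c) (x : κ → EReal) :
    ⨅ j, (c : EReal) * ((a : EReal) - x j) = (c : EReal) * ((a : EReal) - ⨆ j, x j) := by
  refine eq_of_forall_le_iff fun y => ?_
  simp only [le_iInf_iff, EReal.le_coe_mul_sub_iff hc, iSup_le_iff]

namespace Model

variable (S : Model Ω ι 𝓜 𝓗 D)

/-- Coverage is decided by the least favourable `μ`, which is what the infimum in `PL_n` records.
Finiteness of `L_n(θ̂)` makes `x ↦ 2n (L_n(θ̂) - x)` exchange suprema and infima even at infinite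
values. -/
theorem mem_coverM_iff {α : ℝ} {n : ℕ} (hn : 1 ≤ n) {i : ι} {ω : Ω} {a : ℝ}
    (ha : S.Ln n ω (S.thetaHat n ω) = a) :
    ω ∈ S.coverM α n i ↔ S.PQn n ω (S.MI i) ≤ S.ξmcp α n i ω := by
  have hc : (0 : ℝ) < 2 * n := by
    have : (0 : ℝ) < n := by exact_mod_cast hn
    positivity
  have h1 : ω ∈ S.coverM α n i ↔ ∀ μ ∈ S.MI i, ((2 * n : ℝ) : EReal) *
      ((a : EReal) - ⨆ η : {η : 𝓗 // (μ, η) ∈ S.Θ}, S.Ln n ω ⟨(μ, η.1), η.2⟩)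
        ≤ S.ξmcp α n i ω := by
    refine forall₂_congr fun μ hμ => ?_
    have h2 : ∃ η, (μ, η) ∈ S.Θ := by
      obtain ⟨η, h, -⟩ := hμ
      exact ⟨η, h⟩
    simp only [MHat, Qn, ha, Set.mem_ofPred_eq, h2, true_and]
    rw [EReal.iInf_coe_mul_sub hc]
  rw [h1, PQn, ha, EReal.coe_mul_sub_le_iff hc, PLn]
  simp only [le_iInf_iff, EReal.coe_mul_sub_le_iff hc]

end Model

/-! ### Expansions of the likelihood ratio statistics. -/

namespace LocalExpansion

variable {S : Model Ω ι 𝓜 𝓗 D} {R : LocalExpansion S}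

theorem whp_thetaHat (hreparam : R.Reparam) (hcontraction : R.Contraction) (hquad : R.Quad) {ε : ℝ}
    (hε : 0 < ε) :
    Whp S.P fun n i ω => ∃ a : ℝ, S.Ln n ω (S.thetaHat n ω) = a ∧
      |n * a - (R.ell n i ω + 1 / 2 * ‖R.driftProj n i ω‖ ^ 2)| ≤ ε := by
  have hε2 : 0 < ε / 2 := by positivity
  refine hquad.tight.whp fun C hC =>
    ((hquad.whp_goodApprox hε2).and (hcontraction.consistent.whp hε2)).mono ?_
  filter_upwards [eventually_ge_atTop 1, hreparam.subset_ΘN, hquad.local_cone, hquad.k_tendsto C,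
    hquad.exists_mem_γ_eq_γperp_eq] with n hn hsub hcone hk hprod i ω ⟨hgood, hcons⟩ hV
  rw [abs_norm] at hV
  have hw := (hquad.norm_driftProj_le n i ω).trans hV
  have hn0 : (0 : ℝ) < n := by exact_mod_cast hn
  have hsq : 0 < √(n : ℝ) := Real.sqrt_pos.2 hn0
  obtain ⟨θI, hθI⟩ := S.nonempty_ΘI i
  have hθI' : θI ∈ R.Θosn n i := hreparam.ΘI_subset n i hθI
  have hγI : R.γstar i θI = 0 := (hreparam.zero_iff i θI (hsub i hθI')).2 hθI
  have hw2 : R.driftProj n i ω ∈ {x | ∃ t ∈ R.T i, x = t - √(n : ℝ) • R.τ i} ∩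
      Metric.closedBall 0 (R.k n i) :=
    ⟨⟨_, coneProj_mem _ _, rfl⟩, mem_closedBall_zero_iff.2 (hw.trans (hk i))⟩
  rw [← hcone i] at hw2
  obtain ⟨⟨θ₁, h1, he1⟩, -⟩ := hw2
  -- A maximizer of the quadratic approximation: `√n γ = w`, attainable because `w ∈ T - √n τ`,
  -- together with `γ_⊥ = 0` borrowed from a point of `Θ_I`.
  obtain ⟨θ₀, h0, hγ0, hp0⟩ := hprod i θ₁ h1 θI hθI'
  set K := R.ell n i ω + 1 / 2 * ‖R.driftProj n i ω‖ ^ 2 with hK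
  have hq0 : R.quadApprox n i ω θ₀ = K := by
    have h2 : R.γperp i θI = 0 := congrArg Prod.snd hγI
    rw [quadApprox_eq hn, hγ0, hp0, ← he1, sub_self, norm_zero, h2, hquad.fperp_zero]
    simp [hK]
  have hqle : ∀ θ ∈ R.Θosn n i, R.quadApprox n i ω θ ≤ K := by
    intro θ hθ
    have h2 := hquad.fperp_nonneg n i ω _ (hreparam.mapsTo_γ i θ (hsub i hθ)).2
    have h3 : 0 ≤ ‖R.driftProj n i ω - √(n : ℝ) • R.γ i θ‖ ^ 2 := by positivity
    rw [quadApprox_eq hn]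
    linarith
  set s : EReal := ⨆ θ : R.Θosn n i, S.Ln n ω θ.1 with hs
  have hs1 : s ≤ (((K + ε / 2) / n : ℝ) : EReal) := by
    refine iSup_le fun θ => ?_
    obtain ⟨a, ha, hab⟩ := hgood θ.1 θ.2
    rw [ha, EReal.coe_le_coe_iff, le_div_iff₀' hn0]
    linarith [(abs_le.1 hab).2, hqle θ.1 θ.2]
  have hs2 : (((K - ε / 2) / n : ℝ) : EReal) ≤ s := by
    obtain ⟨a, ha, hab⟩ := hgood θ₀ h0
    refine le_trans ?_ (le_iSup (fun θ : R.Θosn n i => S.Ln n ω θ.1) ⟨θ₀, h0⟩)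
    simp only
    rw [ha, EReal.coe_le_coe_iff, div_le_iff₀' hn0]
    linarith [(abs_le.1 hab).1]
  have habs : (S.Ln n ω (S.thetaHat n ω) - s).abs ≤ ENNReal.ofReal (ε / 2 / n) := by
    rw [ENNReal.ofReal_div_of_pos hn0, ENNReal.ofReal_natCast, ENNReal.le_div_iff_mul_le
      (Or.inl (by positivity)) (Or.inl (by simp)), mul_comm]
    exact hcons
  obtain ⟨a, b, ha, hb, hab⟩ := exists_coe_of_abs_sub_le habs
  rw [max_eq_left (by positivity)] at hab
  rw [hb, EReal.coe_le_coe_iff] at hs1 hs2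
  rw [le_div_iff₀' hn0] at hs1
  rw [div_le_iff₀' hn0] at hs2
  refine ⟨a, ha, ?_⟩
  have h4 : |n * a - n * b| ≤ ε / 2 := by
    rw [← mul_sub, abs_mul, abs_of_pos hn0]
    rwa [le_div_iff₀' hn0] at hab
  rw [abs_le] at h4 ⊢
  constructor <;> linarith [h4.1, h4.2]

theorem coe_two_mul_mul_sub (n : ℕ) (a b : ℝ) :
    ((2 * n : ℝ) : EReal) * ((a : EReal) - b) = ((2 * (n * a - n * b) : ℝ) : EReal) := by
  rw [← EReal.coe_sub, ← EReal.coe_mul]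
  congr 1; ring

theorem whp_Qn (hreparam : R.Reparam) (hcontraction : R.Contraction) (hquad : R.Quad) {ε : ℝ}
    (hε : 0 < ε) :
    Whp S.P fun n i ω => ∀ θ ∈ R.Θosn n i, ∃ q : ℝ, S.Qn n ω θ = q ∧
      |q - (‖R.driftProj n i ω - √(n : ℝ) • R.γ i θ‖ ^ 2 + 2 * R.fperp n i ω (R.γperp i θ))|
        ≤ ε := by
  -- Two errors, at `θ̂` and at `θ`, each doubled by the factor `2n`.
  have hε4 : 0 < ε / 4 := by positivity
  refine ((hquad.whp_goodApprox hε4).and (whp_thetaHat hreparam hcontraction hquad hε4)).mono ?_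
  filter_upwards [eventually_ge_atTop 1] with n hn i ω ⟨hgood, a, ha, hak⟩ θ hθ
  obtain ⟨b, hb, hbq⟩ := hgood θ hθ
  refine ⟨2 * (n * a - n * b), by rw [Model.Qn, ha, hb, coe_two_mul_mul_sub], ?_⟩
  rw [quadApprox_eq hn] at hbq
  rw [abs_le] at hak hbq ⊢
  constructor <;> linarith [hak.1, hak.2, hbq.1, hbq.2]

theorem whp_PQn (hreparam : R.Reparam) (hcontraction : R.Contraction) (hquad : R.Quad)
    {f : (i : ι) → Eu (R.d i) → ℝ} (hf : R.Profile f) {ε : ℝ} (hε : 0 < ε) :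
    Whp S.P fun n i ω => ∀ θ ∈ R.Θosn n i, ∃ q : ℝ, S.PQn n ω (S.Mset i θ) = q ∧
      |q - f i (R.driftProj n i ω - √(n : ℝ) • R.γ i θ)| ≤ ε := by
  have hε4 : 0 < ε / 4 := by positivity
  refine ((hf.approx.whp hε4).and (whp_thetaHat hreparam hcontraction hquad hε4)).mono ?_
  filter_upwards [eventually_ge_atTop 1] with n hn i ω ⟨happ, a, ha, hak⟩ θ hθ
  have h1 := le_trans (le_iSup₂ (f := fun (θ : S.Θ) (_ : θ ∈ R.Θosn n i) =>
    ((n : EReal) * S.PLn n ω (S.Mset i θ) - ((R.profileApprox f n i ω θ : ℝ) : EReal)).abs) θ hθ)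
      happ
  obtain ⟨c, c', hc, hc', hcc⟩ := exists_coe_of_abs_sub_le h1
  obtain ⟨b, hb, hbc⟩ := EReal.coe_eq_of_natCast_mul hn hc
  rw [max_eq_left hε4.le, ← hbc, ← EReal.coe_injective hc', profileApprox, smul_γhat_sub hn,
    smul_γhat_sub_sub hn] at hcc
  refine ⟨2 * (n * a - n * b), by rw [Model.PQn, ha, hb, coe_two_mul_mul_sub], ?_⟩
  rw [abs_le] at hak hcc ⊢
  constructor <;> linarith [hak.1, hak.2, hcc.1, hcc.2]

end LocalExpansion

theorem innerProb_le (P : Measure Ω) [IsProbabilityMeasure P] (A : Set Ω) : innerProb P A ≤ P A := by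
  rw [innerProb, tsub_le_iff_right]
  calc (1 : ℝ≥0∞) = P Set.univ := measure_univ.symm
    _ = P (A ∪ Aᶜ) := by rw [Set.union_compl_self]
    _ ≤ _ := measure_union_le _ _

/-! ### Critical values and coverage for a general pair of limit statistics. -/

namespace LocalExpansion

variable {S : Model Ω ι 𝓜 𝓗 D} {R : LocalExpansion S}

theorem condProb_eq_gaussCdfOn (g : (i : ι) → Eu (R.d i) → ℝ) (n : ℕ) (i : ι) (ω : Ω) (z : ℝ) :
    R.condProb n i ω {x | g i x ≤ z}
      = gaussCdfOn (g i) (R.T i) (R.proj i (R.V n i ω + √(n : ℝ) • R.τ i)) z :=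
  (gaussCdfOn_eq _ _ _ _).symm

theorem condProb_nonneg (n : ℕ) (i : ι) (ω : Ω) (A : Set (Eu (R.d i))) :
    0 ≤ R.condProb n i ω A :=
  mul_nonneg (inv_nonneg.2 measureReal_nonneg) measureReal_nonneg

theorem Quad.condProb_compl (hquad : R.Quad) (n : ℕ) (i : ι) (ω : Ω) {A : Set (Eu (R.d i))}
    (hA : MeasurableSet A) : R.condProb n i ω Aᶜ = 1 - R.condProb n i ω A := by
  obtain ⟨c, hc, hcT⟩ := hquad.exists_cone_mass
  rw [condProb, condProb]
  set Q := subCone (R.T i) (R.proj i (R.V n i ω + √(n : ℝ) • R.τ i)) with hQ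
  have hq : 0 < (gauss (R.d i)).real Q := hc.trans_le ((hcT i).trans
    (ENNReal.toReal_mono (measure_ne_top _ _) (gauss_cone_le_subCone _ (coneProj_mem _ _))))
  have h := measureReal_inter_add_sdiff (μ := gauss (R.d i)) (s := Q) hA
  rw [Set.sdiff_eq] at h
  rw [eq_sub_iff_add_eq, ← mul_add, add_comm, h, inv_mul_cancel₀ hq.ne']

variable {α : ℝ} {X : ℕ → (i : ι) → Ω → S.Θ → EReal} {ξ : ℕ → ι → Ω → EReal}
  {cover : ℕ → ι → Set Ω} {g h : (i : ι) → Eu (R.d i) → ℝ}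

/-- Uniform lower bound of the Monte Carlo critical value. -/
theorem whp_le_criticalValue (hα0 : 0 < α) (hreparam : R.Reparam) (hcontraction : R.Contraction)
    (hquad : R.Quad) (hprior : R.Prior)
    (hMC : UnifLittleO S.P fun n i ω => (ξ n i ω - quantile (S.posterior n ω) (X n i ω) α).abs)
    (hg : ∀ i, Measurable (g i))
    (hlow : ∀ ε : ℝ, 0 < ε → Whp S.P fun n i ω => ∀ θ ∈ R.Θosn n i,
      ((g i (R.driftProj n i ω - √(n : ℝ) • R.γ i θ) - ε : ℝ) : EReal) ≤ X n i ω θ)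
    {ε δ : ℝ} (hε : 0 < ε) (hδ : 0 < δ) {p : ι → ℝ}
    (hp : ∀ i, ∀ v ∈ R.T i, gaussCdfOn (g i) (R.T i) v (p i) ≤ α - δ) :
    Whp S.P fun n i ω => ((p i - 2 * ε : ℝ) : EReal) ≤ ξ n i ω := by
  have hδ4 : 0 < δ / 4 := by positivity
  refine ((((hcontraction.contract.whp hδ4).and
    (whp_posterior_le hreparam hquad hprior hδ4)).and (hlow ε hε)).and (hMC.whp hε)).mono ?_
  refine Eventually.of_forall fun n i ω ⟨⟨⟨hcon, hpost⟩, hX⟩, hmc⟩ => ?_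
  have hquant : ((p i - ε : ℝ) : EReal) ≤ quantile (S.posterior n ω) (X n i ω) α := by
    refine le_sInf fun c hc => ?_
    -- A value `c < p - ε` would carry posterior mass at most `(α - δ) + δ/4 + δ/4 < α`, so it
    -- cannot enter the infimum defining the quantile.
    by_contra! hlt
    refine absurd (show ENNReal.ofReal α ≤ _ from hc) (not_le.2 ?_)
    have hA : MeasurableSet {x | g i x ≤ p i} := hg i measurableSet_Iic
    have hsub : {θ | X n i ω θ ≤ c} ⊆ (R.Θosn n i)ᶜ ∪ (R.Θosn n i ∩
        {θ | R.driftProj n i ω - √(n : ℝ) • R.γ i θ ∈ {x | g i x ≤ p i}}) := by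
      intro θ hθ
      by_cases hO : θ ∈ R.Θosn n i
      · refine Or.inr ⟨hO, ?_⟩
        have h1 := ((hX θ hO).trans hθ).trans_lt hlt
        rw [EReal.coe_lt_coe_iff] at h1
        have h2 : g i (R.driftProj n i ω - √(n : ℝ) • R.γ i θ) ≤ p i := by linarith
        exact h2
      · exact Or.inl hO
    have h2 := hp i _ (coneProj_mem (R.T i) (R.V n i ω + √(n : ℝ) • R.τ i))
    have h3 := condProb_eq_gaussCdfOn g n i ω (p i)
    have h4 := condProb_nonneg n i ω {x | g i x ≤ p i}
    calc S.posterior n ω {θ | X n i ω θ ≤ c}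
        ≤ ENNReal.ofReal (δ / 4) + ENNReal.ofReal (R.condProb n i ω {x | g i x ≤ p i} + δ / 4) :=
          (measure_mono hsub).trans ((measure_union_le _ _).trans (add_le_add hcon (hpost _ hA)))
      _ = ENNReal.ofReal (δ / 4 + (R.condProb n i ω {x | g i x ≤ p i} + δ / 4)) :=
          (ENNReal.ofReal_add hδ4.le (by linarith)).symm
      _ < ENNReal.ofReal α := by
          refine (ENNReal.ofReal_lt_ofReal_iff hα0).2 ?_
          rw [h3]
          have : gaussCdfOn (g i) (R.T i) (R.proj i (R.V n i ω + √(n : ℝ) • R.τ i)) (p i) ≤ α - δ := h2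
          linarith
  obtain ⟨a, b, ha, hb, hab⟩ := exists_coe_of_abs_sub_le hmc
  rw [max_eq_left hε.le] at hab
  rw [hb, EReal.coe_le_coe_iff] at hquant
  rw [ha, EReal.coe_le_coe_iff]
  linarith [(abs_le.1 hab).1]

/-- Uniform upper bound of the Monte Carlo critical value. -/
theorem whp_criticalValue_le (hα0 : 0 < α) (hreparam : R.Reparam) (hcontraction : R.Contraction)
    (hquad : R.Quad) (hprior : R.Prior)
    (hMC : UnifLittleO S.P fun n i ω => (ξ n i ω - quantile (S.posterior n ω) (X n i ω) α).abs)
    (hg : ∀ i, Measurable (g i))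
    (hup : ∀ ε : ℝ, 0 < ε → Whp S.P fun n i ω => ∀ θ ∈ R.Θosn n i,
      X n i ω θ ≤ ((g i (R.driftProj n i ω - √(n : ℝ) • R.γ i θ) + ε : ℝ) : EReal))
    {ε δ : ℝ} (hε : 0 < ε) (hδ : 0 < δ) {i : ι} {p : ℝ}
    (hp : ∀ v ∈ R.T i, α + δ ≤ gaussCdfOn (g i) (R.T i) v p) :
    Whp S.P fun n j ω => j = i → ξ n j ω ≤ ((p + 2 * ε : ℝ) : EReal) := by
  have hδ4 : 0 < δ / 4 := by positivity
  have hproper : Whp S.P fun n _ ω => ∫⁻ θ, S.weight n ω θ ∂S.prior < ∞ :=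
    whp_of_ae (by
      filter_upwards [eventually_ge_atTop 1] with n hn j using hprior.proper j n hn)
  refine (((((hcontraction.contract.whp hδ4).and
    (whp_posterior_le hreparam hquad hprior hδ4)).and (hup ε hε)).and (hMC.whp hε)).and
      hproper).mono ?_
  refine Eventually.of_forall fun n j ω ⟨⟨⟨⟨hcon, hpost⟩, hX⟩, hmc⟩, hfin⟩ hji => ?_
  subst hji
  obtain ⟨a, b, ha, hb, hab⟩ := exists_coe_of_abs_sub_le hmc
  rw [max_eq_left hε.le] at hab
  -- With zero total weight the quasi-posterior would be the zero measure and its quantile `sInf ∅ =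
  -- ⊤`, contrary to the finite value forced by Monte Carlo convergence.
  have hZ0 : ∫⁻ θ, S.weight n ω θ ∂S.prior ≠ 0 := by
    intro h0
    have hz : S.posterior n ω = 0 := by
      rw [Model.posterior, withDensity_eq_zero_iff (S.measurable_weight n ω).aemeasurable |>.2
        ((lintegral_eq_zero_iff (S.measurable_weight n ω)).1 h0), smul_zero]
    rw [hz, quantile] at hb
    have he : {c : EReal | ENNReal.ofReal α ≤ (0 : Measure S.Θ) {s | X n j ω s ≤ c}} = ∅ := by
      ext c
      simp [hα0]
    rw [he, sInf_empty] at hb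
    exact EReal.top_ne_coe b hb
  have huniv : S.posterior n ω Set.univ = 1 := by
    rw [Model.posterior_apply S n ω MeasurableSet.univ, Measure.restrict_univ,
      ENNReal.inv_mul_cancel hZ0 hfin.ne]
  set O := R.Θosn n j with hO
  set A : Set (Eu (R.d j)) := {x | g j x ≤ p} with hAdef
  have hA : MeasurableSet A := hg j measurableSet_Iic
  set z : S.Θ → Eu (R.d j) := fun θ => R.driftProj n j ω - √(n : ℝ) • R.γ j θ with hz
  have hcp : α + δ ≤ R.condProb n j ω A := by
    rw [hAdef, condProb_eq_gaussCdfOn g n j ω p]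
    exact hp _ (coneProj_mem (R.T j) (R.V n j ω + √(n : ℝ) • R.τ j))
  have hcn := condProb_nonneg n j ω Aᶜ
  have hcc := hquad.condProb_compl n j ω hA
  -- The lower bound comes from the upper bound on the complement and from total mass one.
  have hmass : ENNReal.ofReal α ≤ S.posterior n ω (O ∩ {θ | z θ ∈ A}) := by
    have hcover : (Set.univ : Set S.Θ) ⊆ (Oᶜ ∪ (O ∩ {θ | z θ ∈ Aᶜ})) ∪ (O ∩ {θ | z θ ∈ A}) := by
      intro θ _
      by_cases h1 : θ ∈ O
      · by_cases h2 : z θ ∈ A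
        · exact Or.inr ⟨h1, h2⟩
        · exact Or.inl (Or.inr ⟨h1, h2⟩)
      · exact Or.inl (Or.inl h1)
    have h1 : (1 : ℝ≥0∞) ≤ ENNReal.ofReal (1 - α) + S.posterior n ω (O ∩ {θ | z θ ∈ A}) := by
      calc (1 : ℝ≥0∞) = S.posterior n ω Set.univ := huniv.symm
        _ ≤ S.posterior n ω Oᶜ + S.posterior n ω (O ∩ {θ | z θ ∈ Aᶜ})
            + S.posterior n ω (O ∩ {θ | z θ ∈ A}) :=
          (measure_mono hcover).trans ((measure_union_le _ _).trans
            (add_le_add_left (measure_union_le _ _) _))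
        _ ≤ ENNReal.ofReal (δ / 4) + ENNReal.ofReal (R.condProb n j ω Aᶜ + δ / 4)
            + S.posterior n ω (O ∩ {θ | z θ ∈ A}) :=
          add_le_add_left (add_le_add hcon (hpost _ hA.compl)) _
        _ ≤ _ := by
          refine add_le_add_left ?_ _
          rw [← ENNReal.ofReal_add hδ4.le (by linarith)]
          exact ENNReal.ofReal_le_ofReal (by linarith)
    have h2 : ENNReal.ofReal α = 1 - ENNReal.ofReal (1 - α) := by
      rw [← ENNReal.ofReal_one, ← ENNReal.ofReal_sub _ (by linarith)]
      congr 1; ring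
    rw [h2]
    exact tsub_le_iff_left.2 h1
  have hquant : quantile (S.posterior n ω) (X n j ω) α ≤ ((p + ε : ℝ) : EReal) := by
    refine sInf_le (hmass.trans (measure_mono fun θ hθ => ?_))
    refine (hX θ hθ.1).trans (EReal.coe_le_coe_iff.2 ?_)
    have h3 : g j (z θ) ≤ p := hθ.2
    simp only [hz] at h3
    linarith
  rw [hb, EReal.coe_le_coe_iff] at hquant
  rw [ha, EReal.coe_le_coe_iff]
  linarith [(abs_le.1 hab).2]

theorem Quad.measurableSet_le (hquad : R.Quad) (hh : ∀ i, Measurable (h i)) (n : ℕ) (i : ι) (z : ℝ) :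
    MeasurableSet {ω | h i (R.V n i ω) ≤ z} :=
  ((hh i).comp (hquad.measurable_V n i)) measurableSet_Iic

/-- Uniform asymptotic coverage is at least the nominal level. -/
theorem le_liminf_coverage (hα0 : 0 < α) (hreparam : R.Reparam)
    (hcontraction : R.Contraction) (hquad : R.Quad) (hprior : R.Prior)
    (hMC : UnifLittleO S.P fun n i ω => (ξ n i ω - quantile (S.posterior n ω) (X n i ω) α).abs)
    (hg : ∀ i, Measurable (g i)) (hh : ∀ i, Measurable (h i))
    (hlow : ∀ ε : ℝ, 0 < ε → Whp S.P fun n i ω => ∀ θ ∈ R.Θosn n i,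
      ((g i (R.driftProj n i ω - √(n : ℝ) • R.γ i θ) - ε : ℝ) : EReal) ≤ X n i ω θ)
    (hcov : ∀ ε : ℝ, 0 < ε → Whp S.P fun n i ω =>
      ((g i (R.driftProj n i ω) + ε : ℝ) : EReal) ≤ ξ n i ω → ω ∈ cover n i)
    (hdrift : ∀ i, ∀ n, 1 ≤ n → ∀ᵐ ω ∂(S.P i), g i (R.driftProj n i ω) ≤ h i (R.V n i ω))
    (hK : R.KolmogorovConv h)
    (hlevel : ∀ κ : ℝ, 0 < κ → ∃ ε δ : ℝ, 0 < ε ∧ 0 < δ ∧ ∃ p : ι → ℝ, ∀ i,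
      (∀ v ∈ R.T i, gaussCdfOn (g i) (R.T i) v (p i) ≤ α - δ) ∧
        α - κ ≤ gaussCdf (h i) (p i - 4 * ε)) :
    ENNReal.ofReal α ≤ liminf (fun n => ⨅ i, innerProb (S.P i) (cover n i)) atTop := by
  -- One `κ` each for the exceptional event, the Kolmogorov distance and the choice of level. On the
  -- good event `h(V_n) ≤ p - 4ε` gives `g(w) + ε ≤ p - 3ε ≤ p - 2ε ≤ ξ`, hence coverage.
  have key : ∀ κ : ℝ, 0 < κ → ∀ᶠ n in atTop, ∀ i,
      ENNReal.ofReal (α - 3 * κ) ≤ innerProb (S.P i) (cover n i) := by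
    intro κ hκ
    obtain ⟨ε, δ, hε, hδ, p, hp⟩ := hlevel κ hκ
    have hwhp := ((whp_le_criticalValue hα0 hreparam hcontraction hquad hprior hMC hg hlow hε hδ
      (fun i => (hp i).1)).and (hcov ε hε)).and (whp_of_ae (P := S.P)
        (E := fun n i ω => g i (R.driftProj n i ω) ≤ h i (R.V n i ω)) (by
          filter_upwards [eventually_ge_atTop 1] with n hn j using hdrift j n hn))
    filter_upwards [hwhp (ENNReal.ofReal κ) (ENNReal.ofReal_pos.2 hκ), hK κ hκ] with n hn hKn i
    have := S.isProb i
    set z := p i - 4 * ε with hz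
    have hsub : (cover n i)ᶜ ⊆ {ω | h i (R.V n i ω) ≤ z}ᶜ ∪
        {ω | ¬((((p i - 2 * ε : ℝ) : EReal) ≤ ξ n i ω ∧
          (((g i (R.driftProj n i ω) + ε : ℝ) : EReal) ≤ ξ n i ω → ω ∈ cover n i)) ∧
            g i (R.driftProj n i ω) ≤ h i (R.V n i ω))} := by
      intro ω hω
      by_contra hcon
      rw [Set.mem_union, not_or] at hcon
      obtain ⟨h1, h2⟩ := hcon
      rw [Set.notMem_compl_iff] at h1
      obtain ⟨⟨h3, h4⟩, h5⟩ := not_not.1 h2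
      refine hω (h4 (le_trans (EReal.coe_le_coe_iff.2 ?_) h3))
      have h6 : h i (R.V n i ω) ≤ z := h1
      linarith
    have hm := hquad.measurableSet_le hh n i z
    have hprob : S.P i {ω | h i (R.V n i ω) ≤ z}ᶜ
        = ENNReal.ofReal (1 - (S.P i).real {ω | h i (R.V n i ω) ≤ z}) := by
      rw [← ofReal_measureReal (measure_ne_top _ _), probReal_compl_eq_one_sub hm]
    have hG := (abs_le.1 (hKn i z)).1
    have hGα := (hp i).2
    have hr1 : (S.P i).real {ω | h i (R.V n i ω) ≤ z} ≤ 1 := measureReal_le_one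
    have hle : S.P i (cover n i)ᶜ ≤ ENNReal.ofReal (1 - (α - 3 * κ)) := by
      calc S.P i (cover n i)ᶜ ≤ _ + _ := (measure_mono hsub).trans (measure_union_le _ _)
        _ ≤ ENNReal.ofReal (1 - (S.P i).real {ω | h i (R.V n i ω) ≤ z}) + ENNReal.ofReal κ :=
          add_le_add hprob.le (hn i)
        _ = ENNReal.ofReal (1 - (S.P i).real {ω | h i (R.V n i ω) ≤ z} + κ) :=
          (ENNReal.ofReal_add (by linarith) hκ.le).symm
        _ ≤ _ := ENNReal.ofReal_le_ofReal (by linarith)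
    rw [innerProb]
    refine le_trans (le_of_eq_of_le ?_ (tsub_le_tsub_left hle 1)) le_rfl
    rw [← ENNReal.ofReal_one, ← ENNReal.ofReal_sub _ (by linarith)]
    congr 1; ring
  have hlim : Tendsto (fun κ : ℝ => ENNReal.ofReal (α - 3 * κ)) (𝓝[>] 0) (𝓝 (ENNReal.ofReal α)) := by
    have hc : Continuous fun κ : ℝ => ENNReal.ofReal (α - 3 * κ) :=
      ENNReal.continuous_ofReal.comp (by fun_prop)
    have := hc.tendsto 0
    simp only [mul_zero, sub_zero] at this
    exact this.mono_left nhdsWithin_le_nhds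
  refine le_of_tendsto hlim ?_
  filter_upwards [self_mem_nhdsWithin] with κ hκ
  refine le_liminf_of_le (by isBoundedDefault) ?_
  filter_upwards [key κ hκ] with n hn using le_iInf hn

/-- Uniform asymptotic coverage is at most the nominal level. -/
theorem liminf_coverage_le [Nonempty ι] (hα0 : 0 < α) (hreparam : R.Reparam)
    (hcontraction : R.Contraction) (hquad : R.Quad) (hprior : R.Prior)
    (hMC : UnifLittleO S.P fun n i ω => (ξ n i ω - quantile (S.posterior n ω) (X n i ω) α).abs)
    (hg : ∀ i, Measurable (g i))
    (hup : ∀ ε : ℝ, 0 < ε → Whp S.P fun n i ω => ∀ θ ∈ R.Θosn n i,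
      X n i ω θ ≤ ((g i (R.driftProj n i ω - √(n : ℝ) • R.γ i θ) + ε : ℝ) : EReal))
    (hcov : ∀ ε : ℝ, 0 < ε → Whp S.P fun n i ω =>
      ω ∈ cover n i → ((g i (R.driftProj n i ω) - ε : ℝ) : EReal) ≤ ξ n i ω)
    (hdrift : ∀ i, ∀ n, 1 ≤ n → ∀ᵐ ω ∂(S.P i), g i (R.driftProj n i ω) = h i (R.V n i ω))
    (hK : R.KolmogorovConv h)
    (hlevel : ∀ i, ∀ κ : ℝ, 0 < κ → ∃ ε δ p : ℝ, 0 < ε ∧ 0 < δ ∧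
      (∀ v ∈ R.T i, α + δ ≤ gaussCdfOn (g i) (R.T i) v p) ∧
        gaussCdf (h i) (p + 4 * ε) ≤ α + κ) :
    liminf (fun n => ⨅ i, S.P i (cover n i)) atTop ≤ ENNReal.ofReal α := by
  -- One process suffices, because the infimum over the class is at most its coverage.
  obtain ⟨i⟩ := ‹Nonempty ι›
  have key : ∀ κ : ℝ, 0 < κ → ∀ᶠ n in atTop, S.P i (cover n i) ≤ ENNReal.ofReal (α + 3 * κ) := by
    intro κ hκ
    obtain ⟨ε, δ, p, hε, hδ, hp, hpG⟩ := hlevel i κ hκ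
    have hwhp := ((whp_criticalValue_le hα0 hreparam hcontraction hquad hprior hMC hg hup hε hδ
      hp).and (hcov ε hε)).and (whp_of_ae (P := S.P)
        (E := fun n i ω => g i (R.driftProj n i ω) = h i (R.V n i ω)) (by
          filter_upwards [eventually_ge_atTop 1] with n hn j using hdrift j n hn))
    filter_upwards [hwhp (ENNReal.ofReal κ) (ENNReal.ofReal_pos.2 hκ), hK κ hκ] with n hn hKn
    have := S.isProb i
    set z := p + 4 * ε with hz
    have hsub : cover n i ⊆ {ω | h i (R.V n i ω) ≤ z} ∪
        {ω | ¬(((i = i → ξ n i ω ≤ ((p + 2 * ε : ℝ) : EReal)) ∧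
          (ω ∈ cover n i → ((g i (R.driftProj n i ω) - ε : ℝ) : EReal) ≤ ξ n i ω)) ∧
            g i (R.driftProj n i ω) = h i (R.V n i ω))} := by
      intro ω hω
      by_contra hcon
      rw [Set.mem_union, not_or] at hcon
      obtain ⟨h1, h2⟩ := hcon
      obtain ⟨⟨h3, h4⟩, h5⟩ := not_not.1 h2
      refine h1 ?_
      have h6 := EReal.coe_le_coe_iff.1 ((h4 hω).trans (h3 rfl))
      change h i (R.V n i ω) ≤ z
      linarith
    have hG := (abs_le.1 (hKn i z)).2
    calc S.P i (cover n i) ≤ _ + _ := (measure_mono hsub).trans (measure_union_le _ _)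
      _ ≤ ENNReal.ofReal ((S.P i).real {ω | h i (R.V n i ω) ≤ z}) + ENNReal.ofReal κ :=
        add_le_add (ofReal_measureReal (measure_ne_top _ _)).ge (hn i)
      _ = ENNReal.ofReal ((S.P i).real {ω | h i (R.V n i ω) ≤ z} + κ) :=
        (ENNReal.ofReal_add measureReal_nonneg hκ.le).symm
      _ ≤ _ := ENNReal.ofReal_le_ofReal (by linarith)
  have hlim : Tendsto (fun κ : ℝ => ENNReal.ofReal (α + 3 * κ)) (𝓝[>] 0) (𝓝 (ENNReal.ofReal α)) := by
    have hc : Continuous fun κ : ℝ => ENNReal.ofReal (α + 3 * κ) :=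
      ENNReal.continuous_ofReal.comp (by fun_prop)
    have := hc.tendsto 0
    simp only [mul_zero, add_zero] at this
    exact this.mono_left nhdsWithin_le_nhds
  refine ge_of_tendsto hlim ?_
  filter_upwards [self_mem_nhdsWithin] with κ hκ
  refine liminf_le_of_frequently_le' (Eventually.frequently ?_)
  filter_upwards [key κ hκ] with n hn using (iInf_le _ i).trans hn

/-- Asymptotically exact coverage, from the two one-sided bounds. -/
theorem liminf_coverage_eq (hlower :
      ENNReal.ofReal α ≤ liminf (fun n => ⨅ i, innerProb (S.P i) (cover n i)) atTop)
    (hupper : liminf (fun n => ⨅ i, S.P i (cover n i)) atTop ≤ ENNReal.ofReal α) :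
    liminf (fun n => ⨅ i, innerProb (S.P i) (cover n i)) atTop = ENNReal.ofReal α ∧
      liminf (fun n => ⨅ i, S.P i (cover n i)) atTop = ENNReal.ofReal α := by
  have hle : liminf (fun n => ⨅ i, innerProb (S.P i) (cover n i)) atTop
      ≤ liminf (fun n => ⨅ i, S.P i (cover n i)) atTop := by
    refine liminf_le_liminf (Eventually.of_forall fun n => iInf_mono fun i => ?_)
    have := S.isProb i
    exact innerProb_le _ _
  exact ⟨le_antisymm (hle.trans hupper) hlower, le_antisymm hupper (hlower.trans hle)⟩

end LocalExpansion

/-! ### The two procedures: coverage events and levels. -/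

namespace LocalExpansion

variable {S : Model Ω ι 𝓜 𝓗 D} {R : LocalExpansion S} {α : ℝ}

theorem measurable_normSqProj (i : ι) : Measurable (R.normSqProj i) :=
  measurable_normSq_coneProj (R.T i)

theorem measurable_norm_sq (i : ι) : Measurable fun x : Eu (R.d i) => ‖x‖ ^ 2 := by fun_prop

theorem eventually_γ_eq_zero_of_mem_ΘI (hreparam : R.Reparam) : ∀ᶠ n in atTop, ∀ i, ∀ θ ∈ S.ΘI i,
    θ ∈ R.Θosn n i ∧ R.γ i θ = 0 ∧ R.γperp i θ = 0 := by
  filter_upwards [hreparam.subset_ΘN] with n hn i θ hθ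
  have h1 := hreparam.ΘI_subset n i hθ
  have h2 := (hreparam.zero_iff i θ (hn i h1)).2 hθ
  exact ⟨h1, congrArg Prod.fst h2, congrArg Prod.snd h2⟩

/-- The singular part adds `2 f_⊥ ≥ 0` to `Q_n` and can only raise the critical value, so it is
dropped for a lower bound. -/
theorem whp_le_Qn (hreparam : R.Reparam) (hcontraction : R.Contraction) (hquad : R.Quad) {ε : ℝ}
    (hε : 0 < ε) :
    Whp S.P fun n i ω => ∀ θ ∈ R.Θosn n i,
      ((‖R.driftProj n i ω - √(n : ℝ) • R.γ i θ‖ ^ 2 - ε : ℝ) : EReal) ≤ S.Qn n ω θ := by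
  refine (whp_Qn hreparam hcontraction hquad hε).mono ?_
  filter_upwards [hreparam.subset_ΘN] with n hn i ω h θ hθ
  obtain ⟨q, hq, hb⟩ := h θ hθ
  have h2 := hquad.fperp_nonneg n i ω _ (hreparam.mapsTo_γ i θ (hn i hθ)).2
  rw [hq, EReal.coe_le_coe_iff]
  linarith [(abs_le.1 hb).1]

theorem whp_Qn_le (hreparam : R.Reparam) (hcontraction : R.Contraction) (hquad : R.Quad)
    (hm : ∀ i, R.m i = 0) {ε : ℝ} (hε : 0 < ε) :
    Whp S.P fun n i ω => ∀ θ ∈ R.Θosn n i,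
      S.Qn n ω θ ≤ ((‖R.driftProj n i ω - √(n : ℝ) • R.γ i θ‖ ^ 2 + ε : ℝ) : EReal) := by
  refine (whp_Qn hreparam hcontraction hquad hε).mono (Eventually.of_forall ?_)
  intro n i ω h θ hθ
  obtain ⟨q, hq, hb⟩ := h θ hθ
  have : Subsingleton (Eu (R.m i)) := by rw [hm i]; infer_instance
  rw [Subsingleton.elim (R.γperp i θ) 0, hquad.fperp_zero] at hb
  rw [hq, EReal.coe_le_coe_iff]
  linarith [(abs_le.1 hb).2]

theorem whp_coverΘ (hreparam : R.Reparam) (hcontraction : R.Contraction) (hquad : R.Quad) {ε : ℝ}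
    (hε : 0 < ε) :
    Whp S.P fun n i ω =>
      (((‖R.driftProj n i ω‖ ^ 2 + ε : ℝ) : EReal) ≤ S.ξmc α n ω → ω ∈ S.coverΘ α n i) ∧
      (ω ∈ S.coverΘ α n i → ((‖R.driftProj n i ω‖ ^ 2 - ε : ℝ) : EReal) ≤ S.ξmc α n ω) := by
  refine (whp_Qn hreparam hcontraction hquad hε).mono ?_
  filter_upwards [eventually_γ_eq_zero_of_mem_ΘI hreparam] with n hn i ω h
  have h1 : ∀ θ ∈ S.ΘI i, ∃ q : ℝ, S.Qn n ω θ = q ∧ |q - ‖R.driftProj n i ω‖ ^ 2| ≤ ε := by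
    intro θ hθ
    obtain ⟨h2, h3, h4⟩ := hn i θ hθ
    obtain ⟨q, hq, hb⟩ := h θ h2
    rw [h3, h4, hquad.fperp_zero, smul_zero, sub_zero, mul_zero, add_zero] at hb
    exact ⟨q, hq, hb⟩
  constructor
  · intro hle θ hθ
    obtain ⟨q, hq, hb⟩ := h1 θ hθ
    change S.Qn n ω θ ≤ _
    rw [hq]
    exact (EReal.coe_le_coe_iff.2 (by linarith [(abs_le.1 hb).2])).trans hle
  · intro hcov
    obtain ⟨θ, hθ⟩ := S.nonempty_ΘI i
    obtain ⟨q, hq, hb⟩ := h1 θ hθ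
    have h2 : S.Qn n ω θ ≤ S.ξmc α n ω := hcov hθ
    rw [hq] at h2
    exact (EReal.coe_le_coe_iff.2 (by linarith [(abs_le.1 hb).1])).trans h2

theorem whp_coverM (hreparam : R.Reparam) (hcontraction : R.Contraction) (hquad : R.Quad)
    {f : (i : ι) → Eu (R.d i) → ℝ} (hf : R.Profile f) (heq : S.EquivIdentified) {ε : ℝ}
    (hε : 0 < ε) :
    Whp S.P fun n i ω =>
      (((f i (R.driftProj n i ω) + ε : ℝ) : EReal) ≤ S.ξmcp α n i ω → ω ∈ S.coverM α n i) ∧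
      (ω ∈ S.coverM α n i → ((f i (R.driftProj n i ω) - ε : ℝ) : EReal) ≤ S.ξmcp α n i ω) := by
  refine ((whp_PQn hreparam hcontraction hquad hf hε).and
    (whp_thetaHat hreparam hcontraction hquad hε)).mono ?_
  filter_upwards [eventually_γ_eq_zero_of_mem_ΘI hreparam, eventually_ge_atTop 1] with n hn hn1 i ω ⟨h, a, ha, _⟩
  obtain ⟨θ, hθ⟩ := S.nonempty_ΘI i
  obtain ⟨h2, h3, -⟩ := hn i θ hθ
  obtain ⟨q, hq, hb⟩ := h θ h2
  rw [h3, smul_zero, sub_zero] at hb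
  rw [S.mem_coverM_iff hn1 ha, ← heq i θ hθ, hq]
  exact ⟨fun hle => (EReal.coe_le_coe_iff.2 (by linarith [(abs_le.1 hb).2])).trans hle,
    fun hle => (EReal.coe_le_coe_iff.2 (by linarith [(abs_le.1 hb).1])).trans hle⟩

/-- Lower levels for Procedure 1: the conditional law of `‖Z‖²` has no atom at zero, so the
possible atom of `‖𝐓 Z‖²` is harmless. -/
theorem exists_level_normSqProj (hα0 : 0 < α) (hα1 : α < 1) (hreparam : R.Reparam)
    (hquad : R.Quad) {κ : ℝ} (hκ : 0 < κ) :
    ∃ ε δ : ℝ, 0 < ε ∧ 0 < δ ∧ ∃ p : ι → ℝ, ∀ i,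
      (∀ v ∈ R.T i, gaussCdfOn (fun x => ‖x‖ ^ 2) (R.T i) v (p i) ≤ α - δ) ∧
        α - κ ≤ gaussCdf (R.normSqProj i) (p i - 4 * ε) := by
  obtain ⟨dmax, hd⟩ := hreparam.dim
  obtain ⟨c, hc, hcT⟩ := hquad.exists_cone_mass
  obtain ⟨r, hr, hball⟩ := exists_gauss_closedBall_le dmax (η := ENNReal.ofReal (α / 2 * c))
    (ENNReal.ofReal_pos.2 (by positivity))
  -- Keeps the level `α - κ'/2` positive. The radius `r` makes the conditional probability of `‖Z‖²
  -- ≤ r²` at most `α/2`, so `r²` may serve as a floor for the quantiles, above which scaling gives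
  -- continuity.
  set κ' := min κ α with hκ'
  have hκ'0 : 0 < κ' := lt_min hκ hα0
  obtain ⟨ε, hε, hcont⟩ := exists_gaussCdf_normSq_coneProj_sub_le dmax (z₀ := r ^ 2) (κ := κ' / 2)
    (by positivity) (by positivity)
  set q : ι → ℝ := fun i => max (gaussQuantile (R.normSqProj i) (α - κ' / 2)) (r ^ 2) with hq
  have hlev0 : 0 < α - κ' / 2 := by linarith [min_le_right κ α]
  have hlev1 : α - κ' / 2 < 1 := by linarith
  refine ⟨ε / 5, min (α / 2) (κ' / 2), by positivity, by positivity, fun i => q i - ε / 5,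
    fun i => ⟨fun v hv => ?_, ?_⟩⟩
  -- At a genuine quantile the Gaussian comparison applies; at the floor `r²` the small-ball bound
  -- replaces it.
  · rcases max_choice (gaussQuantile (R.normSqProj i) (α - κ' / 2)) (r ^ 2) with h | h
    · have h1 := gaussCdfOn_normSq_le_gaussCdf (R.T i) v (q i - ε / 5)
      have h2 : gaussCdf (R.normSqProj i) (q i - ε / 5) < α - κ' / 2 :=
        gaussCdf_lt_of_lt_gaussQuantile (measurable_normSqProj i) hlev0 (by
          simp only [hq, h]; linarith)
      have h3 : gaussCdfOn (fun x => ‖x‖ ^ 2) (R.T i) v (q i - ε / 5) ≤ α - κ' / 2 := h1.trans h2.le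
      linarith [min_le_right (α / 2) (κ' / 2)]
    · have h1 : gaussCdfOn (fun x => ‖x‖ ^ 2) (R.T i) v (q i - ε / 5)
          ≤ gaussCdfOn (fun x => ‖x‖ ^ 2) (R.T i) v (r ^ 2) := by
        refine gaussCdfOn_mono _ _ _ ?_
        simp only [hq, h]; linarith
      have h2 := gaussCdfOn_le_div (g := fun x => ‖x‖ ^ 2) (R.T i) hv (r ^ 2) hc (hcT i)
      have h3 : (gauss (R.d i)).real {x | ‖x‖ ^ 2 ≤ r ^ 2} ≤ α / 2 * c := by
        have h4 := ENNReal.toReal_mono ENNReal.ofReal_ne_top (hball _ (hd i).1 (hd i).2)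
        rw [ENNReal.toReal_ofReal (by positivity)] at h4
        refine le_trans (measureReal_mono fun x hx => ?_) h4
        exact (pow_le_pow_iff_left₀ (norm_nonneg x) hr.le two_ne_zero).1 hx
      have h5 : (gauss (R.d i)).real {x | ‖x‖ ^ 2 ≤ r ^ 2} / c ≤ α / 2 := (div_le_iff₀ hc).2 h3
      linarith [min_le_left (α / 2) (κ' / 2)]
  · have h1 := hcont _ (hd i).2 (R.T i) (q i) (le_max_right _ _)
    have h2 : α - κ' / 2 ≤ gaussCdf (R.normSqProj i) (q i) :=
      (le_gaussCdf_gaussQuantile (measurable_normSqProj i) hlev1).trans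
        (gaussCdf_mono _ (le_max_left _ _))
    have h3 : q i - ε / 5 - 4 * (ε / 5) = q i - ε := by ring
    have h4 : gaussCdf (R.normSqProj i) (q i) ≤ gaussCdf (R.normSqProj i) (q i - ε) + κ' / 2 := h1
    rw [h3]
    linarith [min_le_left κ α]

/-- With `T` the whole space conditioning is void, and `‖Z‖²` has no atom at zero because `d ≥ 1`.
Its quantiles are therefore positive, and the scaling bound gives continuity there. -/
theorem exists_level_upper_normSq (hα0 : 0 < α) (hα1 : α < 1) {i : ι} (hd : 1 ≤ R.d i)
    (hT : (R.T i : Set (Eu (R.d i))) = Set.univ) {κ : ℝ} (hκ : 0 < κ) :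
    ∃ ε δ p : ℝ, 0 < ε ∧ 0 < δ ∧
      (∀ v ∈ R.T i, α + δ ≤ gaussCdfOn (fun x => ‖x‖ ^ 2) (R.T i) v p) ∧
        gaussCdf (R.normSqProj i) (p + 4 * ε) ≤ α + κ := by
  have hid : R.normSqProj i = fun x => ‖x‖ ^ 2 := by
    ext x
    have hx : x ∈ (R.T i : Set (Eu (R.d i))) := hT ▸ Set.mem_univ x
    rw [normSqProj, proj, coneProj_of_mem _ hx]
  set κ' := min κ (1 - α) with hκ'
  have hκ'0 : 0 < κ' := lt_min hκ (by linarith)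
  set p := gaussQuantile (R.normSqProj i) (α + κ' / 2) with hp
  have hG : α + κ' / 2 ≤ gaussCdf (R.normSqProj i) p :=
    le_gaussCdf_gaussQuantile (measurable_normSqProj i) (by linarith [min_le_right κ (1 - α)])
  have hp0 : 0 < p := by
    by_contra! hle
    have h1 := hG.trans (gaussCdf_mono _ hle)
    have h2 : gaussCdf (R.normSqProj i) 0 = 0 := by
      rw [hid, gaussCdf]
      have : {x : Eu (R.d i) | ‖x‖ ^ 2 ≤ 0} = {0} := by
        ext x
        simp only [Set.mem_ofPred_eq, Set.mem_singleton_iff]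
        rw [(sq_nonneg ‖x‖).ge_iff_eq']
        simp
      rw [this, measureReal_def, gauss_singleton_zero hd, ENNReal.toReal_zero]
    linarith
  obtain ⟨ε, hε, hcont⟩ := exists_gaussCdf_normSq_coneProj_sub_le (R.d i) (z₀ := p) (κ := κ / 2)
    hp0 (by positivity)
  refine ⟨ε / 8, κ' / 2, p, by positivity, by positivity, fun v _ => ?_, ?_⟩
  · rw [gaussCdfOn_of_univ hT, ← hid]
    exact hG
  · have h1 : gaussCdf (R.normSqProj i) (p + 4 * (ε / 8))
        ≤ gaussCdf (R.normSqProj i) (p + 4 * (ε / 8) - ε) + κ / 2 :=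
      hcont _ le_rfl (R.T i) (p + 4 * (ε / 8)) (by linarith)
    have h2 : gaussCdf (R.normSqProj i) (p + 4 * (ε / 8) - ε) < α + κ' / 2 :=
      gaussCdf_lt_of_lt_gaussQuantile (measurable_normSqProj i) (by linarith) (by linarith)
    linarith [min_le_left κ (1 - α)]

theorem EquicontAtQuantile.exists_level {f : (i : ι) → Eu (R.d i) → ℝ} (hf : R.Profile f)
    (heq : R.EquicontAtQuantile f α) {κ : ℝ} (hκ : 0 < κ) :
    ∃ ε δ : ℝ, 0 < ε ∧ 0 < δ ∧ ∃ p : ι → ℝ, ∀ i,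
      (∀ v ∈ R.T i, gaussCdfOn (f i) (R.T i) v (p i) ≤ α - δ) ∧
        α - κ ≤ gaussCdf (f i) (p i - 4 * ε) := by
  -- The gap `e` below the quantile is cut into five: one part puts `p` strictly below the quantile,
  -- four are the slack `4ε` for approximation errors.
  obtain ⟨e, he, he0⟩ := ((heq.limit.eventually (lt_mem_nhds (show α - κ < α by linarith))).and
    self_mem_nhdsWithin).exists
  have he0' : 0 < e := he0
  obtain ⟨δ, hδ, hinc⟩ := heq.increase (e / 5) (by positivity)
  refine ⟨e / 5, δ, by positivity, hδ, fun i => gaussQuantile (f i) α - e / 5,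
    fun i => ⟨fun v hv => (hf.cond_le i v hv _).trans (hinc i).le, ?_⟩⟩
  have h1 : gaussQuantile (f i) α - e / 5 - 4 * (e / 5) = gaussQuantile (f i) α - e := by ring
  rw [h1]
  refine he.le.trans (ciInf_le ⟨0, ?_⟩ i)
  rintro _ ⟨j, rfl⟩
  exact measureReal_nonneg

theorem RegularAtQuantile.exists_level_upper {f : (i : ι) → Eu (R.d i) → ℝ} (hf : R.Profile f)
    (hfe : R.ProfileEq f) (hreg : R.RegularAtQuantile f α) (i : ι) {κ : ℝ} (hκ : 0 < κ) :
    ∃ ε δ p : ℝ, 0 < ε ∧ 0 < δ ∧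
      (∀ v ∈ R.T i, α + δ ≤ gaussCdfOn (f i) (R.T i) v p) ∧
        gaussCdf (f i) (p + 4 * ε) ≤ α + κ := by
  set x := gaussQuantile (f i) α with hx
  have h1 := (gaussCdf_tendsto_right (hf.measurable_f i) x).mono_left
    (nhdsWithin_mono _ Set.Ioi_subset_Ici_self)
  rw [(hreg i).1] at h1
  -- No jump at the quantile gives `z` to its right with value below `α + κ`. Strict excess over `α`
  -- at one fifth of the way gives `δ`, and the other four fifths are `4ε`.
  obtain ⟨z, hz, hxz⟩ := ((h1.eventually (gt_mem_nhds (show α < α + κ by linarith))).and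
    self_mem_nhdsWithin).exists
  have hxz' : x < z := hxz
  have h2 := (hreg i).2 (x + (z - x) / 5) (by linarith)
  refine ⟨(z - x) / 5, gaussCdf (f i) (x + (z - x) / 5) - α, x + (z - x) / 5, by linarith,
    by linarith, fun v hv => ?_, ?_⟩
  · rw [hfe.cond_eq i v hv]; linarith
  · have h3 : x + (z - x) / 5 + 4 * ((z - x) / 5) = z := by ring
    rw [h3]
    exact hz.le

end LocalExpansion

end QuasiPosterior

end

/-! ### Assembly for both procedures. -/

open QuasiPosterior LocalExpansion in
theorem theoremt {Ω ι 𝓜 𝓗 D : Type*} [MeasurableSpace Ω] [MeasurableSpace 𝓜]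
    [MeasurableSpace 𝓗] [Nonempty ι] (S : QuasiPosterior.Model Ω ι 𝓜 𝓗 D)
    (R : QuasiPosterior.LocalExpansion S) (α : ℝ) (hα0 : 0 < α) (hα1 : α < 1)
    (hreparam : R.Reparam) (hcontraction : R.Contraction) (hquad : R.Quad) (hprior : R.Prior) :
    (S.MCConv α → R.KolmogorovConv R.normSqProj →
      ((∀ i, ∀ n, 1 ≤ n → ∀ᵐ ω ∂(S.P i),
          ‖R.driftProj n i ω‖ ^ 2 ≤ ‖R.proj i (R.V n i ω)‖ ^ 2) →
        ENNReal.ofReal α ≤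
          liminf (fun n => ⨅ i, QuasiPosterior.innerProb (S.P i) (S.coverΘ α n i)) atTop) ∧
      ((∀ i, R.m i = 0) → (∀ i, (R.T i : Set (QuasiPosterior.Eu (R.d i))) = Set.univ) →
        liminf (fun n => ⨅ i, QuasiPosterior.innerProb (S.P i) (S.coverΘ α n i)) atTop
            = ENNReal.ofReal α ∧
          liminf (fun n => ⨅ i, S.P i (S.coverΘ α n i)) atTop = ENNReal.ofReal α)) ∧
    (∀ f : (i : ι) → QuasiPosterior.Eu (R.d i) → ℝ,
      S.EquivIdentified → R.Profile f → S.MCConvProfile α → R.KolmogorovConv f →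
      R.EquicontAtQuantile f α →
      ENNReal.ofReal α ≤
          liminf (fun n => ⨅ i, QuasiPosterior.innerProb (S.P i) (S.coverM α n i)) atTop ∧
      (R.ProfileEq f → R.RegularAtQuantile f α →
        liminf (fun n => ⨅ i, QuasiPosterior.innerProb (S.P i) (S.coverM α n i)) atTop
            = ENNReal.ofReal α ∧
          liminf (fun n => ⨅ i, S.P i (S.coverM α n i)) atTop = ENNReal.ofReal α)) := by
  constructor
  · intro hMC hK
    have hlower : (∀ i, ∀ n, 1 ≤ n → ∀ᵐ ω ∂(S.P i),
          ‖R.driftProj n i ω‖ ^ 2 ≤ ‖R.proj i (R.V n i ω)‖ ^ 2) →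
        ENNReal.ofReal α ≤
          liminf (fun n => ⨅ i, innerProb (S.P i) (S.coverΘ α n i)) atTop := fun hdrift =>
      -- The posterior statistic `‖x‖²` and the sampling statistic `‖𝐓 x‖²` differ here; the level
      -- lemma bridges them.
      le_liminf_coverage (X := fun n _ ω => S.Qn n ω) (ξ := fun n _ ω => S.ξmc α n ω)
        (g := fun i x => ‖x‖ ^ 2) (h := R.normSqProj) hα0 hreparam hcontraction hquad hprior hMC
        measurable_norm_sq measurable_normSqProj
        (fun ε hε => whp_le_Qn hreparam hcontraction hquad hε)
        (fun ε hε => (whp_coverΘ hreparam hcontraction hquad hε).mono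
          (Eventually.of_forall fun n i ω h => h.1)) hdrift hK
        (fun κ hκ => exists_level_normSqProj hα0 hα1 hreparam hquad hκ)
    refine ⟨hlower, fun hm hT => ?_⟩
    have hproj : ∀ i (x : Eu (R.d i)), R.proj i x = x := fun i x =>
      coneProj_of_mem _ (show x ∈ (R.T i : Set (Eu (R.d i))) from hT i ▸ Set.mem_univ x)
    have hdrift : ∀ n i ω, R.driftProj n i ω = R.V n i ω := fun n i ω => by
      rw [driftProj, hproj, add_sub_cancel_right]
    refine liminf_coverage_eq (hlower fun i n _ => Eventually.of_forall fun ω => ?_)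
      (liminf_coverage_le (X := fun n _ ω => S.Qn n ω) (ξ := fun n _ ω => S.ξmc α n ω)
        (g := fun i x => ‖x‖ ^ 2) (h := R.normSqProj) hα0 hreparam hcontraction hquad hprior hMC
        measurable_norm_sq (fun ε hε => whp_Qn_le hreparam hcontraction hquad hm hε)
        (fun ε hε => (whp_coverΘ hreparam hcontraction hquad hε).mono
          (Eventually.of_forall fun n i ω h => h.2))
        (fun i n _ => Eventually.of_forall fun ω => ?_) hK
        (fun i κ hκ => exists_level_upper_normSq hα0 hα1 (hreparam.dim.choose_spec i).1 (hT i) hκ))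
    · rw [hdrift, hproj]
    · rw [hdrift, normSqProj, hproj]
  · intro f heq hf hMC hK hcont
    have hlower : ENNReal.ofReal α ≤
        liminf (fun n => ⨅ i, innerProb (S.P i) (S.coverM α n i)) atTop :=
      le_liminf_coverage (X := fun n i ω θ => S.PQn n ω (S.Mset i θ))
        (ξ := fun n i ω => S.ξmcp α n i ω) (g := f) (h := f) hα0 hreparam hcontraction hquad hprior
        hMC hf.measurable_f hf.measurable_f
        (fun ε hε => (whp_PQn hreparam hcontraction hquad hf hε).mono
          (Eventually.of_forall fun n i ω h θ hθ => by
            obtain ⟨q, hq, hb⟩ := h θ hθ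
            rw [hq, EReal.coe_le_coe_iff]
            linarith [(abs_le.1 hb).1]))
        (fun ε hε => (whp_coverM hreparam hcontraction hquad hf heq hε).mono
          (Eventually.of_forall fun n i ω h => h.1)) hf.drift_le hK
        (fun κ hκ => hcont.exists_level hf hκ)
    refine ⟨hlower, fun hfe hreg => liminf_coverage_eq hlower ?_⟩
    exact liminf_coverage_le (X := fun n i ω θ => S.PQn n ω (S.Mset i θ))
      (ξ := fun n i ω => S.ξmcp α n i ω) (g := f) (h := f) hα0 hreparam hcontraction hquad hprior
      hMC hf.measurable_f
      (fun ε hε => (whp_PQn hreparam hcontraction hquad hf hε).mono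
        (Eventually.of_forall fun n i ω h θ hθ => by
          obtain ⟨q, hq, hb⟩ := h θ hθ
          rw [hq, EReal.coe_le_coe_iff]
          linarith [(abs_le.1 hb).2]))
      (fun ε hε => (whp_coverM hreparam hcontraction hquad hf heq hε).mono
        (Eventually.of_forall fun n i ω h => h.2)) hfe.drift_eq hK
      (fun i κ hκ => hreg.exists_level_upper hf hfe i hκ)
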